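/- Let $\mathbb K$ be a field of characteristic zero, $q\in\mathbb K\setminus\{0\}$ and $n\ge 1$ an integer. For a tuple $\bar q=(q_1,\dots,q_n)$ of nonzero elements of $\mathbb K$ let $$\mathcal O_{\bar q}(\mathbb K^{2n})=\mathbb K\langle x_1,\dots,x_n,y_1,\dots,y_n\mid y_ix_j=q_i^{\delta_{ij}}x_jy_i,\ [x_i,x_j]=[y_i,y_j]=0\ (1\le i,j\le n)\rangle ,$$ an Ore domain, and let $\mathcal F_{\bar q,n}$ be its skew field of fractions; for $\bar q=(q,\dots,q)$ write $\mathcal O_q(\mathbb K^{2n})$ and $\mathcal F_{q,n}$. The group $W(B_n)=W(C_n)=S_n\ltimes(\mathbb Z/2\mathbb Z)^n$ acts on $\mathcal O_q(\mathbb K^{2n})$, hence on $\mathcal F_{q,n}$, by $\mathbb K$-algebra automorphisms with $\sigma(x_i)=x_{\sigma(i)}$, $\sigma(y_i)=y_{\sigma(i)}$ for $\sigma\in S_n$, and $\alpha(x_i)=(-1)^{\alpha_i}x_i$, $\alpha(y_i)=(-1)^{\alpha_i}y_i$ for $\alpha\in(\mathbb Z/2\mathbb Z)^n$. Let $W(D_n)=S_n\ltimes\{\alpha\mid\alpha_1+\dots+\alpha_n=0\}$.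 **(1)** For each $W_n\in\{S_n,W(B_n)=W(C_n),W(D_n)\}$ there is an isomorphism of $\mathbb K$-algebras $\mathcal F_{q,n}^{W_n}\simeq\mathcal F_{\bar q,n}$, where $$\bar q=\begin{cases}(q,q,\dots,q),&W_n=S_n,\\(q^2,q^2,\dots,q^2),&W_n=W(B_n)=W(C_n),\\(q,q^2,\dots,q^2),&W_n=W(D_n).\end{cases}$$ **(2)** There is an isomorphism of $\mathbb K$-algebras $\mathcal F_{q,n}^{W(B_n)}\simeq\mathcal F_{q^2,n}^{S_n}$. **(3)** For $S_n$ there is the following explicit isomorphism. Let $e_d$ $(0\le d\le n)$ be the elementary symmetric polynomial of degree $d$ in $x_1,\dots,x_n$, and for $1\le i\le n$ let $$t_i=\sum_{j=1}^n\frac{(-1)^{n-i}\,e'_{n-i}(x_1,\dots,\widehat{x_j},\dots,x_n)}{\prod_{k\ne j}(x_j-x_k)}\,y_j\in\mathcal F_{q,n},$$ where $e'_d$ is the elementary symmetric polynomial of degree $d$ in $n-1$ variables. Define $e_k^{(i)}$ for $0\le i\le n$, $0\le k\le n-i$ by $e^{(0)}_k=e_k$, $e^{(1)}_k=t_{k+1}$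 and, for $i\ge 2$, $$e_k^{(i)}=e_{k+1}^{(i-2)}e_0^{(i-1)}e_{n-i+1}^{(i-1)}-(-1)^{k+1}e_0^{(i-2)}e_{n-i-k}^{(i-1)}e_0^{(i-1)}-(-1)^{n-i+1-k}e_{n-i+2}^{(i-2)}e_{n-i+1-k}^{(i-1)}e_{n-i+1}^{(i-1)} .$$ Put $X_i=e_{n-i+1}^{(i-1)}$ and $Y_i=e_0^{(i)}$ for $1\le i\le n$. Then all $e_k^{(i)}$ lie in $\mathcal F_{q,n}^{S_n}$, all $X_i$ and $Y_i$ are nonzero, and with $$\widehat X_1=X_1,\quad \widehat X_i=Y_{i-1}^{(-1)^i}X_i^{(-1)^{i+1}}\ (2\le i\le n),\qquad \widehat Y_1=Y_1,\quad \widehat Y_2=Y_1^{-2}Y_2,\quad \widehat Y_j=Y_{j-2}^{-1}Y_{j-1}^{-2}Y_j\ (3\le j\le n)$$ there is an isomorphism of $\mathbb K$-algebras $\mathcal F_{q,n}\to\mathcal F_{q,n}^{S_n}$ with $x_k\mapsto\widehat X_k$ and $y_k\mapsto\widehat Y_k$ for $1\le k\le n$. -/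

import Mathlib

open scoped nonZeroDivisors

section TwistedBasis

open Classical in
theorem twisted_repr_mul {K A σ : Type*} [Field K] [Ring A] [Algebra K A]
    (b : Module.Basis (σ →₀ ℕ) K A) (c : (σ →₀ ℕ) → (σ →₀ ℕ) → Kˣ)
    (h : ∀ s t, b s * b t = (c s t : K) • b (s + t)) (u v : A) (r : σ →₀ ℕ) :
    b.repr (u * v) r = ∑ s ∈ (b.repr u).support, ∑ t ∈ (b.repr v).support,
      if s + t = r then b.repr u s * b.repr v t * (c s t : K) else 0 := by
  classical
  have hu : u = ∑ s ∈ (b.repr u).support, b.repr u s • b s := (b.linearCombination_repr u).symm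
  have hv : v = ∑ s ∈ (b.repr v).support, b.repr v s • b s := (b.linearCombination_repr v).symm
  conv_lhs => rw [hu, hv]
  rw [Finset.sum_mul_sum]
  simp only [smul_mul_smul_comm, h, map_sum, map_smul, Module.Basis.repr_self, Finsupp.coe_finsetSum,
    Finset.sum_apply, Finsupp.smul_apply, smul_eq_mul, Finsupp.single_apply, mul_ite, mul_one, mul_zero]

theorem twisted_noZeroDivisors {K A σ : Type*} [Field K] [Ring A] [Algebra K A]
    (b : Module.Basis (σ →₀ ℕ) K A) (c : (σ →₀ ℕ) → (σ →₀ ℕ) → Kˣ)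
    (h : ∀ s t, b s * b t = (c s t : K) • b (s + t)) : NoZeroDivisors A where
  eq_zero_or_eq_zero_of_mul_eq_zero {u v} huv := by
    contrapose! huv
    have hu : (b.repr u).support.Nonempty := by simpa using huv.1
    have hv : (b.repr v).support.Nonempty := by simpa using huv.2
    obtain ⟨s, hs, t, ht, hst⟩ := UniqueSums.uniqueAdd_of_nonempty hu hv
    intro h0
    have h1 := twisted_repr_mul b c h u v (s + t)
    rw [h0, map_zero, Finsupp.zero_apply, Finset.sum_eq_single s, Finset.sum_eq_single t, if_pos rfl] at h1
    · rw [Finsupp.mem_support_iff] at hs ht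
      exact mul_ne_zero (mul_ne_zero hs ht) (c s t).ne_zero h1.symm
    · intro t' ht' hne
      rw [if_neg]
      intro h2
      exact hne (hst hs ht' h2).2
    · intro h2; exact absurd ht h2
    · intro s' hs' hne
      refine Finset.sum_eq_zero fun t' ht' => ?_
      rw [if_neg]
      intro h2
      exact hne (hst hs' ht' h2).1
    · intro h2; exact absurd hs h2

theorem exists_box_card (m d : ℕ) : ∃ N : ℕ, (N + d) ^ m < 2 * N ^ m := by
  have h1 : Filter.Tendsto (fun N : ℕ => (1 + (d : ℝ) / N) ^ m) Filter.atTop (nhds ((1 + 0) ^ m)) :=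
    (tendsto_const_nhds.add (tendsto_const_div_atTop_nhds_zero_nat (d : ℝ))).pow m
  have h2 : ∀ᶠ N : ℕ in Filter.atTop, (1 + (d : ℝ) / N) ^ m < 2 :=
    h1.eventually_lt_const (by norm_num)
  obtain ⟨N, hN, hN0⟩ := (h2.and (Filter.eventually_gt_atTop 0)).exists
  refine ⟨N, ?_⟩
  have hN' : (0 : ℝ) < N := by exact_mod_cast hN0
  have h3 : ((N : ℝ) + d) ^ m = (1 + (d : ℝ) / N) ^ m * N ^ m := by
    rw [← mul_pow]; congr 1; field_simp
  have h4 : ((N : ℝ) + d) ^ m < 2 * N ^ m := by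
    rw [h3]; exact mul_lt_mul_of_pos_right hN (by positivity)
  exact_mod_cast h4

theorem twisted_ore {K A σ : Type*} [Fintype σ] [Field K] [Ring A] [Algebra K A]
    (b : Module.Basis (σ →₀ ℕ) K A) (c : (σ →₀ ℕ) → (σ →₀ ℕ) → Kˣ)
    (h : ∀ s t, b s * b t = (c s t : K) • b (s + t)) (x y : A) (hy : y ≠ 0) :
    ∃ u v : A, v ≠ 0 ∧ v * x = u * y := by
  classical
  have := twisted_noZeroDivisors b c h
  obtain ⟨d, hd⟩ : ∃ d : ℕ, ∀ t ∈ (b.repr x).support ∪ (b.repr y).support, ∀ i, t i < d := by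
    refine ⟨(((b.repr x).support ∪ (b.repr y).support).sup fun t => Finset.univ.sup t) + 1, ?_⟩
    intro t ht i
    have h1 : t i ≤ Finset.univ.sup t := Finset.le_sup (f := t) (Finset.mem_univ i)
    have h2 := Finset.le_sup (f := fun t : σ →₀ ℕ => Finset.univ.sup t) ht
    exact Nat.lt_succ_of_le (h1.trans h2)
  obtain ⟨N, hN⟩ := exists_box_card (Fintype.card σ) d
  let ext (M : ℕ) (p : σ → Fin M) : σ →₀ ℕ := Finsupp.equivFunOnFinite.symm fun i => (p i : ℕ)
  have ext_inj (M : ℕ) : Function.Injective (ext M) := by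
    intro p p' hp
    funext i
    exact Fin.ext (DFunLike.congr_fun hp i)
  let f : ((σ → Fin N) → K) →ₗ[K] A := Fintype.linearCombination K (fun p => b (ext N p))
  have f_inj : Function.Injective f := by
    have := (b.linearIndependent.comp _ (ext_inj N))
    exact linearIndependent_iff_injective_fintypeLinearCombination.1 this
  let T : ((σ → Fin N) → K) × ((σ → Fin N) → K) →ₗ[K] ((σ → Fin (N + d)) → K) :=
    LinearMap.pi fun p => (Finsupp.lapply (ext (N + d) p)) ∘ₗ b.repr.toLinearMap ∘ₗ
      ((LinearMap.mulRight K x ∘ₗ f ∘ₗ LinearMap.fst _ _ _) -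
        (LinearMap.mulRight K y ∘ₗ f ∘ₗ LinearMap.snd _ _ _))
  have hker : LinearMap.ker T ≠ ⊥ := by
    apply LinearMap.ker_ne_bot_of_finrank_lt
    simp only [Module.finrank_prod, Module.finrank_fintype_fun_eq_card, Fintype.card_fun,
      Fintype.card_fin]
    omega
  obtain ⟨⟨p, p'⟩, hp, hp0⟩ := (Submodule.ne_bot_iff _).1 hker
  have fsupp : ∀ (w : (σ → Fin N) → K) (s : σ →₀ ℕ), b.repr (f w) s ≠ 0 → ∀ i, s i < N := by
    intro w s hs
    have : f w = ∑ p, w p • b (ext N p) := rfl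
    rw [this] at hs
    simp only [map_sum, map_smul, Module.Basis.repr_self, Finsupp.coe_finsetSum, Finset.sum_apply,
      Finsupp.smul_apply, smul_eq_mul, Finsupp.single_apply, mul_ite, mul_one, mul_zero] at hs
    obtain ⟨p, -, hp⟩ := Finset.exists_ne_zero_of_sum_ne_zero hs
    intro i
    have : ext N p = s := by
      by_contra hne; exact hp (if_neg hne)
    rw [← this]
    exact (p i).2
  have box : ∀ (w : (σ → Fin N) → K) (z : A), (∀ t ∈ (b.repr z).support, ∀ i, t i < d) →
      ∀ r : σ →₀ ℕ, (¬ ∀ i, r i < N + d) → b.repr (f w * z) r = 0 := by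
    intro w z hz r hr
    rw [twisted_repr_mul b c h]
    refine Finset.sum_eq_zero fun s hs => Finset.sum_eq_zero fun t ht => if_neg ?_
    rintro rfl
    apply hr
    intro i
    have h1 := fsupp w s (Finsupp.mem_support_iff.1 hs) i
    have h2 := hz t ht i
    simp only [Finsupp.add_apply]
    omega
  have key : f p * x = f p' * y := by
    rw [← sub_eq_zero]
    apply b.repr.injective
    ext r
    rw [map_zero, Finsupp.zero_apply]
    by_cases hr : ∀ i, r i < N + d
    · have h1 := congrFun (LinearMap.mem_ker.1 hp) fun i => ⟨r i, hr i⟩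
      have h2 : ext (N + d) (fun i => ⟨r i, hr i⟩) = r := by ext i; rfl
      simpa [T, h2] using h1
    · rw [map_sub, Finsupp.sub_apply, box p x (fun t ht => hd t (Finset.mem_union_left _ ht)) r hr,
        box p' y (fun t ht => hd t (Finset.mem_union_right _ ht)) r hr, sub_zero]
  refine ⟨f p', f p, ?_, key⟩
  intro h0
  rw [h0, zero_mul] at key
  have h1 : f p' = 0 := (mul_eq_zero.1 key.symm).resolve_right hy
  apply hp0
  rw [Prod.mk_eq_zero]
  exact ⟨f_inj (by rw [h0, map_zero]), f_inj (by rw [h1, map_zero])⟩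

end TwistedBasis

noncomputable section QuantumAffine

open scoped IsMulCommutative in
/-- The homomorphism `K[X_i : i ∈ ι] → A`, `X_i ↦ x_i`, for commuting elements `x_i` of `A`. -/
def commEval {K A ι : Type*} [Field K] [Ring A] [Algebra K A] (x : ι → A)
    (hx : ∀ i j, x i * x j = x j * x i) : MvPolynomial ι K →ₐ[K] A :=
  haveI := Algebra.isMulCommutative_adjoin K (s := Set.range x)
    (by rintro _ ⟨i, rfl⟩ _ ⟨j, rfl⟩; exact hx i j)
  (Algebra.adjoin K (Set.range x)).val.comp
    (MvPolynomial.aeval fun i => ⟨x i, Algebra.subset_adjoin ⟨i, rfl⟩⟩)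

@[simp] theorem commEval_X {K A ι : Type*} [Field K] [Ring A] [Algebra K A] (x : ι → A)
    (hx : ∀ i j, x i * x j = x j * x i) (i : ι) :
    commEval (K := K) x hx (MvPolynomial.X i) = x i := by
  simp [commEval]

/-- The relations `x_i x_j = x_j x_i`, `y_i y_j = y_j y_i`, `y_i x_j = q_i^{δ_{ij}} x_j y_i` in the free
algebra on `x_i` (the letters `inl i`) and `y_i` (the letters `inr i`). -/
inductive QAffineRel {K : Type*} [Field K] {n : ℕ} (q : Fin n → Kˣ) :
    FreeAlgebra K (Fin n ⊕ Fin n) → FreeAlgebra K (Fin n ⊕ Fin n) → Prop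
  | xx (i j : Fin n) : QAffineRel q
      (FreeAlgebra.ι K (Sum.inl i) * FreeAlgebra.ι K (Sum.inl j))
      (FreeAlgebra.ι K (Sum.inl j) * FreeAlgebra.ι K (Sum.inl i))
  | yy (i j : Fin n) : QAffineRel q
      (FreeAlgebra.ι K (Sum.inr i) * FreeAlgebra.ι K (Sum.inr j))
      (FreeAlgebra.ι K (Sum.inr j) * FreeAlgebra.ι K (Sum.inr i))
  | yx (i j : Fin n) : QAffineRel q
      (FreeAlgebra.ι K (Sum.inr i) * FreeAlgebra.ι K (Sum.inl j))
      ((if i = j then (q i : K) else 1) •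
        (FreeAlgebra.ι K (Sum.inl j) * FreeAlgebra.ι K (Sum.inr i)))

/-- The quantum affine space `O_q̄(K^{2n}) = O_{q_1}(K²) ⊗ ⋯ ⊗ O_{q_n}(K²)`, by generators and
relations. -/
def QAffine {K : Type*} [Field K] {n : ℕ} (q : Fin n → Kˣ) : Type _ := RingQuot (QAffineRel q)

namespace QAffine

variable {K : Type*} [Field K] {n : ℕ} (q : Fin n → Kˣ)

instance : Ring (QAffine q) := inferInstanceAs (Ring (RingQuot (QAffineRel q)))
instance : Algebra K (QAffine q) := inferInstanceAs (Algebra K (RingQuot (QAffineRel q)))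

/-- The quotient map from the free algebra. -/
def mk : FreeAlgebra K (Fin n ⊕ Fin n) →ₐ[K] QAffine q := RingQuot.mkAlgHom K (QAffineRel q)

/-- The generator `x_i`. -/
def x (i : Fin n) : QAffine q := mk q (FreeAlgebra.ι K (Sum.inl i))

/-- The generator `y_i`. -/
def y (i : Fin n) : QAffine q := mk q (FreeAlgebra.ι K (Sum.inr i))

theorem x_mul_x (i j : Fin n) : x q i * x q j = x q j * x q i := by
  unfold x
  rw [← map_mul, ← map_mul]
  exact RingQuot.mkAlgHom_rel K (QAffineRel.xx i j)

theorem y_mul_y (i j : Fin n) : y q i * y q j = y q j * y q i := by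
  unfold y
  rw [← map_mul, ← map_mul]
  exact RingQuot.mkAlgHom_rel K (QAffineRel.yy i j)

theorem y_mul_x (i j : Fin n) :
    y q i * x q j = (if i = j then (q i : K) else 1) • (x q j * y q i) := by
  unfold x y
  rw [← map_mul, ← map_mul, ← map_smul]
  exact RingQuot.mkAlgHom_rel K (QAffineRel.yx i j)

/-- The universal property of the presentation. -/
def lift {B : Type*} [Ring B] [Algebra K B] (a b : Fin n → B)
    (haa : ∀ i j, a i * a j = a j * a i) (hbb : ∀ i j, b i * b j = b j * b i)
    (hba : ∀ i j, b i * a j = (if i = j then (q i : K) else 1) • (a j * b i)) :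
    QAffine q →ₐ[K] B :=
  RingQuot.liftAlgHom K ⟨FreeAlgebra.lift K (Sum.elim a b), by
    rintro _ _ (⟨i, j⟩ | ⟨i, j⟩ | ⟨i, j⟩)
    · simpa using haa i j
    · simpa using hbb i j
    · rw [map_mul, map_smul, map_mul]; simpa only [FreeAlgebra.lift_ι_apply, Sum.elim_inl, Sum.elim_inr] using hba i j⟩

section
variable {q} {B : Type*} [Ring B] [Algebra K B] (a b : Fin n → B)
    (haa : ∀ i j, a i * a j = a j * a i) (hbb : ∀ i j, b i * b j = b j * b i)
    (hba : ∀ i j, b i * a j = (if i = j then (q i : K) else 1) • (a j * b i))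

@[simp] theorem lift_x (i : Fin n) : lift q a b haa hbb hba (x q i) = a i := by
  refine (RingQuot.liftAlgHom_mkAlgHom_apply K _ _ _).trans ?_
  simp

@[simp] theorem lift_y (i : Fin n) : lift q a b haa hbb hba (y q i) = b i := by
  refine (RingQuot.liftAlgHom_mkAlgHom_apply K _ _ _).trans ?_
  simp

theorem hom_ext {f g : QAffine q →ₐ[K] B} (hx : ∀ i, f (x q i) = g (x q i))
    (hy : ∀ i, f (y q i) = g (y q i)) : f = g := by
  refine RingQuot.ringQuot_ext' K f g ?_
  ext (i | i)
  · exact hx i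
  · exact hy i
end

theorem induction_left {P : QAffine q → Prop} (h0 : P 1) (hadd : ∀ a b, P a → P b → P (a + b))
    (hsmul : ∀ (c : K) a, P a → P (c • a)) (hx : ∀ i a, P a → P (x q i * a))
    (hy : ∀ i a, P a → P (y q i * a)) (a : QAffine q) : P a := by
  obtain ⟨w, rfl⟩ := RingQuot.mkAlgHom_surjective K (QAffineRel q) a
  suffices ∀ z, P z → P (mk q w * z) by simpa [mk] using! this 1 h0
  induction w using FreeAlgebra.induction with
  | grade0 c =>
    intro z hz
    rw [AlgHom.commutes, ← Algebra.smul_def]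
    exact hsmul c z hz
  | grade1 i =>
    rcases i with i | i
    · exact hx i
    · exact hy i
  | mul u v hu hv =>
    intro z hz
    rw [map_mul, mul_assoc]
    exact hu _ (hv _ hz)
  | add u v hu hv =>
    intro z hz
    rw [map_add, add_mul]
    exact hadd _ _ (hu _ hz) (hv _ hz)

/-- The homomorphism `K[X_1, …, X_n] → O_q̄(K^{2n})`, `X_i ↦ x_i`. -/
def px : MvPolynomial (Fin n) K →ₐ[K] QAffine q := commEval (x q) (x_mul_x q)

/-- The homomorphism `K[X_1, …, X_n] → O_q̄(K^{2n})`, `X_i ↦ y_i`. -/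
def py : MvPolynomial (Fin n) K →ₐ[K] QAffine q := commEval (y q) (y_mul_y q)

/-- The automorphism `x_i ↦ q_i x_i` fixing the other variables. -/
def shift (i : Fin n) : MvPolynomial (Fin n ⊕ Fin n) K →ₐ[K] MvPolynomial (Fin n ⊕ Fin n) K :=
  MvPolynomial.aeval fun k =>
    (if k = Sum.inl i then (q i : K) else 1) • MvPolynomial.X k

/-- The representation on `K[x_1, …, x_n, y_1, …, y_n]` by left multiplication, in terms of the
basis of ordered monomials. -/
def rep : QAffine q →ₐ[K] Module.End K (MvPolynomial (Fin n ⊕ Fin n) K) :=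
  lift q (fun i => LinearMap.mulLeft K (MvPolynomial.X (Sum.inl i)))
    (fun i => LinearMap.mulLeft K (MvPolynomial.X (Sum.inr i)) ∘ₗ (shift q i).toLinearMap)
    (fun i j => LinearMap.ext fun f => by simp [mul_left_comm])
    (fun i j => by
      have hc : (shift q i).comp (shift q j) = (shift q j).comp (shift q i) := by
        ext k : 1
        simp only [shift, AlgHom.comp_apply, MvPolynomial.aeval_X, map_smul, smul_smul]
        rw [mul_comm]
      refine LinearMap.ext fun f => ?_
      have := DFunLike.congr_fun hc f
      simp only [AlgHom.comp_apply] at this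
      simp only [Module.End.mul_apply, LinearMap.comp_apply, LinearMap.mulLeft_apply,
        AlgHom.toLinearMap_apply, map_mul, this]
      simp [shift, mul_left_comm])
    (fun i j => by
      refine LinearMap.ext fun f => ?_
      simp only [Module.End.mul_apply, LinearMap.comp_apply, LinearMap.mulLeft_apply,
        AlgHom.toLinearMap_apply, map_mul, LinearMap.smul_apply]
      simp only [shift, MvPolynomial.aeval_X, Sum.inl.injEq, eq_comm (a := j), smul_mul_assoc,
        mul_smul_comm, mul_left_comm])

/-- `a` acts on monomials as the monomial of exponent `s`, up to nonzero scalars. -/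
def IsMono (a : QAffine q) (s : Fin n ⊕ Fin n →₀ ℕ) : Prop :=
  ∀ t, ∃ c : Kˣ, rep q a (MvPolynomial.monomial t 1) = MvPolynomial.monomial (s + t) (c : K)

theorem isMono_one : IsMono q 1 0 := fun t => ⟨1, by simp⟩

variable {q} in
theorem IsMono.mul {a b : QAffine q} {s t : Fin n ⊕ Fin n →₀ ℕ} (ha : IsMono q a s)
    (hb : IsMono q b t) : IsMono q (a * b) (s + t) := by
  intro r
  obtain ⟨c, hc⟩ := hb r
  obtain ⟨d, hd⟩ := ha (t + r)
  refine ⟨c * d, ?_⟩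
  rw [map_mul, Module.End.mul_apply, hc, ← mul_one (c : K), ← smul_eq_mul,
    ← MvPolynomial.smul_monomial, map_smul, hd, MvPolynomial.smul_monomial, add_assoc]
  simp

theorem isMono_x (i : Fin n) : IsMono q (x q i) (Finsupp.single (Sum.inl i) 1) := by
  intro t
  refine ⟨1, ?_⟩
  simp [rep, MvPolynomial.X, MvPolynomial.monomial_mul]

theorem shift_monomial (i : Fin n) (t : Fin n ⊕ Fin n →₀ ℕ) :
    shift q i (MvPolynomial.monomial t 1) =
      MvPolynomial.monomial t (((q i) ^ t (Sum.inl i) : Kˣ) : K) := by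
  rw [shift, MvPolynomial.aeval_monomial, map_one, one_mul, MvPolynomial.monomial_eq]
  simp only [MvPolynomial.smul_eq_C_mul, mul_pow, Finsupp.prod_mul]
  congr 1
  rw [Finsupp.prod_eq_single (Sum.inl i)]
  · simp
  · intro k _ hk; simp [hk]
  · simp

theorem isMono_y (i : Fin n) : IsMono q (y q i) (Finsupp.single (Sum.inr i) 1) := by
  intro t
  refine ⟨q i ^ t (Sum.inl i), ?_⟩
  simp only [rep, lift_y, LinearMap.comp_apply, AlgHom.toLinearMap_apply, shift_monomial,
    LinearMap.mulLeft_apply, MvPolynomial.X, MvPolynomial.monomial_mul, one_mul]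

/-- The ordered monomial `x^α y^β`. -/
def mono (s : Fin n ⊕ Fin n →₀ ℕ) : QAffine q :=
  px q (MvPolynomial.monomial (s.comapDomain Sum.inl Sum.inl_injective.injOn) 1) *
    py q (MvPolynomial.monomial (s.comapDomain Sum.inr Sum.inr_injective.injOn) 1)

theorem isMono_px (s : Fin n →₀ ℕ) :
    IsMono q (px q (MvPolynomial.monomial s 1)) (s.mapDomain Sum.inl) := by
  induction s using Finsupp.induction_linear with
  | zero => simpa using isMono_one q
  | add s t hs ht =>
    rw [← one_mul (1 : K), ← MvPolynomial.monomial_mul, map_mul, Finsupp.mapDomain_add]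
    exact hs.mul ht
  | single i k =>
    rw [Finsupp.mapDomain_single]
    induction k with
    | zero => simpa using isMono_one q
    | succ k ih =>
      rw [Finsupp.single_add, Finsupp.single_add, ← one_mul (1 : K), ← MvPolynomial.monomial_mul,
        map_mul]
      refine ih.mul ?_
      have := isMono_x q i
      rwa [← commEval_X (K := K) (x q) (x_mul_x q) i] at this

theorem isMono_py (s : Fin n →₀ ℕ) :
    IsMono q (py q (MvPolynomial.monomial s 1)) (s.mapDomain Sum.inr) := by
  induction s using Finsupp.induction_linear with
  | zero => simpa using isMono_one q
  | add s t hs ht =>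
    rw [← one_mul (1 : K), ← MvPolynomial.monomial_mul, map_mul, Finsupp.mapDomain_add]
    exact hs.mul ht
  | single i k =>
    rw [Finsupp.mapDomain_single]
    induction k with
    | zero => simpa using isMono_one q
    | succ k ih =>
      rw [Finsupp.single_add, Finsupp.single_add, ← one_mul (1 : K), ← MvPolynomial.monomial_mul,
        map_mul]
      refine ih.mul ?_
      have := isMono_y q i
      rwa [← commEval_X (K := K) (y q) (y_mul_y q) i] at this

theorem mono_exp (s : Fin n ⊕ Fin n →₀ ℕ) :
    (s.comapDomain Sum.inl Sum.inl_injective.injOn).mapDomain Sum.inl +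
      (s.comapDomain Sum.inr Sum.inr_injective.injOn).mapDomain Sum.inr = s := by
  ext (i | i)
  · rw [Finsupp.add_apply, Finsupp.mapDomain_apply Sum.inl_injective,
      Finsupp.mapDomain_of_notMem_range _ _ (by simp)]
    simp
  · rw [Finsupp.add_apply, Finsupp.mapDomain_apply Sum.inr_injective,
      Finsupp.mapDomain_of_notMem_range _ _ (by simp)]
    simp

theorem isMono_mono (s : Fin n ⊕ Fin n →₀ ℕ) : IsMono q (mono q s) s := by
  have := (isMono_px q (s.comapDomain Sum.inl Sum.inl_injective.injOn)).mul
    (isMono_py q (s.comapDomain Sum.inr Sum.inr_injective.injOn))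
  rwa [mono_exp] at this

theorem y_mul_px (i : Fin n) (f : MvPolynomial (Fin n) K) :
    ∃ g, y q i * px q f = px q g * y q i := by
  induction f using MvPolynomial.induction_on with
  | C c =>
    refine ⟨MvPolynomial.C c, ?_⟩
    rw [← MvPolynomial.algebraMap_eq, AlgHom.commutes, Algebra.commutes]
  | add f g hf hg =>
    obtain ⟨f', hf⟩ := hf
    obtain ⟨g', hg⟩ := hg
    exact ⟨f' + g', by rw [map_add, map_add, mul_add, add_mul, hf, hg]⟩
  | mul_X f j hf =>
    obtain ⟨f', hf⟩ := hf
    refine ⟨(if i = j then (q i : K) else 1) • (f' * MvPolynomial.X j), ?_⟩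
    rw [map_mul, ← mul_assoc, hf, map_smul, map_mul, px, commEval_X, mul_assoc, y_mul_x]
    simp [mul_assoc]

theorem span_mono : Submodule.span K (Set.range (mono q)) = ⊤ := by
  have key : ∀ f g, px q f * py q g ∈ Submodule.span K (Set.range (mono q)) := by
    intro f g
    induction f using MvPolynomial.induction_on' with
    | add f f' hf hf' => rw [map_add, add_mul]; exact add_mem hf hf'
    | monomial s c =>
      induction g using MvPolynomial.induction_on' with
      | add f f' hf hf' => rw [map_add, mul_add]; exact add_mem hf hf'
      | monomial t d =>
        have hm : ∀ (r : Fin n →₀ ℕ) (e : K),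
            MvPolynomial.monomial r e = e • MvPolynomial.monomial r 1 := fun r e => by
          rw [MvPolynomial.smul_monomial, smul_eq_mul, mul_one]
        rw [hm s c, hm t d, map_smul, map_smul, smul_mul_smul_comm]
        refine Submodule.smul_mem _ _ (Submodule.subset_span ⟨Finsupp.sumElim s t, ?_⟩)
        unfold mono
        congr 4 <;> (ext i; simp)
  have key2 : Submodule.span K (Set.range fun p : MvPolynomial (Fin n) K × MvPolynomial (Fin n) K =>
      px q p.1 * py q p.2) ≤ Submodule.span K (Set.range (mono q)) := by
    rw [Submodule.span_le]
    rintro _ ⟨⟨f, g⟩, rfl⟩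
    exact key f g
  rw [eq_top_iff]
  refine le_trans ?_ key2
  rintro a -
  have hsp := fun (f g : MvPolynomial (Fin n) K) => Submodule.subset_span (R := K)
    (s := Set.range fun p : MvPolynomial (Fin n) K × MvPolynomial (Fin n) K =>
      px q p.1 * py q p.2) ⟨(f, g), rfl⟩
  refine induction_left q (P := fun a => a ∈ Submodule.span K (Set.range
    fun p : MvPolynomial (Fin n) K × MvPolynomial (Fin n) K => px q p.1 * py q p.2))
    ?_ (fun _ _ => add_mem) (fun c _ => Submodule.smul_mem _ c) ?_ ?_ a
  · simpa using hsp 1 1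
  · intro i a ha
    induction ha using Submodule.span_induction with
    | mem _ h =>
      obtain ⟨⟨f, g⟩, rfl⟩ := h
      have := hsp (MvPolynomial.X i * f) g
      simpa [px, mul_assoc] using this
    | zero => simp
    | add _ _ _ _ h h' => rw [mul_add]; exact add_mem h h'
    | smul c _ _ h => rw [mul_smul_comm]; exact Submodule.smul_mem _ _ h
  · intro i a ha
    induction ha using Submodule.span_induction with
    | mem _ h =>
      obtain ⟨⟨f, g⟩, rfl⟩ := h
      obtain ⟨f', hf⟩ := y_mul_px q i f
      have := hsp f' (MvPolynomial.X i * g)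
      simp only
      rw [← mul_assoc, hf, mul_assoc]
      simpa [py] using this
    | zero => simp
    | add _ _ _ _ h h' => rw [mul_add]; exact add_mem h h'
    | smul c _ _ h => rw [mul_smul_comm]; exact Submodule.smul_mem _ _ h

theorem rep_linearCombination (u : (Fin n ⊕ Fin n →₀ ℕ) → Kˣ)
    (hu : ∀ s, rep q (mono q s) 1 = MvPolynomial.monomial s (u s : K))
    (l : (Fin n ⊕ Fin n →₀ ℕ) →₀ K) (r : Fin n ⊕ Fin n →₀ ℕ) :
    MvPolynomial.coeff r (rep q (Finsupp.linearCombination K (mono q) l) 1) = l r * u r := by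
  classical
  rw [Finsupp.linearCombination_apply, Finsupp.sum, map_sum, LinearMap.sum_apply,
    MvPolynomial.coeff_sum]
  simp only [map_smul, LinearMap.smul_apply, hu, MvPolynomial.smul_monomial,
    MvPolynomial.coeff_monomial, smul_eq_mul, Finset.sum_ite_eq']
  split_ifs with h
  · rfl
  · rw [Finsupp.notMem_support_iff.1 h, zero_mul]

theorem exists_units : ∃ u : (Fin n ⊕ Fin n →₀ ℕ) → Kˣ,
    ∀ s, rep q (mono q s) 1 = MvPolynomial.monomial s (u s : K) := by
  choose u hu using fun s => isMono_mono q s 0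
  exact ⟨u, fun s => by simpa using! hu s⟩

theorem rep_injective {a : QAffine q} (h : rep q a 1 = 0) : a = 0 := by
  obtain ⟨u, hu⟩ := exists_units q
  obtain ⟨l, rfl⟩ := (Finsupp.mem_span_range_iff_exists_finsupp (R := K)).1
    (show a ∈ Submodule.span K (Set.range (mono q)) by rw [span_mono]; trivial)
  change Finsupp.linearCombination K (mono q) l = 0
  have : l = 0 := by
    ext r
    have h1 := rep_linearCombination q u hu l r
    have h2 : rep q (Finsupp.linearCombination K (mono q) l) 1 = 0 := h
    rw [h2, MvPolynomial.coeff_zero] at h1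
    simpa using h1.symm
  rw [this, map_zero]

/-- The monomials `x^α y^β` form a `K`-basis. -/
def basis : Module.Basis (Fin n ⊕ Fin n →₀ ℕ) K (QAffine q) :=
  Module.Basis.mk (v := mono q) (by
    rw [linearIndependent_iff]
    intro l hl
    obtain ⟨u, hu⟩ := exists_units q
    ext r
    have h1 := rep_linearCombination q u hu l r
    rw [hl, map_zero, LinearMap.zero_apply, MvPolynomial.coeff_zero] at h1
    simpa using h1.symm) (span_mono q).ge

theorem basis_mul : ∃ c : (Fin n ⊕ Fin n →₀ ℕ) → (Fin n ⊕ Fin n →₀ ℕ) → Kˣ,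
    ∀ s t, basis q s * basis q t = (c s t : K) • basis q (s + t) := by
  obtain ⟨u, hu⟩ := exists_units q
  choose v hv using fun s t => (isMono_mono q s).mul (isMono_mono q t) 0
  refine ⟨fun s t => v s t * (u (s + t))⁻¹, fun s t => ?_⟩
  simp only [basis, Module.Basis.mk_apply]
  rw [← sub_eq_zero]
  apply rep_injective
  have := hv s t
  rw [add_zero] at this
  rw [map_sub, LinearMap.sub_apply, map_smul, LinearMap.smul_apply, hu, MvPolynomial.smul_monomial,
    sub_eq_zero]
  refine Eq.trans ?_ (this.trans ?_)
  · rfl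
  · simp

instance : Nontrivial (QAffine q) :=
  ⟨basis q 0, 0, (basis q).ne_zero 0⟩

instance : NoZeroDivisors (QAffine q) :=
  twisted_noZeroDivisors (basis q) _ (basis_mul q).choose_spec

instance : OreLocalization.OreSet (nonZeroDivisors (QAffine q)) :=
  Classical.choice (OreLocalization.nonempty_oreSet_iff_of_noZeroDivisors.2 fun a s => by
    obtain ⟨u, v, hv, h⟩ := twisted_ore (basis q) _ (basis_mul q).choose_spec a s
      (nonZeroDivisors.coe_ne_zero s)
    exact ⟨u, ⟨v, mem_nonZeroDivisors_of_ne_zero hv⟩, h⟩)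

end QAffine

end QuantumAffine

noncomputable section SkewFractions

open nonZeroDivisors

variable {K A : Type*} [Field K] [Ring A] [Algebra K A] [Nontrivial A] [NoZeroDivisors A]
  [OreLocalization.OreSet A⁰]

/-- The skew field of fractions `Frac(A)` of an Ore domain `A`. -/
abbrev SkewFrac (A : Type*) [Ring A] [Nontrivial A] [NoZeroDivisors A]
    [OreLocalization.OreSet A⁰] : Type _ :=
  OreLocalization A⁰ A

namespace SkewFrac

variable (K A) in
/-- The canonical embedding `A → Frac(A)`. -/
def of : A →ₐ[K] SkewFrac A :=
  { OreLocalization.numeratorRingHom with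
    commutes' := fun _ => rfl }

variable (K) in
theorem of_injective : Function.Injective (of K A) :=
  OreLocalization.numeratorHom_inj fun _ h => h.1

variable (K) in
theorem of_ne_zero (s : A⁰) : of K A s ≠ 0 := by
  rw [Ne, map_eq_zero_iff _ (of_injective K)]
  exact nonZeroDivisors.coe_ne_zero s

variable (K) in
theorem exists_eq (z : SkewFrac A) : ∃ (a : A) (s : A⁰), z = (of K A s)⁻¹ * of K A a := by
  induction z using OreLocalization.ind with
  | _ a s =>
    refine ⟨a, s, ?_⟩
    rw [eq_inv_mul_iff_mul_eq₀ (of_ne_zero K s)]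
    exact OreLocalization.mul_cancel

theorem hom_ext {f g : SkewFrac A →ₐ[K] SkewFrac A} (h : ∀ a, f (of K A a) = g (of K A a)) :
    f = g := by
  ext z
  obtain ⟨a, s, rfl⟩ := exists_eq K z
  simp [h]

/-- The extension to `Frac(A)` of an automorphism of `A`. -/
def mapHom (f : A ≃ₐ[K] A) : SkewFrac A →ₐ[K] SkewFrac A :=
  { OreLocalization.universalHom ((of K A).comp f.toAlgHom).toRingHom
      (Units.liftRight (((of K A).comp f.toAlgHom).toMonoidHom.comp (A⁰).subtype)
        (fun s => Units.mk0 (of K A (f s)) (by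
          rw [Ne, map_eq_zero_iff _ (of_injective K), map_eq_zero_iff _ f.injective]
          exact nonZeroDivisors.coe_ne_zero s))
        (fun _ => rfl))
      (fun _ => rfl) with
    commutes' := fun c => by
      refine (OreLocalization.universalHom_commutes _ _ _ (r := algebraMap K A c)).trans ?_
      change of K A (f (algebraMap K A c)) = _
      rw [AlgEquiv.commutes, AlgHom.commutes] }

@[simp] theorem mapHom_of (f : A ≃ₐ[K] A) (a : A) : mapHom f (of K A a) = of K A (f a) :=
  OreLocalization.universalHom_commutes _ _ _

/-- Automorphisms of `A` extend (uniquely) to automorphisms of `Frac(A)`. -/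
def map : (A ≃ₐ[K] A) →* (SkewFrac A ≃ₐ[K] SkewFrac A) where
  toFun f := AlgEquiv.ofAlgHom (mapHom f) (mapHom f.symm)
    (hom_ext fun a => by simp) (hom_ext fun a => by simp)
  map_one' := by
    apply AlgEquiv.coe_toAlgHom_injective
    exact hom_ext fun a => by simp
  map_mul' f g := by
    apply AlgEquiv.coe_toAlgHom_injective
    exact hom_ext fun a => by simp

@[simp] theorem map_of (f : A ≃ₐ[K] A) (a : A) : map f (of K A a) = of K A (f a) :=
  mapHom_of f a

end SkewFrac

end SkewFractions

noncomputable section QNoether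

/-- The Weyl group `W(B_n) = W(C_n) = (ℤ/2ℤ)^n ⋊ S_n`, with `ℤ/2ℤ` written as `{1, -1}`;
`S_n` acts on `(ℤ/2ℤ)^n` by permuting the coordinates, `(σ ε)_i = ε_{σ⁻¹ i}`. -/
abbrev WeylB (n : ℕ) : Type :=
  (Fin n → ℤˣ) ⋊[mulAutArrow] Equiv.Perm (Fin n)

/-- The types of the classical Weyl groups; type `A` stands for the group `S_n`. -/
inductive ClassicalType
  | A | B | C | D

/-- The classical Weyl groups `S_n`, `W(B_n)`, `W(C_n)`, `W(D_n)` as subgroups of `W(B_n)`: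
`S_n` is the subgroup without sign changes and `W(D_n)` that with an even number of them. -/
def weylGroup (n : ℕ) : ClassicalType → Subgroup (WeylB n)
  | .A => (SemidirectProduct.inr : Equiv.Perm (Fin n) →* WeylB n).range
  | .B => ⊤
  | .C => ⊤
  | .D =>
    { carrier := {w | ∏ i, w.left i = 1}
      one_mem' := by simp
      mul_mem' := by
        intro v w hv hw
        simp only [Set.mem_ofPred_eq, SemidirectProduct.mul_left, Pi.mul_apply,
          Finset.prod_mul_distrib] at *
        rw [hv, one_mul, ← hw]
        exact Equiv.prod_comp v.right⁻¹ w.left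
      inv_mem' := by
        intro w hw
        simp only [Set.mem_ofPred_eq, SemidirectProduct.inv_left] at *
        have : ∏ i, (w.left)⁻¹ i = 1 := by simp [hw]
        rw [← this]
        exact Equiv.prod_comp (w.right⁻¹)⁻¹ (w.left)⁻¹ }

variable {K : Type*} [Field K]

/-- `O_q(K^{2n})`, all the parameters being equal to `q`. -/
abbrev QSpace (n : ℕ) (q : Kˣ) : Type _ := QAffine (fun _ : Fin n => q)

/-- The endomorphism `x_i ↦ ε_{σ i} x_{σ i}`, `y_i ↦ ε_{σ i} y_{σ i}` of `O_q(K^{2n})` given by the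
element `(ε, σ) = ε σ` of `W(B_n)`. -/
def weylHom (n : ℕ) (q : Kˣ) (w : WeylB n) : QSpace n q →ₐ[K] QSpace n q :=
  QAffine.lift _
    (fun i => ((w.left (w.right i) : ℤ) : K) • QAffine.x _ (w.right i))
    (fun i => ((w.left (w.right i) : ℤ) : K) • QAffine.y _ (w.right i))
    (fun i j => by
      rw [smul_mul_smul_comm, smul_mul_smul_comm, QAffine.x_mul_x, mul_comm])
    (fun i j => by
      rw [smul_mul_smul_comm, smul_mul_smul_comm, QAffine.y_mul_y, mul_comm])
    (fun i j => by
      rw [smul_mul_smul_comm, smul_mul_smul_comm, QAffine.y_mul_x, smul_comm,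
        mul_comm (((w.left (w.right i) : ℤ) : K))]
      simp only [EmbeddingLike.apply_eq_iff_eq])

theorem mulAutArrow_apply_perm {n : ℕ} (σ : Equiv.Perm (Fin n)) (f : Fin n → ℤˣ) (j : Fin n) :
    (mulAutArrow σ f) (σ j) = f j := by
  change f (σ⁻¹ • σ j) = f j
  simp

theorem weylHom_mul (n : ℕ) (q : Kˣ) (v w : WeylB n) :
    weylHom n q (v * w) = (weylHom n q v).comp (weylHom n q w) := by
  refine QAffine.hom_ext (fun i => ?_) (fun i => ?_) <;>
  simp only [weylHom, QAffine.lift_x, QAffine.lift_y, AlgHom.comp_apply, map_smul, smul_smul,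
    SemidirectProduct.mul_left, SemidirectProduct.mul_right, Equiv.Perm.coe_mul,
    Function.comp_apply, Pi.mul_apply, mulAutArrow_apply_perm, Units.val_mul, Int.cast_mul,
    mul_comm]

theorem weylHom_one (n : ℕ) (q : Kˣ) : weylHom n q 1 = AlgHom.id K _ := by
  refine QAffine.hom_ext (fun i => ?_) (fun i => ?_) <;> simp [weylHom]

/-- The action of `W(B_n)` on `O_q(K^{2n})`. -/
def weylAction (n : ℕ) (q : Kˣ) : WeylB n →* (QSpace n q ≃ₐ[K] QSpace n q) where
  toFun w := AlgEquiv.ofAlgHom (weylHom n q w) (weylHom n q w⁻¹)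
    (by rw [← weylHom_mul, mul_inv_cancel, weylHom_one])
    (by rw [← weylHom_mul, inv_mul_cancel, weylHom_one])
  map_one' := by
    apply AlgEquiv.coe_toAlgHom_injective
    exact weylHom_one n q
  map_mul' v w := by
    apply AlgEquiv.coe_toAlgHom_injective
    exact weylHom_mul n q v w

/-- The skew field `F_{q̄,n} = Frac(O_q̄(K^{2n}))`. -/
abbrev QField {n : ℕ} (q : Fin n → Kˣ) : Type _ := SkewFrac (QAffine q)

/-- The invariants `F_{q,n}^{W_n}` of the classical Weyl group of type `T`, for the induced action
on `F_{q,n} = Frac(O_q(K^{2n}))`. -/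
def weylInvariants (T : ClassicalType) (n : ℕ) (q : Kˣ) :
    Subalgebra K (QField fun _ : Fin n => q) where
  carrier := {a | ∀ w ∈ weylGroup n T, SkewFrac.map (weylAction n q w) a = a}
  mul_mem' ha hb w hw := by rw [map_mul, ha w hw, hb w hw]
  add_mem' ha hb w hw := by rw [map_add, ha w hw, hb w hw]
  algebraMap_mem' c w _ := by rw [AlgEquiv.commutes]

/-- The tuple `q̄`: `(q, …, q)` for `S_n`, `(q², …, q²)` for `B_n` and `C_n`, and
`(q, q², …, q²)` for `D_n`. -/
def weylParam (n : ℕ) (q : Kˣ) : ClassicalType → Fin n → Kˣ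
  | .A, _ => q
  | .B, _ => q ^ 2
  | .C, _ => q ^ 2
  | .D, i => if (i : ℕ) = 0 then q else q ^ 2

namespace QField

variable {n : ℕ} (q : Fin n → Kˣ)

/-- The generator `x_i` in the skew field. -/
def x (i : Fin n) : QField q := SkewFrac.of K _ (QAffine.x q i)

/-- The generator `y_i` in the skew field. -/
def y (i : Fin n) : QField q := SkewFrac.of K _ (QAffine.y q i)

/-- The inclusion of the commutative polynomial ring `K[x_1, …, x_n]`. -/
def poly : MvPolynomial (Fin n) K →ₐ[K] QField q := (SkewFrac.of K _).comp (QAffine.px q)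

theorem poly_X (i : Fin n) : poly q (MvPolynomial.X i) = x q i := by
  simp [poly, x, QAffine.px]

/-- The elementary symmetric polynomial `e_d` in `x_1, …, x_n`. -/
def e (d : ℕ) : QField q := poly q (MvPolynomial.esymm (Fin n) K d)

/-- The elementary symmetric polynomial of degree `d` in the variables other than `x_j`. -/
def esymmOmit (K : Type*) [Field K] {n : ℕ} (d : ℕ) (j : Fin n) : MvPolynomial (Fin n) K :=
  ∑ s ∈ (Finset.univ.erase j).powersetCard d, ∏ k ∈ s, MvPolynomial.X k

/-- For `1 ≤ i ≤ n`, the element `t_i = ∑_j c_{ij} y_j`, where `(c_{ij})` is the inverse of the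
Vandermonde matrix `(x_i^{j-1})`:
`c_{ij} = (-1)^{n-i} e_{n-i}(x_k : k ≠ j) / ∏_{k ≠ j} (x_j - x_k)`. -/
def t (i : ℕ) : QField q :=
  ∑ j, poly q ((-1) ^ (n - i) * esymmOmit K (n - i) j) *
    (poly q (∏ k ∈ Finset.univ.erase j, (MvPolynomial.X j - MvPolynomial.X k)))⁻¹ * y q j

/-- `eRec q i k` is the element `e_k^{(i)}`, for `0 ≤ i ≤ n` and `0 ≤ k ≤ n - i`; in this range no
subtraction below is truncated. -/
def eRec : ℕ → ℕ → QField q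
  | 0, k => e q k
  | 1, k => t q (k + 1)
  | i + 2, k =>
      eRec i (k + 1) * eRec (i + 1) 0 * eRec (i + 1) (n - (i + 2) + 1)
      - (-1) ^ (k + 1) * eRec i 0 * eRec (i + 1) (n - (i + 2) - k) * eRec (i + 1) 0
      - (-1) ^ (n - (i + 2) + 1 - k) * eRec i (n - (i + 2) + 2) *
          eRec (i + 1) (n - (i + 2) + 1 - k) * eRec (i + 1) (n - (i + 2) + 1)

/-- `X_i = e_{n-i+1}^{(i-1)}`, for `1 ≤ i ≤ n`. -/
def bigX (i : ℕ) : QField q := eRec q (i - 1) (n - (i - 1))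

/-- `Y_i = e_0^{(i)}`, for `1 ≤ i ≤ n`. -/
def bigY (i : ℕ) : QField q := eRec q i 0

/-- `X̂_1 = X_1` and `X̂_i = Y_{i-1}^{(-1)^i} X_i^{(-1)^{i+1}}` for `2 ≤ i ≤ n`. -/
def hatX (i : ℕ) : QField q :=
  if i = 1 then bigX q 1
  else bigY q (i - 1) ^ ((-1) ^ i : ℤ) * bigX q i ^ ((-1) ^ (i + 1) : ℤ)

/-- `Ŷ_1 = Y_1`, `Ŷ_2 = Y_1⁻² Y_2` and `Ŷ_i = Y_{i-2}⁻¹ Y_{i-1}⁻² Y_i` for `3 ≤ i ≤ n`. -/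
def hatY (i : ℕ) : QField q :=
  if i = 1 then bigY q 1
  else if i = 2 then bigY q 1 ^ (-2 : ℤ) * bigY q 2
  else (bigY q (i - 2))⁻¹ * bigY q (i - 1) ^ (-2 : ℤ) * bigY q i

end QField

end QNoether

/-!
The invariants of `S_n` are described through a noncommutative Euclidean algorithm. Put
`P_0(u) = ∏_k (u - x_k)` and `P_1(u) = ∑_i t_{i+1} u^i`; the latter is the interpolation polynomial with
value `y_j` at `u = x_j` (`QField.y_eq_sum`). The step from `A = P_i`, of degree `m + 1`, and
`B = P_{i+1}`, of degree `m`, to `C = P_{i+2}`, of degree `m - 1`, removes both end coefficients: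
`u C(u) = A(u) b₀ bₘ - aₘ₊₁ u B(u) b₀ - a₀ B(u) bₘ`. Up to signs the coefficients of `P_i` are the
`e_k^{(i)}` (`QField.eRec_eq_chain`), so that `X_{i+1}` and `Y_i` are the two end coefficients of `P_i`.

Commutation. The coefficients of each `P_i` commute, and two successive polynomials satisfy the exchange
relation `(u - v) B(v) A(u) = l ((u - q v) A(u) B(v) - (1 - q) u A(v) B(u))` with central `u`, `v`. It
holds for `P_0`, `P_1` with `l = 1` (`QField.exchangePair_basePoly`), and the Euclidean step preserves it,
with `1 / (l q)` in place of `l` (`ExchangePair.next`). Its extreme coefficients say that `X_{i+1}` and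
`Y_i` commute up to powers of `q` with the coefficients of `P_{i+1}`, hence with all later ones, where the
exponents obey `f_{i+2} = f_i + 2 f_{i+1}` (`QField.skewComm_chain_next`). In `X̂_i` and `Ŷ_i` these
exponents cancel, and the defining relations of `x_i`, `y_i` result (`QField.comm_hat`,
`QField.qRelations_hat`).

Embedding. When the end coefficients are invertible, the Euclidean algorithm can be run backwards, so the
`e_k` and `t_k` are Laurent polynomials in the `X̂_i`, `Ŷ_i` (`QField.chain_mem_of_hat_mem`). As the `x_i`
are integral over the `e_k`, and the `y_i` are combinations of the `t_k` with coefficients in `K[x]`, left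
multiplication by `x_i` and `y_i` preserves `Q T`, for a finite-dimensional `Q` and the algebra `T` of
these Laurent polynomials. If `2n` elements commuting up to scalars have this property, their ordered
monomials are linearly independent, since otherwise the growth of `T` would be smaller than that of the
quantum affine space (`linearIndependent_qMonomial_of_mul_mem`). Hence `x_i ↦ X̂_i`, `y_i ↦ Ŷ_i` is an
embedding of skew fields, over whose image `D` the skew field is spanned by `K[x]`
(`QRelations.exists_algHom`). The same growth argument shows that the end coefficients do not vanish: at the
first zero the exchange relation degenerates and makes the remaining coefficients commute up to scalars,
which leads to `2n` elements with the property above, one of which is zero (`QField.corner_ne_zero`).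

Invariants. All of `D` is invariant, and `D` contains the symmetric polynomials. Averaging an invariant
written as an element of `K[x] D` shows that it lies in `D` (`mem_of_forall_fixed`).

For `W(B_n)` the same method identifies the invariants of the sign changes with `F_{q²,n}`, through
`x_i ↦ x_i²`, `y_i ↦ x_i⁻¹ y_i` (`QField.exists_algHom_sq`); this is compatible with permutations, so the
case of `S_n` with parameter `q²` applies. For `W(D_n)`, the image `(x_1 ⋯ x_n)²` of the first generator in
the resulting isomorphism is replaced by its square root `x_1 ⋯ x_n`, which is `W(D_n)`-invariant and, with
the `W(B_n)`-invariants, generates all `W(D_n)`-invariants (`QField.exists_add_prodX_mul`).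
-/

/-! ### Exchange relations between values of two polynomials -/

section Exchange

/-- Two pairs of values `A(u), A(v)` and `B(u), B(v)`, with the extreme coefficients `a0, al` of `A`
and `b0, bl` of `B`, subject to the quadratic exchange relations. -/
structure ExchangeAt {k S : Type*} [CommRing k] [Ring S] [Algebra k S] (q l u v : k)
    (Au Av Bu Bv a0 al b0 bl : S) : Prop where
  AA : Au * Av = Av * Au
  Aua0 : Au * a0 = a0 * Au
  Ava0 : Av * a0 = a0 * Av
  Aual : Au * al = al * Au
  Aval : Av * al = al * Av
  ala0 : al * a0 = a0 * al
  BB : Bu * Bv = Bv * Bu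
  b0Bu : b0 * Bu = Bu * b0
  b0Bv : b0 * Bv = Bv * b0
  blBu : bl * Bu = Bu * bl
  blBv : bl * Bv = Bv * bl
  blb0 : bl * b0 = b0 * bl
  Bua0 : Bu * a0 = (l * q) • (a0 * Bu)
  Bva0 : Bv * a0 = (l * q) • (a0 * Bv)
  b0a0 : b0 * a0 = (l * q) • (a0 * b0)
  bla0 : bl * a0 = (l * q) • (a0 * bl)
  Bual : Bu * al = l • (al * Bu)
  Bval : Bv * al = l • (al * Bv)
  b0al : b0 * al = l • (al * b0)
  blal : bl * al = l • (al * bl)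
  b0Au : b0 * Au = l • (Au * b0) - (l * (1 - q)) • (a0 * Bu)
  b0Av : b0 * Av = l • (Av * b0) - (l * (1 - q)) • (a0 * Bv)
  blAu : bl * Au = (l * q) • (Au * bl) + (l * (1 - q) * u) • (al * Bu)
  blAv : bl * Av = (l * q) • (Av * bl) + (l * (1 - q) * v) • (al * Bv)
  BvAu : (u - v) • (Bv * Au) = (l * (u - q * v)) • (Au * Bv) - (l * (1 - q) * u) • (Av * Bu)
  BuAv : (v - u) • (Bu * Av) = (l * (v - q * u)) • (Av * Bu) - (l * (1 - q) * v) • (Au * Bv)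

namespace ExchangeAt

variable {k S : Type*} [CommRing k] [Ring S] [Algebra k S] {q l u v : k}
    {Au Av Bu Bv a0 al b0 bl : S}

/-- The value `u C(u)` of the next polynomial. -/
def next (u : k) (Au Bu a0 al b0 bl : S) : S :=
  Au * (b0 * bl) - u • (al * (Bu * b0)) - a0 * (Bu * bl)

/-- The exchange relation between `B` and the next polynomial, multiplied by `u - v`: the scalars form
a commutative ring in which `u - v` is not assumed to be invertible. -/
theorem next_B (h : ExchangeAt q l u v Au Av Bu Bv a0 al b0 bl) :
    (u - v) • (l * q * (u - v)) • (next v Av Bv a0 al b0 bl * Bu) =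
      (u - v) • ((u - q * v) • (Bu * next v Av Bv a0 al b0 bl) -
        ((1 - q) * v) • (Bv * next u Au Bu a0 al b0 bl)) := by
  have asc : ∀ {x y z : S} (w : S), x * y = z → x * (y * w) = z * w :=
    fun w h => by rw [← mul_assoc, h]
  have e1 := congrArg (· * (b0 * bl)) h.BvAu
  have e2 := congrArg (· * (b0 * bl)) h.BuAv
  simp only [smul_mul_assoc, sub_mul, mul_assoc] at e1 e2
  simp only [next, mul_sub, sub_mul, mul_assoc, smul_mul_assoc, mul_smul_comm, h.blBu,
    h.b0Bu, asc _ h.b0Bu, asc _ h.BB, asc _ h.Bua0, asc _ h.Bual, asc _ h.Bva0, asc _ h.Bval,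
    smul_sub]
  linear_combination (norm := module) (u - q * v) • e2 + ((1 - q) * v) • e1

/-- The values of the next polynomial at `u` and `v` commute, up to the factor `u - v`. -/
theorem next_next (h : ExchangeAt q l u v Au Av Bu Bv a0 al b0 bl) :
    (u - v) • (next u Au Bu a0 al b0 bl * next v Av Bv a0 al b0 bl) =
      (u - v) • (next v Av Bv a0 al b0 bl * next u Au Bu a0 al b0 bl) := by
  have asc : ∀ {x y z : S} (w : S), x * y = z → x * (y * w) = z * w :=
    fun w h => by rw [← mul_assoc, h]
  have e1 := congrArg (fun x => a0 * (x * (b0 * (bl * bl)))) h.BvAu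
  have e2 := congrArg (fun x => a0 * (x * (b0 * (bl * bl)))) h.BuAv
  have e3 := congrArg (fun x => al * (x * (b0 * (b0 * bl)))) h.BvAu
  have e4 := congrArg (fun x => al * (x * (b0 * (b0 * bl)))) h.BuAv
  simp only [smul_mul_assoc, sub_mul, mul_assoc, mul_sub, mul_smul_comm] at e1 e2 e3 e4
  simp only [next, mul_sub, sub_mul, add_mul, mul_add, mul_assoc, smul_mul_assoc, mul_smul_comm,
    asc _ h.b0Bu, asc _ h.blBu, asc _ h.b0Bv, asc _ h.blBv,
    h.blb0, asc _ h.blb0,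
    asc _ h.BB, asc _ h.Bua0, asc _ h.Bual, asc _ h.Bva0, asc _ h.Bval,
    asc _ h.b0a0, asc _ h.bla0, asc _ h.b0al, asc _ h.blal,
    asc _ h.b0Au, asc _ h.b0Av, asc _ h.blAu, asc _ h.blAv, asc _ h.AA, asc _ h.Aua0, asc _ h.Ava0,
    asc _ h.Aual, asc _ h.Aval, asc _ h.ala0,
    smul_sub, smul_add]
  linear_combination (norm := module) (l * q) • e1 + (l * q) • e2 + (l * v) • e3 + (l * u) • e4

end ExchangeAt
end Exchange

/-! ### Exchange relations between coefficients -/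

noncomputable section ExchangePairs

open Polynomial

/-- Polynomials `A`, `B` of degrees at most `m + 1` and `m` over a `K`-algebra whose coefficients
satisfy `[A(u), A(v)] = [B(u), B(v)] = 0` and
`(u - v) B(v) A(u) = l ((u - q v) A(u) B(v) - (1 - q) u A(v) B(u))` for central `u`, `v`.
The last relation is written in terms of the coefficients. -/
structure ExchangePair {K F : Type*} [Field K] [Ring F] [Algebra K F] (q l : K) (m : ℕ)
    (A B : F[X]) : Prop where
  coeff_A : ∀ i, m + 1 < i → A.coeff i = 0
  coeff_B : ∀ i, m < i → B.coeff i = 0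
  comm_A : ∀ i j, A.coeff i * A.coeff j = A.coeff j * A.coeff i
  comm_B : ∀ i j, B.coeff i * B.coeff j = B.coeff j * B.coeff i
  zero_succ : ∀ j, B.coeff j * A.coeff 0 = (l * q) • (A.coeff 0 * B.coeff j)
  succ_zero : ∀ i, B.coeff 0 * A.coeff i =
    l • (A.coeff i * B.coeff 0) - (l * (1 - q)) • (A.coeff 0 * B.coeff i)
  succ_succ : ∀ i j, B.coeff (j + 1) * A.coeff i - B.coeff j * A.coeff (i + 1) =
    l • (A.coeff i * B.coeff (j + 1)) - (l * q) • (A.coeff (i + 1) * B.coeff j) -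
      (l * (1 - q)) • (A.coeff (j + 1) * B.coeff i)

namespace ExchangePair

variable {K F : Type*} [Field K] [Ring F] [Algebra K F] {q l : K} {m : ℕ} {A B : F[X]}

/-! The central elements `u`, `v` are the two variables of `F[X][X]`, which is an algebra over `K[X][X]`:
`u` is the inner variable `C X` and `v` the outer variable `X`, so that `A(u)` is `C A` and `A(v)` is
`A.map C`. -/

attribute [local instance] Polynomial.algebra

theorem polyScalar_CC (c : K) (p : F[X][X]) : (C (C c) : K[X][X]) • p = C (C (algebraMap K F c)) * p := by
  rw [Algebra.smul_def]
  congr 1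
  simp [algebraMap, Algebra.algebraMap]

theorem polyScalar_CX (p : F[X][X]) : (C X : K[X][X]) • p = C X * p := by
  rw [Algebra.smul_def]
  congr 1
  simp [algebraMap, Algebra.algebraMap]

theorem polyScalar_X (p : F[X][X]) : (X : K[X][X]) • p = X * p := by
  rw [Algebra.smul_def]
  congr 1
  simp [algebraMap, Algebra.algebraMap]

theorem polyScalar_mul (a b : K[X][X]) (p : F[X][X]) : (a * b) • p = a • b • p := mul_smul a b p

theorem polyScalar_sub (a b : K[X][X]) (p : F[X][X]) : (a - b) • p = a • p - b • p := sub_smul a b p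

theorem ext_coeff {f g : F[X][X]} (h : ∀ i j, (f.coeff j).coeff i = (g.coeff j).coeff i) : f = g := by
  ext j i
  exact h i j

/-- The commutation of the leading coefficient of `B` with the coefficients of `A`. -/
theorem lead_B (h : ExchangePair q l m A B) (i : ℕ) : B.coeff m * A.coeff (i + 1) =
    (l * q) • (A.coeff (i + 1) * B.coeff m) + (l * (1 - q)) • (A.coeff (m + 1) * B.coeff i) := by
  have := h.succ_succ i m
  rw [h.coeff_B (m + 1) (by omega), zero_mul, mul_zero, smul_zero] at this
  linear_combination (norm := module) -this

/-- The leading coefficient of `A` commutes up to a scalar with the coefficients of `B`. -/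
theorem lead_A (h : ExchangePair q l m A B) (j : ℕ) : B.coeff j * A.coeff (m + 1) =
    l • (A.coeff (m + 1) * B.coeff j) := by
  cases j with
  | zero =>
    have := h.succ_zero (m + 1)
    rw [h.coeff_B (m + 1) (by omega), mul_zero, smul_zero, sub_zero] at this
    exact this
  | succ j =>
    have := h.succ_succ (m + 1) j
    rw [h.coeff_B (m + 1) (by omega), h.coeff_A (m + 1 + 1) (by omega)] at this
    simpa using this

set_option linter.unusedSimpArgs false in
/-- The relations between coefficients, assembled into relations between values at the two variables. -/
theorem exchangeAt (h : ExchangePair q l m A B) :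
    ExchangeAt (k := K[X][X]) (C (C q)) (C (C l)) (C X) X (C A) (A.map C) (C B) (B.map C)
      (C (C (A.coeff 0))) (C (C (A.coeff (m + 1)))) (C (C (B.coeff 0))) (C (C (B.coeff m))) := by
  constructor
  case AA | Aua0 | Ava0 | Aual | Aval | ala0 =>
    all_goals
      apply ext_coeff
      rintro (_ | i) (_ | j) <;>
      simp [h.comm_A]
  case BB | b0Bu | b0Bv | blBu | blBv | blb0 =>
    all_goals
      apply ext_coeff
      rintro (_ | i) (_ | j) <;>
      simp [h.comm_B]
  case Bua0 | Bva0 | b0a0 | bla0 =>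
    all_goals
      apply ext_coeff
      rintro (_ | i) (_ | j) <;>
      simp only [coeff_C_mul, coeff_mul_C, polyScalar_CC, polyScalar_CX, polyScalar_X,
        coeff_C_zero, coeff_C_succ, coeff_map, coeff_add, coeff_sub, coeff_neg,
        coeff_X_mul_zero, coeff_X_mul, coeff_zero,
        mul_zero, zero_mul, mul_sub, polyScalar_sub, mul_one, polyScalar_mul, sub_zero,
        zero_sub, add_zero, zero_add, sub_self, ← Algebra.smul_def] <;>
      first
        | linear_combination (norm := module) h.zero_succ m
        | linear_combination (norm := module) h.zero_succ 0
        | linear_combination (norm := module) h.zero_succ (i + 1)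
        | linear_combination (norm := module) h.zero_succ (j + 1)
  case Bual | Bval | b0al | blal =>
    all_goals
      apply ext_coeff
      rintro (_ | i) (_ | j) <;>
      simp only [coeff_C_mul, coeff_mul_C, polyScalar_CC, polyScalar_CX, polyScalar_X,
        coeff_C_zero, coeff_C_succ, coeff_map, coeff_add, coeff_sub, coeff_neg,
        coeff_X_mul_zero, coeff_X_mul, coeff_zero,
        mul_zero, zero_mul, mul_sub, polyScalar_sub, mul_one, polyScalar_mul, sub_zero,
        zero_sub, add_zero, zero_add, sub_self, ← Algebra.smul_def] <;>
      first
        | linear_combination (norm := module) h.lead_A m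
        | linear_combination (norm := module) h.lead_A 0
        | linear_combination (norm := module) h.lead_A (i + 1)
        | linear_combination (norm := module) h.lead_A (j + 1)
  case b0Au | b0Av =>
    all_goals
      apply ext_coeff
      rintro (_ | i) (_ | j) <;>
      simp only [coeff_C_mul, coeff_mul_C, polyScalar_CC, polyScalar_CX, polyScalar_X,
        coeff_C_zero, coeff_C_succ, coeff_map, coeff_add, coeff_sub, coeff_neg,
        coeff_X_mul_zero, coeff_X_mul, coeff_zero,
        mul_zero, zero_mul, mul_sub, polyScalar_sub, mul_one, polyScalar_mul, sub_zero,
        zero_sub, add_zero, zero_add, sub_self, ← Algebra.smul_def] <;>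
      first
        | linear_combination (norm := module) h.succ_zero 0
        | linear_combination (norm := module) h.succ_zero (i + 1)
        | linear_combination (norm := module) h.succ_zero (j + 1)
  case blAu | blAv =>
    all_goals
      apply ext_coeff
      rintro (_ | i) (_ | j) <;>
      simp only [coeff_C_mul, coeff_mul_C, polyScalar_CC, polyScalar_CX, polyScalar_X,
        coeff_C_zero, coeff_C_succ, coeff_map, coeff_add, coeff_sub, coeff_neg,
        coeff_X_mul_zero, coeff_X_mul, coeff_zero,
        mul_zero, zero_mul, mul_sub, polyScalar_sub, mul_one, polyScalar_mul, sub_zero,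
        zero_sub, add_zero, zero_add, sub_self, ← Algebra.smul_def] <;>
      first
        | linear_combination (norm := module) h.lead_B i
        | linear_combination (norm := module) h.lead_B j
        | linear_combination (norm := module) h.zero_succ m
  case BvAu | BuAv =>
    all_goals
      apply ext_coeff
      rintro (_ | i) (_ | j) <;>
      simp only [coeff_C_mul, coeff_mul_C, polyScalar_CC, polyScalar_CX, polyScalar_X,
        coeff_C_zero, coeff_C_succ, coeff_map, coeff_add, coeff_sub, coeff_neg,
        coeff_X_mul_zero, coeff_X_mul, coeff_zero,
        mul_zero, zero_mul, mul_sub, polyScalar_sub, mul_one, polyScalar_mul, sub_zero,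
        zero_sub, add_zero, zero_add, sub_self, ← Algebra.smul_def] <;>
      first
        | linear_combination (norm := module) (0 : K) • h.zero_succ 0
        | linear_combination (norm := module) -h.zero_succ j
        | linear_combination (norm := module) -h.zero_succ i
        | linear_combination (norm := module) h.succ_zero i
        | linear_combination (norm := module) h.succ_zero j
        | linear_combination (norm := module) h.succ_succ i j
        | linear_combination (norm := module) h.succ_succ j i
end ExchangePair
end ExchangePairs

/-! ### The Euclidean step -/

noncomputable section ExchangeStep

open Polynomial

namespace ExchangePair

variable {K F : Type*} [Field K] [Ring F] [Algebra K F] {q l : K} {m : ℕ} {A B : F[X]}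

/-- The Euclidean step: for `A`, `B` of degrees `m + 1` and `m`, the polynomial `C` of degree `m - 1`
with `u C(u) = A(u) b₀ bₘ - aₘ₊₁ u B(u) b₀ - a₀ B(u) bₘ`. -/
def step (m : ℕ) (A B : F[X]) : F[X] :=
  divX A * C (B.coeff 0 * B.coeff m) - C (A.coeff (m + 1)) * (B * C (B.coeff 0)) -
    C (A.coeff 0) * (divX B * C (B.coeff m))

theorem coeff_step (m : ℕ) (A B : F[X]) (k : ℕ) : (step m A B).coeff k =
    A.coeff (k + 1) * (B.coeff 0 * B.coeff m) - A.coeff (m + 1) * (B.coeff k * B.coeff 0) -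
      A.coeff 0 * (B.coeff (k + 1) * B.coeff m) := by
  simp only [step, coeff_sub, coeff_mul_C, coeff_C_mul, coeff_divX]

theorem X_mul_step (m : ℕ) (A B : F[X]) : X * step m A B =
    A * (C (B.coeff 0) * C (B.coeff m)) - X * (C (A.coeff (m + 1)) * (B * C (B.coeff 0))) -
      C (A.coeff 0) * (B * C (B.coeff m)) := by
  ext (_ | k)
  · simp only [coeff_sub, ← C_mul, coeff_mul_C, coeff_C_mul, coeff_X_mul_zero]
    simp
  · simp only [coeff_step, coeff_sub, ← C_mul, coeff_mul_C, coeff_C_mul, coeff_X_mul]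

attribute [local instance] Polynomial.algebra

/-- `u C(u)` at the inner variable. -/
theorem next_C (m : ℕ) (A B : F[X]) :
    ExchangeAt.next (k := K[X][X]) (C X) (C A) (C B)
      (C (C (A.coeff 0))) (C (C (A.coeff (m + 1)))) (C (C (B.coeff 0))) (C (C (B.coeff m))) =
      C X * C (step m A B) := by
  rw [← C_mul, X_mul_step]
  simp [ExchangeAt.next, polyScalar_CX]

/-- `u C(u)` at the outer variable. -/
theorem next_map (m : ℕ) (A B : F[X]) :
    ExchangeAt.next (k := K[X][X]) X (A.map C) (B.map C)
      (C (C (A.coeff 0))) (C (C (A.coeff (m + 1)))) (C (C (B.coeff 0))) (C (C (B.coeff m))) =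
      X * (step m A B).map C := by
  have := congrArg (Polynomial.map (C : F →+* F[X])) (X_mul_step m A B)
  simp only [Polynomial.map_mul, map_X] at this
  rw [this]
  simp [ExchangeAt.next, polyScalar_X]

/-- The exchange relations in generating function form. -/
theorem of_identity {c : K} (hc : c * l = 1) (coeff_A : ∀ i, m + 1 < i → A.coeff i = 0)
    (coeff_B : ∀ i, m < i → B.coeff i = 0)
    (comm_A : ∀ i j, A.coeff i * A.coeff j = A.coeff j * A.coeff i)
    (comm_B : ∀ i j, B.coeff i * B.coeff j = B.coeff j * B.coeff i)
    (h : (C (C c) * (C X - X) : K[X][X]) • (B.map C * C A) =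
      (C X - C (C q) * X : K[X][X]) • (C A * B.map C) -
        ((1 - C (C q)) * C X : K[X][X]) • (A.map C * C B)) : ExchangePair q l m A B := by
  have hl : l = c⁻¹ := eq_inv_of_mul_eq_one_right hc
  have hc0 : c ≠ 0 := left_ne_zero_of_mul_eq_one hc
  have hcf : ∀ i j, (((C (C c) * (C X - X) : K[X][X]) • (B.map C * C A)).coeff j).coeff i =
      (((C X - C (C q) * X : K[X][X]) • (C A * B.map C)).coeff j).coeff i -
      ((((1 - C (C q)) * C X : K[X][X]) • (A.map C * C B)).coeff j).coeff i := by
    intro i j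
    rw [h, coeff_sub, coeff_sub]
  simp only [mul_sub, sub_mul, polyScalar_sub, polyScalar_mul, one_mul, polyScalar_CX,
    polyScalar_CC, polyScalar_X] at hcf
  refine ⟨coeff_A, coeff_B, comm_A, comm_B, fun j => ?_, fun i => ?_, fun i j => ?_⟩
  -- The coefficients at `u^0 v^(j+1)`, `u^(i+1) v^0` and `u^(i+1) v^(j+1)`.
  · have := hcf 0 (j + 1)
    simp [← Algebra.smul_def] at this
    subst hl
    linear_combination (norm := (match_scalars <;> field_simp <;> ring)) c⁻¹ • this
  · have := hcf (i + 1) 0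
    simp [← Algebra.smul_def] at this
    subst hl
    linear_combination (norm := (match_scalars <;> field_simp <;> ring)) c⁻¹ • this
  · have := hcf (i + 1) (j + 1)
    simp [← Algebra.smul_def] at this
    subst hl
    linear_combination (norm := (match_scalars <;> field_simp <;> ring)) c⁻¹ • this

variable [IsDomain F]

theorem X_sub_X_ne_zero : (C X - X : F[X][X]) ≠ 0 := by
  intro h
  have := congrArg (fun p => (p.coeff 1).coeff 0) h
  simp [coeff_X] at this

/-- The pair `B`, `C` satisfies the exchange relations with the inverse parameter `1 / (l q)`. -/
theorem next (h : ExchangePair q l (m + 1) A B) {l' : K} (hl : l * q * l' = 1) :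
    ExchangePair q l' m B (step (m + 1) A B) := by
  have e1 := h.exchangeAt.next_next
  have e2 := h.exchangeAt.next_B
  rw [next_C, next_map] at e1 e2
  set D := step (m + 1) A B with hD
  have hX : (X : F[X][X]) ≠ 0 := X_ne_zero
  have hCX : (C X : F[X][X]) ≠ 0 := C_ne_zero.2 X_ne_zero
  have hdom := X_sub_X_ne_zero (F := F)
  have hXc : ∀ p : F[X][X], p * X = X * p := fun p => (X_mul).symm
  have hCXc : ∀ p : F[X][X], p * C X = C X * p := fun p => by
    ext j i; simp [← X_mul]
  -- `u`, `v` and `u - v` are not zero divisors, and can be cancelled.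
  have e1' : C D * D.map C = D.map C * C D := by
    simp only [polyScalar_sub, polyScalar_CX, polyScalar_X, ← sub_mul] at e1
    have e3 := mul_left_cancel₀ hdom e1
    have e4 : C X * (X * (C D * D.map C)) = C X * (X * (D.map C * C D)) := by
      rw [mul_assoc, ← mul_assoc (C D) X, hXc (C D), mul_assoc, mul_assoc, ← mul_assoc (D.map C) (C X),
        hCXc, mul_assoc, ← mul_assoc X (C X), hCXc X, mul_assoc] at e3
      exact e3
    exact mul_left_cancel₀ hX (mul_left_cancel₀ hCX e4)
  have e2' : (C (C l) * C (C q) * (C X - X) : K[X][X]) • (D.map C * C B) =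
      (C X - C (C q) * X : K[X][X]) • (C B * D.map C) -
        ((1 - C (C q)) * C X : K[X][X]) • (B.map C * C D) := by
    rw [← polyScalar_CX (K := K), ← polyScalar_X (K := K)] at e2
    simp only [smul_mul_assoc, mul_smul_comm] at e2
    have e3 : (X * (C X - X) : K[X][X]) • ((C (C l) * C (C q) * (C X - X) : K[X][X]) •
        (D.map C * C B)) = (X * (C X - X) : K[X][X]) • ((C X - C (C q) * X : K[X][X]) •
          (C B * D.map C) - ((1 - C (C q)) * C X : K[X][X]) • (B.map C * C D)) := by
      linear_combination (norm := module) e2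
    simp only [polyScalar_mul X, polyScalar_X] at e3
    have e4 := mul_left_cancel₀ hX e3
    simp only [polyScalar_sub (C X) X, polyScalar_X, polyScalar_CX, ← sub_mul] at e4
    exact mul_left_cancel₀ hdom e4
  rw [← C_mul, ← C_mul] at e2'
  refine of_identity hl h.coeff_B ?_ h.comm_B ?_ e2'
  · intro i hi
    rw [hD, coeff_step, h.coeff_B (i + 1) (by omega)]
    -- The coefficient of `step` at `u^(m+1)` is `aₘ₊₂ b₀ bₘ₊₁ - aₘ₊₂ bₘ₊₁ b₀ = 0`.
    obtain rfl | hi' := eq_or_lt_of_le (Nat.succ_le_of_lt hi)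
    · rw [h.comm_B 0]; simp
    · rw [h.coeff_A (i + 1) (by omega), h.coeff_B i (by omega)]; simp
  · intro i j
    have := congrArg (fun p => (p.coeff j).coeff i) e1'
    simpa using this

end ExchangePair
end ExchangeStep

/-! ### Ordered monomials in elements commuting up to scalars -/

section QCommuting

/-- `a` and `b` commute up to a nonzero scalar. -/
def QCommute (K : Type*) {F : Type*} [Field K] [Ring F] [Algebra K F] (a b : F) : Prop :=
  ∃ c : Kˣ, a * b = (c : K) • (b * a)

/-- `a` and `b` differ by a nonzero scalar. -/
def UpToUnit (K : Type*) {F : Type*} [Field K] [Ring F] [Algebra K F] (a b : F) : Prop :=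
  ∃ c : Kˣ, a = (c : K) • b

variable {K F ι : Type*} [Field K]

section Ring

variable [Ring F] [Algebra K F]

theorem QCommute.of_commute {a b : F} (h : a * b = b * a) : QCommute K a b := ⟨1, by simp [h]⟩

theorem QCommute.symm {a b : F} (h : QCommute K a b) : QCommute K b a := by
  obtain ⟨c, hc⟩ := h
  exact ⟨c⁻¹, by rw [hc, smul_smul]; simp⟩

theorem QCommute.one_right (a : F) : QCommute K a 1 := .of_commute (by simp)

theorem QCommute.zero_right (a : F) : QCommute K a 0 := .of_commute (by simp)

theorem QCommute.mul_right {a b b' : F} (h : QCommute K a b) (h' : QCommute K a b') :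
    QCommute K a (b * b') := by
  obtain ⟨c, hc⟩ := h
  obtain ⟨c', hc'⟩ := h'
  refine ⟨c * c', ?_⟩
  rw [← mul_assoc, hc, smul_mul_assoc, mul_assoc, hc', mul_smul_comm, smul_smul, mul_assoc,
    Units.val_mul]

theorem QCommute.pow_right {a b : F} (h : QCommute K a b) (k : ℕ) : QCommute K a (b ^ k) := by
  induction k with
  | zero => simpa using QCommute.one_right a
  | succ k ih => rw [pow_succ]; exact ih.mul_right h

theorem QCommute.list_prod_right {a : F} {l : List F} (h : ∀ b ∈ l, QCommute K a b) :
    QCommute K a l.prod := by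
  induction l with
  | nil => simpa using QCommute.one_right a
  | cons b l ih =>
    rw [List.prod_cons]
    exact (h b (by simp)).mul_right (ih fun c hc => h c (by simp [hc]))

theorem UpToUnit.refl (a : F) : UpToUnit K a a := ⟨1, by simp⟩

theorem UpToUnit.symm {a b : F} (h : UpToUnit K a b) : UpToUnit K b a := by
  obtain ⟨c, hc⟩ := h
  exact ⟨c⁻¹, by rw [hc, smul_smul]; simp⟩

theorem UpToUnit.trans {a b c : F} (h : UpToUnit K a b) (h' : UpToUnit K b c) : UpToUnit K a c := by
  obtain ⟨d, hd⟩ := h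
  obtain ⟨e, he⟩ := h'
  exact ⟨d * e, by rw [hd, he, smul_smul]; simp⟩

theorem UpToUnit.mul {a b a' b' : F} (h : UpToUnit K a b) (h' : UpToUnit K a' b') :
    UpToUnit K (a * a') (b * b') := by
  obtain ⟨d, hd⟩ := h
  obtain ⟨e, he⟩ := h'
  exact ⟨d * e, by rw [hd, he, smul_mul_smul_comm]; simp⟩

theorem UpToUnit.mem {a b : F} (h : UpToUnit K a b) {V : Submodule K F} (hb : b ∈ V) : a ∈ V := by
  obtain ⟨d, rfl⟩ := h
  exact V.smul_mem _ hb

theorem UpToUnit.ne_zero {a b : F} (h : UpToUnit K a b) (hb : b ≠ 0) : a ≠ 0 := by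
  obtain ⟨d, rfl⟩ := h
  exact smul_ne_zero d.ne_zero hb

/-- The monomial `∏ z_i ^ s_i`, the factors being multiplied in the order of the list. -/
def listMonomial (l : List ι) (z : ι → F) (s : ι →₀ ℕ) : F := (l.map fun i => z i ^ s i).prod

theorem listMonomial_mul (l : List ι) {z : ι → F} (hz : ∀ i j, QCommute K (z i) (z j))
    (s t : ι →₀ ℕ) :
    UpToUnit K (listMonomial l z s * listMonomial l z t) (listMonomial l z (s + t)) := by
  induction l with
  | nil => exact ⟨1, by simp [listMonomial]⟩
  | cons i l ih =>
    have h : QCommute K (listMonomial l z s) (z i ^ t i) := by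
      refine (QCommute.list_prod_right ?_).symm
      simp only [List.mem_map]
      rintro _ ⟨j, -, rfl⟩
      exact (((hz i j).pow_right _).symm.pow_right _).symm
    obtain ⟨c, hc⟩ := h
    refine UpToUnit.trans ⟨c, ?_⟩ ((UpToUnit.refl (z i ^ (s i + t i))).mul ih)
    have e : ∀ r : ι →₀ ℕ, listMonomial (i :: l) z r = z i ^ r i * listMonomial l z r :=
      fun r => by simp [listMonomial]
    rw [e, e, pow_add, mul_assoc, ← mul_assoc _ (z i ^ t i), hc, smul_mul_assoc, mul_smul_comm]
    simp only [mul_assoc]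

theorem listMonomial_zero (l : List ι) (z : ι → F) : listMonomial l z 0 = 1 := by
  simp [listMonomial]

theorem listMonomial_single {l : List ι} (hl : l.Nodup) {i : ι} (hi : i ∈ l) (z : ι → F) :
    listMonomial l z (Finsupp.single i 1) = z i := by
  classical
  unfold listMonomial
  induction l with
  | nil => simp at hi
  | cons j l ih =>
    rw [List.nodup_cons] at hl
    rw [List.map_cons, List.prod_cons]
    by_cases hij : i = j
    · subst hij
      rw [Finsupp.single_eq_same, pow_one]
      have : (l.map fun k => z k ^ (Finsupp.single i 1 : ι →₀ ℕ) k) = l.map fun _ => 1 := by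
        refine List.map_congr_left fun k hk => ?_
        rw [Finsupp.single_eq_of_ne, pow_zero]
        rintro rfl; exact hl.1 hk
      rw [this]; simp
    · rw [Finsupp.single_eq_of_ne (Ne.symm hij), pow_zero, one_mul]
      exact ih hl.2 ((List.mem_cons.1 hi).resolve_left hij)

theorem finite_degree_le [Finite ι] (M : ℕ) : {s : ι →₀ ℕ | s.degree ≤ M}.Finite := by
  have := Fintype.ofFinite ι
  classical
  refine Set.Finite.subset (s := (fun f : ι → Fin (M + 1) =>
    Finsupp.equivFunOnFinite.symm fun i => (f i : ℕ)) '' Set.univ) (Set.toFinite _) ?_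
  intro s hs
  refine ⟨fun i => ⟨s i, Nat.lt_succ_of_le ((Finsupp.le_degree i s).trans hs)⟩, trivial, ?_⟩
  ext i; rfl

variable [Fintype ι]

/-- The ordered monomial `z^s`, for a fixed order of the index set. -/
noncomputable def qMonomial (z : ι → F) (s : ι →₀ ℕ) : F := listMonomial Finset.univ.toList z s

theorem qMonomial_mul {z : ι → F} (hz : ∀ i j, QCommute K (z i) (z j)) (s t : ι →₀ ℕ) :
    UpToUnit K (qMonomial z s * qMonomial z t) (qMonomial z (s + t)) :=
  listMonomial_mul _ hz s t

theorem qMonomial_zero (z : ι → F) : qMonomial z 0 = 1 := listMonomial_zero _ z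

theorem qMonomial_single (z : ι → F) (i : ι) : qMonomial z (Finsupp.single i 1) = z i :=
  listMonomial_single (Finset.nodup_toList _) (by simp) z

theorem qMonomial_qCommute {z : ι → F} {a : F} (ha : ∀ i, QCommute K a (z i)) (s : ι →₀ ℕ) :
    QCommute K a (qMonomial z s) := by
  refine QCommute.list_prod_right ?_
  simp only [List.mem_map]
  rintro _ ⟨j, -, rfl⟩
  exact (ha j).pow_right _

variable (K) in
/-- The span of the monomials of degree at most `M`. -/
noncomputable def qMonomialSpan (z : ι → F) (M : ℕ) : Submodule K F :=
  Submodule.span K (qMonomial z '' {s | s.degree ≤ M})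

theorem qMonomial_mem {z : ι → F} {M : ℕ} {s : ι →₀ ℕ} (hs : s.degree ≤ M) :
    qMonomial z s ∈ qMonomialSpan K z M :=
  Submodule.subset_span ⟨s, hs, rfl⟩

theorem mul_mem_qMonomialSpan {z : ι → F} (hz : ∀ i j, QCommute K (z i) (z j)) {M N : ℕ} {a b : F}
    (ha : a ∈ qMonomialSpan K z M) (hb : b ∈ qMonomialSpan K z N) :
    a * b ∈ qMonomialSpan K z (M + N) := by
  have : qMonomialSpan K z M * qMonomialSpan K z N ≤ qMonomialSpan K z (M + N) := by
    rw [qMonomialSpan, qMonomialSpan, Submodule.span_mul_span, Submodule.span_le]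
    rintro _ ⟨_, ⟨s, hs, rfl⟩, _, ⟨t, ht, rfl⟩, rfl⟩
    refine (qMonomial_mul hz s t).mem (qMonomial_mem ?_)
    rw [map_add]
    exact add_le_add hs ht
  exact this (Submodule.mul_mem_mul ha hb)

instance (z : ι → F) (M : ℕ) : Module.Finite K (qMonomialSpan K z M) :=
  Module.Finite.span_of_finite K ((finite_degree_le M).image _)

/-- If the monomials are linearly dependent, all of them are combinations of the monomials not
divisible by the leading one of a relation. -/
theorem finrank_qMonomialSpan_le {z : ι → F} (hz : ∀ i j, QCommute K (z i) (z j))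
    (hdep : ¬ LinearIndependent K (qMonomial z)) :
    ∃ C : ℕ, ∀ M, Module.finrank K (qMonomialSpan K z M) ≤ C * (M + 1) ^ (Fintype.card ι - 1) := by
  classical
  let : LinearOrder ι := LinearOrder.lift' (Fintype.equivFin ι) (Fintype.equivFin ι).injective
  rw [linearIndependent_iff'] at hdep
  push Not at hdep
  obtain ⟨S, g, hg, i0, hi0, hgi0⟩ := hdep
  -- `z^s` is the leading term of a relation, for the degree lexicographic order.
  obtain ⟨s, hs, hmax⟩ := Finset.exists_max_image (S.filter fun s => g s ≠ 0) toDegLex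
    ⟨i0, by simp [hi0, hgi0]⟩
  rw [Finset.mem_filter] at hs
  have hlead : qMonomial z s ∈ Submodule.span K (qMonomial z '' {t | toDegLex t < toDegLex s}) := by
    have h1 : qMonomial z s = -(g s)⁻¹ • ∑ t ∈ S.erase s, g t • qMonomial z t := by
      rw [← Finset.add_sum_erase S _ hs.1] at hg
      rw [eq_neg_of_add_eq_zero_right hg, smul_neg, neg_smul, neg_neg, smul_smul,
        inv_mul_cancel₀ hs.2, one_smul]
    rw [h1]
    refine Submodule.smul_mem _ _ (Submodule.sum_mem _ fun t ht => ?_)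
    rw [Finset.mem_erase] at ht
    by_cases h0 : g t = 0
    · rw [h0, zero_smul]; exact zero_mem _
    · refine Submodule.smul_mem _ _ (Submodule.subset_span ⟨t, lt_of_le_of_ne
        (hmax t (Finset.mem_filter.2 ⟨ht.2, h0⟩)) ?_, rfl⟩)
      exact fun h => ht.1 h
  -- Multiples of `z^s` are reduced to smaller monomials of at most the same degree.
  have hred : ∀ M (d : DegLex (ι →₀ ℕ)), (ofDegLex d).degree ≤ M → qMonomial z (ofDegLex d) ∈
      Submodule.span K (qMonomial z '' {t | t.degree ≤ M ∧ ¬ s ≤ t}) := by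
    intro M d
    induction d using WellFoundedLT.induction with
    | ind d ih =>
    intro hd
    by_cases hsd : s ≤ ofDegLex d
    · obtain ⟨r, hr⟩ := exists_add_of_le hsd
      have h1 : qMonomial z r * qMonomial z s ∈
          Submodule.span K (qMonomial z '' {t | t.degree ≤ M ∧ ¬ s ≤ t}) := by
        have h2 := Submodule.mem_map_of_mem (f := LinearMap.mulLeft K (qMonomial z r)) hlead
        rw [Submodule.map_span] at h2
        refine Submodule.span_le.2 ?_ h2
        rintro _ ⟨_, ⟨t, ht, rfl⟩, rfl⟩
        refine (qMonomial_mul hz r t).mem ?_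
        have hlt : toDegLex (r + t) < d := by
          have : d = toDegLex (r + s) := by rw [add_comm, ← hr]; rfl
          rw [this, toDegLex_add, toDegLex_add]
          exact (add_lt_add_iff_left _).2 ht
        exact ih _ hlt ((Finsupp.DegLex.monotone_degree hlt.le).trans hd)
      rw [hr, add_comm]
      exact (qMonomial_mul hz r s).symm.mem h1
    · exact Submodule.subset_span ⟨_, ⟨hd, hsd⟩, rfl⟩
  -- An exponent `t` with `¬ s ≤ t` has `t i < s i` for some `i`; the other entries are at most `M`.
  let box (M : ℕ) : Finset (ι → ℕ) := Finset.univ.biUnion fun i =>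
    Fintype.piFinset fun j => if j = i then Finset.range (s i) else Finset.range (M + 1)
  have hbox : ∀ M, (box M).card ≤ (∑ i, s i) * (M + 1) ^ (Fintype.card ι - 1) := by
    intro M
    refine Finset.card_biUnion_le.trans (le_of_eq ?_)
    rw [Finset.sum_mul]
    refine Finset.sum_congr rfl fun i _ => ?_
    rw [Fintype.card_piFinset, ← Finset.mul_prod_erase _ _ (Finset.mem_univ i), if_pos rfl,
      Finset.card_range, Finset.prod_congr rfl (g := fun _ => M + 1), Finset.prod_const,
      Finset.card_erase_of_mem (Finset.mem_univ i), Finset.card_univ]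
    intro j hj
    rw [if_neg (Finset.ne_of_mem_erase hj), Finset.card_range]
  refine ⟨∑ i, s i, fun M => le_trans ?_ (hbox M)⟩
  have hle : qMonomialSpan K z M ≤ Submodule.span K
      ((box M).image fun f => qMonomial z (Finsupp.equivFunOnFinite.symm f) : Finset F) := by
    rw [qMonomialSpan, Submodule.span_le]
    rintro _ ⟨t, ht, rfl⟩
    refine Submodule.span_mono ?_ (hred M (toDegLex t) ht)
    rintro _ ⟨r, ⟨hr, hsr⟩, rfl⟩
    simp only [Finset.coe_image, Set.mem_image]
    refine ⟨r, ?_, by congr 1; ext i; rfl⟩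
    rw [Finsupp.le_def] at hsr
    push Not at hsr
    obtain ⟨i, hi⟩ := hsr
    simp only [box, Finset.mem_coe, Finset.mem_biUnion, Finset.mem_univ, true_and,
      Fintype.mem_piFinset]
    refine ⟨i, fun j => ?_⟩
    split_ifs with hj
    · subst hj; simpa using hi
    · rw [Finset.mem_range]
      exact Nat.lt_succ_of_le ((Finsupp.le_degree j r).trans hr)
  exact ((Submodule.finrank_mono hle).trans (finrank_span_finset_le_card _)).trans
    Finset.card_image_le

end Ring

end QCommuting

/-! ### Growth of Laurent algebras -/

section Growth

variable {K F ι : Type*} [Field K] [DivisionRing F] [Algebra K F]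

theorem QCommute.inv_right {a b : F} (h : QCommute K a b) : QCommute K a b⁻¹ := by
  obtain rfl | hb := eq_or_ne b 0
  · simpa using QCommute.zero_right a
  obtain ⟨c, hc⟩ := h.symm
  refine ⟨c, ?_⟩
  apply mul_left_cancel₀ hb
  rw [← mul_assoc, hc, mul_smul_comm, smul_mul_assoc, mul_assoc, mul_inv_cancel₀ hb,
    mul_inv_cancel_left₀ hb, mul_one]

variable (K) in
/-- The algebra generated by the elements `z_i` and their inverses (with `0⁻¹ = 0`). -/
def laurentAlgebra (z : ι → F) : Subalgebra K F :=
  Algebra.adjoin K (Set.range z ∪ Set.range fun i => (z i)⁻¹)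

theorem mem_laurentAlgebra (z : ι → F) (i : ι) : z i ∈ laurentAlgebra K z :=
  Algebra.subset_adjoin (Or.inl ⟨i, rfl⟩)

theorem inv_mem_laurentAlgebra (z : ι → F) (i : ι) : (z i)⁻¹ ∈ laurentAlgebra K z :=
  Algebra.subset_adjoin (Or.inr ⟨i, rfl⟩)

variable (K) in
/-- The span of `1`, the elements `z_i` and their inverses. -/
def laurentSpan (z : ι → F) : Submodule K F :=
  Submodule.span K (insert 1 (Set.range z ∪ Set.range fun i => (z i)⁻¹))

theorem one_mem_laurentSpan (z : ι → F) : 1 ∈ laurentSpan K z :=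
  Submodule.subset_span (Set.mem_insert _ _)

theorem laurentSpan_pow_mono (z : ι → F) : Monotone fun k : ℕ => laurentSpan K z ^ k :=
  fun _ _ h => pow_right_mono₀ (Submodule.one_le.2 (one_mem_laurentSpan z)) h

theorem exists_mem_laurentSpan_pow {z : ι → F} {a : F} (ha : a ∈ laurentAlgebra K z) :
    ∃ k : ℕ, a ∈ laurentSpan K z ^ k := by
  induction ha using Algebra.adjoin_induction with
  | mem a ha =>
    exact ⟨1, by rw [pow_one]; exact Submodule.subset_span (Set.mem_insert_of_mem _ ha)⟩
  | algebraMap c =>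
    refine ⟨0, ?_⟩
    rw [pow_zero, Submodule.mem_one]
    exact ⟨c, rfl⟩
  | add a b _ _ ha hb =>
    obtain ⟨k, hk⟩ := ha
    obtain ⟨l, hl⟩ := hb
    exact ⟨max k l, add_mem (laurentSpan_pow_mono z (le_max_left k l) hk)
      (laurentSpan_pow_mono z (le_max_right k l) hl)⟩
  | mul a b _ _ ha hb =>
    obtain ⟨k, hk⟩ := ha
    obtain ⟨l, hl⟩ := hb
    exact ⟨k + l, by rw [pow_add]; exact Submodule.mul_mem_mul hk hl⟩

variable [Fintype ι]

instance (z : ι → F) : Module.Finite K (laurentSpan K z) :=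
  Module.Finite.span_of_finite K (((Set.finite_range _).union (Set.finite_range _)).insert _)

instance (z : ι → F) (k : ℕ) : Module.Finite K ↥(laurentSpan K z ^ k) := by
  rw [Module.Finite.iff_fg]
  exact Submodule.FG.pow (Module.Finite.iff_fg.1 inferInstance) k

/-- Up to the `k`-th power of the product of all nonzero `z_i`, words of length `k` in the
`z_i`, `z_i⁻¹` are words in the `z_i`. -/
theorem finrank_laurentSpan_pow_le {z : ι → F} (hz : ∀ i j, QCommute K (z i) (z j)) (k : ℕ) :
    Module.finrank K ↥(laurentSpan K z ^ k) ≤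
      Module.finrank K (qMonomialSpan K z ((Fintype.card ι + 1) * k)) := by
  classical
  set s : ι →₀ ℕ := Finsupp.equivFunOnFinite.symm fun i => if z i = 0 then 0 else 1 with hs
  set m := qMonomial z s with hm
  have hs1 : s.degree ≤ Fintype.card ι := by
    rw [Finsupp.degree_eq_sum, ← Finset.card_univ, Finset.card_eq_sum_ones]
    refine Finset.sum_le_sum fun i _ => ?_
    simp only [hs, Finsupp.equivFunOnFinite_symm_apply_apply]
    split_ifs <;> simp
  have hm0 : m ≠ 0 := by
    rw [hm, qMonomial, listMonomial]
    refine List.prod_ne_zero ?_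
    simp only [List.mem_map, not_exists, not_and]
    intro i _ h
    simp only [hs, Finsupp.equivFunOnFinite_symm_apply_apply] at h
    split_ifs at h with h0
    · simp at h
    · exact h0 (by simpa using h)
  have hgen : ∀ a ∈ insert (1 : F) (Set.range z ∪ Set.range fun i => (z i)⁻¹),
      m * a ∈ qMonomialSpan K z (Fintype.card ι + 1) ∧ QCommute K m a := by
    have hmz : ∀ i, QCommute K m (z i) := fun i =>
      (qMonomial_qCommute (fun j => hz i j) s).symm
    rintro _ (rfl | ⟨i, rfl⟩ | ⟨i, rfl⟩)
    · exact ⟨by rw [mul_one]; exact qMonomial_mem (by omega), .one_right _⟩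
    · refine ⟨mul_mem_qMonomialSpan hz (qMonomial_mem hs1) ?_, hmz i⟩
      rw [← qMonomial_single z i]
      exact qMonomial_mem (by simp)
    · refine ⟨?_, (hmz i).inv_right⟩
      by_cases h0 : z i = 0
      · simp [h0]
      have h1 : s - Finsupp.single i 1 + Finsupp.single i 1 = s := by
        refine tsub_add_cancel_of_le ?_
        rw [Finsupp.single_le_iff]
        simp [hs, h0]
      have h2 := qMonomial_mul hz (s - Finsupp.single i 1) (Finsupp.single i 1)
      rw [h1, qMonomial_single] at h2
      have h3 := h2.symm.mul (UpToUnit.refl (K := K) (z i)⁻¹)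
      rw [mul_assoc, mul_inv_cancel₀ h0, mul_one] at h3
      refine h3.mem (qMonomial_mem ?_)
      have : (s - Finsupp.single i 1).degree ≤ s.degree := by
        conv_rhs => rw [← h1, map_add]
        omega
      omega
  -- `m` commutes up to scalars with all `z_i`, so each letter of a word takes up one factor `m`.
  have key : ∀ k, ∀ a ∈ laurentSpan K z ^ k,
      m ^ k * a ∈ qMonomialSpan K z ((Fintype.card ι + 1) * k) := by
    intro k
    induction k with
    | zero =>
      intro a ha
      rw [pow_zero, Submodule.mem_one] at ha
      obtain ⟨c, rfl⟩ := ha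
      rw [pow_zero, one_mul, Algebra.algebraMap_eq_smul_one, ← qMonomial_zero z]
      exact Submodule.smul_mem _ _ (qMonomial_mem (by simp))
    | succ k ih =>
      intro a ha
      rw [pow_succ'] at ha
      induction ha using Submodule.mul_induction_on' with
      | add a _ b _ ha hb => rw [mul_add (m ^ (k + 1))]; exact add_mem ha hb
      | mem_mul_mem v hv w hw =>
      induction hv using Submodule.span_induction with
      | zero => simp
      | add v v' _ _ h h' => rw [add_mul v, mul_add (m ^ (k + 1))]; exact add_mem h h'
      | smul c v _ h => rw [smul_mul_assoc, mul_smul_comm]; exact Submodule.smul_mem _ _ h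
      | mem v hv =>
        obtain ⟨h1, h2⟩ := hgen v hv
        obtain ⟨c, hc⟩ := (h2.symm.pow_right k).symm
        have : m ^ (k + 1) * (v * w) = (c : K) • (m * v * (m ^ k * w)) := by
          rw [pow_succ', mul_assoc, ← mul_assoc (m ^ k), hc, smul_mul_assoc, mul_smul_comm]
          simp only [mul_assoc]
        rw [this, mul_add, mul_one, add_comm]
        exact Submodule.smul_mem _ _ (mul_mem_qMonomialSpan hz h1 (ih w hw))
  let f : ↥(laurentSpan K z ^ k) →ₗ[K] qMonomialSpan K z ((Fintype.card ι + 1) * k) :=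
    ((LinearMap.mulLeft K (m ^ k)).domRestrict _).codRestrict _ fun a => key k a a.2
  refine LinearMap.finrank_le_finrank_of_injective (f := f) fun a b hab => ?_
  have := congrArg Subtype.val hab
  exact Subtype.ext (mul_left_cancel₀ (pow_ne_zero k hm0) this)

theorem finrank_submodule_mul_le (P Q : Submodule K F) [Module.Finite K P] [Module.Finite K Q] :
    Module.finrank K ↥(P * Q) ≤ Module.finrank K P * Module.finrank K Q := by
  classical
  have h : ∀ P : Submodule K F, Module.Finite K P →
      ∃ s : Finset F, s.card ≤ Module.finrank K P ∧ Submodule.span K (s : Set F) = P := by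
    intro P hP
    let b := Module.finBasis K P
    refine ⟨Finset.univ.image fun i => (b i : F), Finset.card_image_le.trans (by simp), ?_⟩
    have := congrArg (Submodule.map P.subtype) b.span_eq
    rw [Submodule.map_span, Submodule.map_top, Submodule.range_subtype, ← Set.range_comp] at this
    simpa [Function.comp_def] using this
  obtain ⟨s, hs, rfl⟩ := h P inferInstance
  obtain ⟨t, ht, rfl⟩ := h Q inferInstance
  refine le_trans ?_ (Nat.mul_le_mul hs ht)
  rw [Submodule.span_mul_span, ← Finset.coe_mul]
  exact (finrank_span_finset_le_card _).trans Finset.card_mul_le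

end Growth

section GrowthQField

open MvPolynomial

variable {K : Type*} [Field K] {n : ℕ}

/-- Words in commuting elements: a property compatible with lengths and products passes from the
elements to the monomials in them. -/
theorem commEval_monomial_induction {A ι : Type*} [Ring A] [Algebra K A] {x : ι → A}
    {hx : ∀ i j, x i * x j = x j * x i} {P : ℕ → A → Prop} (h1 : P 0 1)
    (hmul : ∀ k l a b, P k a → P l b → P (k + l) (a * b)) (hP : ∀ i, P 1 (x i)) (s : ι →₀ ℕ) :
    P s.degree (commEval (K := K) x hx (monomial s 1)) := by
  induction s using Finsupp.induction_linear with
  | zero => simpa using h1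
  | add s t hs ht =>
    rw [← one_mul (1 : K), ← monomial_mul, map_mul, map_add]
    exact hmul _ _ _ _ hs ht
  | single i k =>
    rw [Finsupp.degree_single]
    induction k with
    | zero => simpa using h1
    | succ k ih =>
      rw [Finsupp.single_add, ← one_mul (1 : K), ← monomial_mul, map_mul]
      refine hmul _ _ _ _ ih ?_
      have := hP i
      rwa [← commEval_X (K := K) x hx i] at this

/-- Let `Q` be a finite-dimensional space such that `x_i Q` and `y_i Q` lie in `Q T`, for the
algebra `T` generated by `2 n` elements commuting up to scalars, and their inverses. Then the
ordered monomials in these elements are linearly independent: otherwise the growth of `T`, hence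
that of `Q T`, would be less than the growth of `O_q̄(K^{2n})`. -/
theorem linearIndependent_qMonomial_of_mul_mem (hn : 0 < n) {q : Fin n → Kˣ} {ι : Type*}
    [Fintype ι] (hι : Fintype.card ι = 2 * n) {z : ι → QField q}
    (hz : ∀ i j, QCommute K (z i) (z j)) (Q : Submodule K (QField q)) [Module.Finite K Q]
    (h1 : 1 ∈ Q) (hx : ∀ i, ∀ a ∈ Q, QField.x q i * a ∈ Q * (laurentAlgebra K z).toSubmodule)
    (hy : ∀ i, ∀ a ∈ Q, QField.y q i * a ∈ Q * (laurentAlgebra K z).toSubmodule) :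
    LinearIndependent K (qMonomial z) := by
  classical
  by_contra hdep
  obtain ⟨C, hC⟩ := finrank_qMonomialSpan_le hz hdep
  set V := laurentSpan K z with hV
  -- `P k a` says that `a Q ⊆ Q V ^ k`.
  let P (k : ℕ) (a : QAffine q) : Prop := ∀ b ∈ Q, SkewFrac.of K _ a * b ∈ Q * V ^ k
  have hmono : ∀ {k l : ℕ}, k ≤ l → Q * V ^ k ≤ Q * V ^ l := fun h =>
    mul_le_mul_right (laurentSpan_pow_mono z h) Q
  -- `Q` being finite-dimensional, a bounded length suffices for `g Q ⊆ Q T`.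
  have hfin : ∀ g : QField q, (∀ a ∈ Q, g * a ∈ Q * (laurentAlgebra K z).toSubmodule) →
      ∃ c : ℕ, ∀ a ∈ Q, g * a ∈ Q * V ^ c := by
    intro g hg
    have hmem : ∀ a ∈ Q * (laurentAlgebra K z).toSubmodule, ∃ c : ℕ, a ∈ Q * V ^ c := by
      intro a ha
      induction ha using Submodule.mul_induction_on' with
      | add a _ b _ ha hb =>
        obtain ⟨k, hk⟩ := ha
        obtain ⟨l, hl⟩ := hb
        exact ⟨max k l, add_mem (hmono (le_max_left k l) hk) (hmono (le_max_right k l) hl)⟩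
      | mem_mul_mem v hv w hw =>
        obtain ⟨k, hk⟩ := exists_mem_laurentSpan_pow hw
        exact ⟨k, Submodule.mul_mem_mul hv hk⟩
    obtain ⟨s, hs⟩ := Module.Finite.iff_fg.1 (inferInstance : Module.Finite K Q)
    have hsQ : ∀ a ∈ s, a ∈ Q := fun a ha => hs ▸ Submodule.subset_span ha
    choose! c hc using fun a (ha : a ∈ s) => hmem _ (hg a (hsQ a ha))
    refine ⟨s.sup c, fun a ha => ?_⟩
    rw [← hs] at ha
    induction ha using Submodule.span_induction with
    | zero => simp
    | add v v' _ _ h h' => rw [mul_add]; exact add_mem h h'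
    | smul c v _ h => rw [mul_smul_comm]; exact Submodule.smul_mem _ _ h
    | mem v hv => exact hmono (Finset.le_sup hv) (hc v hv)
  choose cx hcx using fun i => hfin _ (hx i)
  choose cy hcy using fun i => hfin _ (hy i)
  set c := Finset.univ.sup cx + Finset.univ.sup cy with hc
  have hPmul : ∀ k l a b, P (c * k) a → P (c * l) b → P (c * (k + l)) (a * b) := by
    intro k l a b ha hb w hw
    rw [map_mul, mul_assoc, mul_add, pow_add, ← mul_assoc]
    have := hb w hw
    generalize SkewFrac.of K _ b * w = v at this
    induction this using Submodule.mul_induction_on' with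
    | add a _ b _ ha hb => rw [mul_add]; exact add_mem ha hb
    | mem_mul_mem v hv w hw => rw [← mul_assoc]; exact Submodule.mul_mem_mul (ha v hv) hw
  have hP1 : P (c * 0) 1 := by
    intro b hb
    simpa using hb
  have hPx : ∀ i, P (c * 1) (QAffine.x q i) := fun i b hb => by
    refine hmono ?_ (hcx i b hb)
    have := Finset.le_sup (f := cx) (Finset.mem_univ i)
    omega
  have hPy : ∀ i, P (c * 1) (QAffine.y q i) := fun i b hb => by
    refine hmono ?_ (hcy i b hb)
    have := Finset.le_sup (f := cy) (Finset.mem_univ i)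
    omega
  have hPmono : ∀ s, P (c * s.degree) (QAffine.mono q s) := by
    intro s
    have := hPmul _ _ _ _ (commEval_monomial_induction (K := K) (x := QAffine.x q)
        (hx := QAffine.x_mul_x q) (P := fun k => P (c * k)) hP1 hPmul hPx
        (s.comapDomain Sum.inl Sum.inl_injective.injOn))
      (commEval_monomial_induction (K := K) (x := QAffine.y q)
        (hx := QAffine.y_mul_y q) (P := fun k => P (c * k)) hP1 hPmul hPy
        (s.comapDomain Sum.inr Sum.inr_injective.injOn))
    have hdeg : s.degree = (s.comapDomain Sum.inl Sum.inl_injective.injOn).degree +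
        (s.comapDomain Sum.inr Sum.inr_injective.injOn).degree := by
      simp [Finsupp.degree_eq_sum]
    rw [hdeg]
    exact this
  -- The `N ^ (2 * n)` monomials with exponents below `N` lie in `Q V ^ (c * (2 * n * N))`.
  have hlow : ∀ N : ℕ, N ^ (2 * n) ≤ Module.finrank K ↥(Q * V ^ (c * (2 * n * N))) := by
    intro N
    let e (p : Fin n ⊕ Fin n → Fin N) : Fin n ⊕ Fin n →₀ ℕ :=
      Finsupp.equivFunOnFinite.symm fun i => (p i : ℕ)
    have he : Function.Injective e := by
      intro p p' hp
      funext i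
      exact Fin.ext (DFunLike.congr_fun hp i)
    have hdeg : ∀ p, (e p).degree ≤ 2 * n * N := by
      intro p
      rw [Finsupp.degree_eq_sum]
      refine (Finset.sum_le_card_nsmul _ _ N fun i _ => (p i).2.le).trans (le_of_eq ?_)
      simp; left; ring
    have hli : LinearIndependent K fun p => SkewFrac.of K _ (QAffine.mono q (e p)) := by
      have := ((QAffine.basis q).linearIndependent.comp _ he).map'
        (SkewFrac.of K (QAffine q)).toLinearMap (LinearMap.ker_eq_bot.2 (SkewFrac.of_injective K))
      simpa [Function.comp_def, QAffine.basis] using this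
    have hmem : ∀ p, SkewFrac.of K _ (QAffine.mono q (e p)) ∈ Q * V ^ (c * (2 * n * N)) := by
      intro p
      have := hPmono (e p) 1 h1
      rw [mul_one] at this
      exact hmono (Nat.mul_le_mul_left _ (hdeg p)) this
    let f : (Fin n ⊕ Fin n → Fin N) → ↥(Q * V ^ (c * (2 * n * N))) := fun p => ⟨_, hmem p⟩
    have hf : LinearIndependent K f := LinearIndependent.of_comp (Submodule.subtype _) hli
    have : Module.Finite K ↥(Q * V ^ (c * (2 * n * N))) := by
      rw [Module.Finite.iff_fg]
      exact Submodule.FG.mul (Module.Finite.iff_fg.1 inferInstance)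
        (Module.Finite.iff_fg.1 inferInstance)
    have := hf.fintype_card_le_finrank
    simpa [← two_mul] using this
  -- If the monomials in the `z_i` are dependent, the dimension grows like `N ^ (2 * n - 1)` only.
  have hup : ∀ N : ℕ, 1 ≤ N → N ≤ Module.finrank K Q * C *
      ((2 * n + 1) * (c * (2 * n)) + 1) ^ (2 * n - 1) := by
    intro N hN
    have h2 := (hlow N).trans (finrank_submodule_mul_le _ _)
    have h3 := (finrank_laurentSpan_pow_le hz (c * (2 * n * N))).trans (hC _)
    rw [hι] at h3
    have h4 := h2.trans (Nat.mul_le_mul_left _ h3)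
    have h5 : (2 * n + 1) * (c * (2 * n * N)) + 1 ≤ ((2 * n + 1) * (c * (2 * n)) + 1) * N := by
      nlinarith
    have h6 := h4.trans (Nat.mul_le_mul_left _ (Nat.mul_le_mul_left _ (Nat.pow_le_pow_left h5 _)))
    obtain ⟨r, hr⟩ : ∃ r, 2 * n = r + 1 := ⟨2 * n - 1, by omega⟩
    have hr' : 2 * n - 1 = r := by omega
    rw [hr', mul_pow] at h6
    rw [hr']
    have h7 : N ^ (2 * n) = N * N ^ r := by rw [hr, pow_succ, mul_comm]
    rw [h7] at h6
    refine Nat.le_of_mul_le_mul_right (c := N ^ r) ?_ (by positivity)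
    calc _ ≤ _ := h6
      _ = _ := by ring
  have := hup (Module.finrank K Q * C * ((2 * n + 1) * (c * (2 * n)) + 1) ^ (2 * n - 1) + 1)
    (by omega)
  omega

end GrowthQField

/-! ### Homomorphisms of skew fields of fractions -/

noncomputable section SkewFracLift

open nonZeroDivisors

variable {K A F : Type*} [Field K] [Ring A] [Algebra K A] [Nontrivial A] [NoZeroDivisors A]
  [OreLocalization.OreSet A⁰] [DivisionRing F] [Algebra K F]

namespace SkewFrac

/-- The extension of an injective homomorphism `A → F` to the skew field of fractions. -/
def lift (f : A →ₐ[K] F) (hf : Function.Injective f) : SkewFrac A →ₐ[K] F :=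
  { OreLocalization.universalHom f.toRingHom
      (Units.liftRight (f.toMonoidHom.comp (A⁰).subtype)
        (fun s => Units.mk0 (f s) (by
          rw [Ne, map_eq_zero_iff _ hf]
          exact nonZeroDivisors.coe_ne_zero s))
        (fun _ => rfl))
      (fun _ => rfl) with
    commutes' := fun c => by
      refine (OreLocalization.universalHom_commutes _ _ _ (r := algebraMap K A c)).trans ?_
      exact f.commutes c }

@[simp] theorem lift_of (f : A →ₐ[K] F) (hf : Function.Injective f) (a : A) :
    lift f hf (of K A a) = f a :=
  OreLocalization.universalHom_commutes _ _ _

/-- A subalgebra closed under inverses that contains the images of `A` contains those of `Frac A`. -/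
theorem mem_of_forall_mem {φ : SkewFrac A →ₐ[K] F} {D : Subalgebra K F}
    (hinv : ∀ a ∈ D, a⁻¹ ∈ D) (h : ∀ a, φ (of K A a) ∈ D) (z : SkewFrac A) : φ z ∈ D := by
  obtain ⟨a, s, rfl⟩ := exists_eq K z
  rw [map_mul, map_inv₀]
  exact D.mul_mem (hinv _ (h _)) (h _)

theorem algHom_ext {φ ψ : SkewFrac A →ₐ[K] F} (h : ∀ a, φ (of K A a) = ψ (of K A a)) : φ = ψ := by
  ext z
  obtain ⟨a, s, rfl⟩ := exists_eq K z
  simp [h]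

theorem inv_mem_range (φ : SkewFrac A →ₐ[K] F) (a : F) (ha : a ∈ φ.range) : a⁻¹ ∈ φ.range := by
  obtain ⟨b, rfl⟩ := ha
  exact ⟨b⁻¹, map_inv₀ φ b⟩

end SkewFrac

namespace QAffine

variable {n : ℕ} {q : Fin n → Kˣ}

theorem mem_of_gen_mem {φ : QAffine q →ₐ[K] F} {D : Subalgebra K F} (hx : ∀ i, φ (x q i) ∈ D)
    (hy : ∀ i, φ (y q i) ∈ D) (a : QAffine q) : φ a ∈ D := by
  induction a using induction_left with
  | h0 => rw [map_one]; exact D.one_mem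
  | hadd a b ha hb => rw [map_add]; exact D.add_mem ha hb
  | hsmul c a ha => rw [map_smul]; exact D.smul_mem ha c
  | hx i a ha => rw [map_mul]; exact D.mul_mem (hx i) ha
  | hy i a ha => rw [map_mul]; exact D.mul_mem (hy i) ha

end QAffine

namespace QField

variable {n : ℕ} {q : Fin n → Kˣ}

theorem mem_of_gen_mem {φ : QField q →ₐ[K] F} {D : Subalgebra K F} (hinv : ∀ a ∈ D, a⁻¹ ∈ D)
    (hx : ∀ i, φ (x q i) ∈ D) (hy : ∀ i, φ (y q i) ∈ D) (a : QField q) : φ a ∈ D :=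
  SkewFrac.mem_of_forall_mem hinv
    (QAffine.mem_of_gen_mem (φ := φ.comp (SkewFrac.of K _)) hx hy) a

theorem algHom_ext {φ ψ : QField q →ₐ[K] F} (hx : ∀ i, φ (x q i) = ψ (x q i))
    (hy : ∀ i, φ (y q i) = ψ (y q i)) : φ = ψ := by
  refine SkewFrac.algHom_ext fun a => ?_
  exact DFunLike.congr_fun (QAffine.hom_ext (f := φ.comp (SkewFrac.of K _))
    (g := ψ.comp (SkewFrac.of K _)) hx hy) a

theorem x_mul_x (i j : Fin n) : x q i * x q j = x q j * x q i := by
  simp only [x, ← map_mul, QAffine.x_mul_x]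

theorem y_mul_y (i j : Fin n) : y q i * y q j = y q j * y q i := by
  simp only [y, ← map_mul, QAffine.y_mul_y]

theorem y_mul_x (i j : Fin n) :
    y q i * x q j = (if i = j then (q i : K) else 1) • (x q j * y q i) := by
  rw [x, y, ← map_mul, QAffine.y_mul_x, map_smul, map_mul]

theorem x_ne_zero (i : Fin n) : x q i ≠ 0 := by
  rw [x, Ne, map_eq_zero_iff _ (SkewFrac.of_injective K)]
  intro h
  have := congrArg (fun a => QAffine.rep q a 1) h
  simp [QAffine.rep] at this

theorem y_mul_poly (i : Fin n) (f : MvPolynomial (Fin n) K) :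
    ∃ g, y q i * poly q f = poly q g * y q i := by
  obtain ⟨g, hg⟩ := QAffine.y_mul_px q i f
  exact ⟨g, by simp only [y, poly, AlgHom.comp_apply, ← map_mul, hg]⟩

end QField

end SkewFracLift

noncomputable section Package

open nonZeroDivisors

variable {K : Type*} [Field K] {n : ℕ} {q q' : Fin n → Kˣ}

/-- Elements of a skew field that satisfy the relations of the generators `x_i`, `y_i`. -/
structure QRelations {F : Type*} [DivisionRing F] [Algebra K F] (q : Fin n → Kˣ)
    (a b : Fin n → F) : Prop where
  aa : ∀ i j, a i * a j = a j * a i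
  bb : ∀ i j, b i * b j = b j * b i
  ba : ∀ i j, b i * a j = (if i = j then (q i : K) else 1) • (a j * b i)

namespace QRelations

variable {a b : Fin n → QField q}

theorem qCommute (h : QRelations q' a b) (i j : Fin n ⊕ Fin n) :
    QCommute K (Sum.elim a b i) (Sum.elim a b j) := by
  have hba : ∀ i j, QCommute K (b i) (a j) := fun i j => by
    refine ⟨if i = j then q' i else 1, ?_⟩
    rw [h.ba]
    split_ifs <;> simp
  rcases i with i | i <;> rcases j with j | j
  · exact .of_commute (h.aa i j)
  · exact (hba j i).symm
  · exact hba i j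
  · exact .of_commute (h.bb i j)

/-- A homomorphism that sends the commuting elements `x_i` to some of the `z_j` sends monomials to
monomials, up to scalars that arise from reordering. -/
theorem commEval_monomial {A F : Type*} [Ring A] [Algebra K A] [Ring F] [Algebra K F]
    (φ : A →ₐ[K] F) {ι κ : Type*} [Fintype κ] {x : ι → A} (hx : ∀ i j, x i * x j = x j * x i)
    {z : κ → F} (hz : ∀ i j, QCommute K (z i) (z j)) (e : ι → κ) (he : ∀ i, φ (x i) = z (e i))
    (s : ι →₀ ℕ) : UpToUnit K (φ (commEval (K := K) x hx (MvPolynomial.monomial s 1)))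
      (qMonomial z (s.mapDomain e)) := by
  induction s using Finsupp.induction_linear with
  | zero => simpa [qMonomial_zero] using UpToUnit.refl (K := K) (1 : F)
  | add s t hs ht =>
    rw [← one_mul (1 : K), ← MvPolynomial.monomial_mul, map_mul, map_mul, Finsupp.mapDomain_add]
    exact (hs.mul ht).trans (qMonomial_mul hz _ _)
  | single i k =>
    rw [Finsupp.mapDomain_single]
    induction k with
    | zero => simpa [qMonomial_zero] using UpToUnit.refl (K := K) (1 : F)
    | succ k ih =>
      rw [Finsupp.single_add, Finsupp.single_add, ← one_mul (1 : K), ← MvPolynomial.monomial_mul,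
        map_mul, map_mul]
      refine (ih.mul ?_).trans (qMonomial_mul hz _ _)
      have := commEval_X (K := K) x hx i
      rw [MvPolynomial.X] at this
      rw [this, he, qMonomial_single]
      exact .refl _

/-- The homomorphism from the quantum affine space is injective if the ordered monomials in the
images of the generators are linearly independent. -/
theorem lift_injective (h : QRelations q' a b)
    (hli : LinearIndependent K (qMonomial (Sum.elim a b))) :
    Function.Injective (QAffine.lift q' a b h.aa h.bb h.ba) := by
  set φ := QAffine.lift q' a b h.aa h.bb h.ba with hφ
  have hu : ∀ s, UpToUnit K (φ (QAffine.basis q' s)) (qMonomial (Sum.elim a b) s) := by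
    intro s
    rw [QAffine.basis, Module.Basis.mk_apply, QAffine.mono, map_mul]
    have h1 := (commEval_monomial φ (QAffine.x_mul_x q') h.qCommute Sum.inl
        (fun i => by simp [hφ]) (s.comapDomain Sum.inl Sum.inl_injective.injOn)).mul
      (commEval_monomial φ (QAffine.y_mul_y q') h.qCommute Sum.inr
        (fun i => by simp [hφ]) (s.comapDomain Sum.inr Sum.inr_injective.injOn))
    have h2 := h1.trans (qMonomial_mul h.qCommute _ _)
    rwa [QAffine.mono_exp] at h2
  choose u hu using hu
  have hli' : LinearIndependent K fun s => φ (QAffine.basis q' s) := by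
    convert hli.units_smul u using 1
    funext s
    exact hu s
  rw [injective_iff_map_eq_zero]
  intro w hw
  have h1 := congrArg φ ((QAffine.basis q').linearCombination_repr w)
  rw [hw, Finsupp.linearCombination_apply, Finsupp.sum, map_sum] at h1
  simp only [map_smul] at h1
  apply (QAffine.basis q').repr.injective
  rw [map_zero]
  apply linearIndependent_iff.1 hli'
  rw [Finsupp.linearCombination_apply]
  exact h1

/-- The Laurent algebra of the elements `a_i`, `b_i`. -/
abbrev laurent (a b : Fin n → QField q) : Subalgebra K (QField q) :=
  laurentAlgebra K (Sum.elim a b)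

/-- If `x_i` is integral over the polynomials that lie in an algebra `T` and `y_i ∈ K[x] T`, then
there is a finite-dimensional `Q ⊆ K[x]` with `x_i Q ⊆ Q T` and `y_i Q ⊆ Q T`. -/
theorem exists_finite_generators (T : Subalgebra K (QField q))
    (hint : ∀ i, IsIntegral (T.comap (QField.poly q)) (MvPolynomial.X i : MvPolynomial (Fin n) K))
    (hy : ∀ i, QField.y q i ∈ (QField.poly q).range.toSubmodule * T.toSubmodule) :
    ∃ Q : Submodule K (QField q), Module.Finite K Q ∧ 1 ∈ Q ∧ Q ≤ (QField.poly q).range.toSubmodule ∧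
      (∀ i, ∀ w ∈ Q, QField.x q i * w ∈ Q * T.toSubmodule) ∧
      (∀ i, ∀ w ∈ Q, QField.y q i * w ∈ Q * T.toSubmodule) := by
  classical
  set E := T.comap (QField.poly q) with hE
  -- `K[x]` is integral and finitely generated over `E`, hence a finite module.
  have hfin : Module.Finite E (MvPolynomial (Fin n) K) := by
    rw [Algebra.finite_iff_isIntegral_and_finiteType]
    refine ⟨⟨fun p => ?_⟩, Algebra.FiniteType.of_restrictScalars_finiteType K _ _⟩
    induction p using MvPolynomial.induction_on with
    | C c => exact isIntegral_algebraMap (R := E) (x := algebraMap K E c)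
    | add p p' hp hp' => exact hp.add hp'
    | mul_X p i hp => exact hp.mul (hint i)
  obtain ⟨s, hs⟩ := hfin.fg_top
  set Q : Submodule K (QField q) :=
    Submodule.span K (insert 1 (QField.poly q '' s)) with hQ
  have hQpoly : Q ≤ (QField.poly q).range.toSubmodule := by
    rw [hQ, Submodule.span_le]
    rintro _ (rfl | ⟨p, -, rfl⟩)
    · exact one_mem (QField.poly q).range
    · exact ⟨p, rfl⟩
  have hpoly : (QField.poly q).range.toSubmodule ≤ Q * T.toSubmodule := by
    rintro _ ⟨p, rfl⟩
    have hp : p ∈ Submodule.span E (s : Set (MvPolynomial (Fin n) K)) := by rw [hs]; trivial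
    change QField.poly q p ∈ _
    induction hp using Submodule.span_induction with
    | zero => simp
    | add p p' _ _ hp hp' => rw [map_add]; exact add_mem hp hp'
    | smul c p _ hp =>
      rw [Algebra.smul_def, mul_comm, map_mul]
      generalize QField.poly q p = v at hp
      induction hp using Submodule.mul_induction_on' with
      | add a _ b _ ha hb => rw [add_mul]; exact add_mem ha hb
      | mem_mul_mem v hv w hw =>
        rw [mul_assoc]
        exact Submodule.mul_mem_mul hv (T.mul_mem hw c.2)
    | mem p hp =>
      rw [← mul_one (QField.poly q p)]
      exact Submodule.mul_mem_mul
        (Submodule.subset_span (Set.mem_insert_of_mem _ ⟨p, hp, rfl⟩)) T.one_mem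
  have hpolyT : (QField.poly q).range.toSubmodule * T.toSubmodule ≤ Q * T.toSubmodule := by
    refine (mul_le_mul_left hpoly _).trans ?_
    rw [mul_assoc, T.isIdempotentElem_toSubmodule.eq]
  refine ⟨Q, Module.Finite.span_of_finite K ((s.finite_toSet.image _).insert _),
    Submodule.subset_span (Set.mem_insert _ _), hQpoly, fun i w hw => ?_, fun i w hw => ?_⟩
  · obtain ⟨p, rfl⟩ := hQpoly hw
    refine hpoly ⟨MvPolynomial.X i * p, ?_⟩
    simp [QField.poly_X]
  · obtain ⟨p, rfl⟩ := hQpoly hw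
    obtain ⟨p', hp'⟩ := QField.y_mul_poly (q := q) i p
    change QField.y q i * QField.poly q p ∈ _
    rw [hp']
    apply hpolyT
    have := Submodule.mul_mem_mul (show QField.poly q p' ∈ (QField.poly q).range.toSubmodule
      from ⟨p', rfl⟩) (hy i)
    rwa [← mul_assoc, (QField.poly q).range.isIdempotentElem_toSubmodule.eq] at this

end QRelations
end Package

/-! ### Spanning over the image of a skew field, and averaging -/

noncomputable section Generation

variable {K : Type*} [Field K] {n : ℕ} {q q' : Fin n → Kˣ}

/-- If left multiplication by the generators preserves `Q D`, where `Q` is finite-dimensional and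
`D` is the image of a skew field, then `Q D` is the whole skew field: left multiplication by a nonzero
element preserving `Q D` is injective, hence bijective, on this finite-dimensional right `D`-space. -/
theorem mem_mul_range_of_mul_mem (φ : QField q' →ₐ[K] QField q) (Q : Submodule K (QField q))
    [Module.Finite K Q] (h1 : 1 ∈ Q)
    (hx : ∀ i, ∀ w ∈ Q, QField.x q i * w ∈ Q * φ.range.toSubmodule)
    (hy : ∀ i, ∀ w ∈ Q, QField.y q i * w ∈ Q * φ.range.toSubmodule) (w : QField q) :
    w ∈ Q * φ.range.toSubmodule := by
  -- `F_{q̄,n}` is regarded as a right vector space over the skew field `F_{q̄',n}`.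
  let : Module (QField q')ᵐᵒᵖ (QField q) := Module.compHom _ φ.toRingHom.op
  have hsmul : ∀ (d : QField q') (w : QField q), MulOpposite.op d • w = w * φ d := fun d w => rfl
  obtain ⟨s, hs⟩ := Module.Finite.iff_fg.1 (inferInstance : Module.Finite K Q)
  let M : Submodule (QField q')ᵐᵒᵖ (QField q) := Submodule.span _ s
  have hfin : Module.Finite (QField q')ᵐᵒᵖ M := Module.Finite.span_of_finite _ s.finite_toSet
  have hMsmul : ∀ (c : K), ∀ w ∈ M, c • w ∈ M := by
    intro c w hw
    have := M.smul_mem (MulOpposite.op (algebraMap K _ c)) hw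
    rwa [hsmul, AlgHom.commutes, ← Algebra.commutes, ← Algebra.smul_def] at this
  have hQM : ∀ w ∈ Q, w ∈ M := by
    intro w hw
    rw [← hs] at hw
    induction hw using Submodule.span_induction with
    | zero => exact zero_mem _
    | add v v' _ _ h h' => exact add_mem h h'
    | smul c v _ h => exact hMsmul c v h
    | mem v hv => exact Submodule.subset_span hv
  have hM : ∀ w, w ∈ M ↔ w ∈ Q * φ.range.toSubmodule := by
    intro w
    constructor
    · intro hw
      induction hw using Submodule.span_induction with
      | zero => exact zero_mem _
      | add v v' _ _ h h' => exact add_mem h h'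
      | smul d v hv h =>
        clear hv
        induction h using Submodule.mul_induction_on' with
        | add a _ b _ ha hb => rw [smul_add]; exact add_mem ha hb
        | mem_mul_mem v hv w hw =>
          rw [← MulOpposite.op_unop d, hsmul, mul_assoc]
          exact Submodule.mul_mem_mul hv (φ.range.mul_mem hw ⟨_, rfl⟩)
      | mem v hv =>
        rw [← mul_one v]
        exact Submodule.mul_mem_mul (hs ▸ Submodule.subset_span hv) φ.range.one_mem
    · intro hw
      induction hw using Submodule.mul_induction_on' with
      | add a _ b _ ha hb => exact add_mem ha hb
      | mem_mul_mem v hv w hw =>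
        obtain ⟨d, rfl⟩ := hw
        exact M.smul_mem (MulOpposite.op d) (hQM v hv)
  -- The elements `a` with `a M ⊆ M` form a subalgebra, closed under inverses as `M` has finite dimension.
  let S : Subalgebra K (QField q) :=
    { carrier := {w | ∀ m ∈ M, w * m ∈ M}
      mul_mem' := fun {a b} ha hb m hm => by rw [mul_assoc]; exact ha _ (hb m hm)
      add_mem' := fun {a b} ha hb m hm => by rw [add_mul]; exact add_mem (ha m hm) (hb m hm)
      algebraMap_mem' := fun c m hm => by rw [← Algebra.smul_def]; exact hMsmul c m hm }
  have hinv : ∀ a ∈ S, a⁻¹ ∈ S := by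
    intro a ha m hm
    obtain rfl | h0 := eq_or_ne a 0
    · simp
    let f : M →ₗ[(QField q')ᵐᵒᵖ] M :=
      { toFun := fun m => ⟨a * m, ha m m.2⟩
        map_add' := fun m m' => Subtype.ext (mul_add a (m : QField q) m')
        map_smul' := fun d m => Subtype.ext (mul_assoc a (m : QField q) (φ d.unop)).symm }
    have hf : Function.Injective f := fun m m' hm =>
      Subtype.ext (mul_left_cancel₀ h0 (congrArg Subtype.val hm))
    obtain ⟨m', hm'⟩ := LinearMap.injective_iff_surjective.1 hf ⟨m, hm⟩
    have : a * m' = m := congrArg Subtype.val hm'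
    rw [← this, inv_mul_cancel_left₀ h0]
    exact m'.2
  have hgen : ∀ g : QField q, (∀ w ∈ Q, g * w ∈ Q * φ.range.toSubmodule) → g ∈ S := by
    intro g hg m hm
    rw [hM] at hm
    induction hm using Submodule.mul_induction_on' with
    | add a _ b _ ha hb => rw [mul_add]; exact add_mem ha hb
    | mem_mul_mem v hv w hw =>
      obtain ⟨d, rfl⟩ := hw
      rw [← mul_assoc]
      exact M.smul_mem (MulOpposite.op d) ((hM _).2 (hg v hv))
  have := QField.mem_of_gen_mem (φ := AlgHom.id K (QField q)) hinv (fun i => hgen _ (hx i))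
    (fun i => hgen _ (hy i)) w 1 (hQM 1 h1)
  rw [AlgHom.id_apply, mul_one] at this
  exact (hM _).1 this

/-- Elements `a_i`, `b_i` satisfying the relations of the generators of `F_{q̄',n}` define an
embedding `F_{q̄',n} → F_{q̄,n}` such that `F_{q̄,n}` is spanned over its image by polynomials in the
`x_i`, provided that the `x_i` are integral over polynomials in the Laurent algebra `T` of `a_i`,
`b_i`, and that the `y_i` lie in `K[x] T`. -/
theorem QRelations.exists_algHom (hn : 0 < n) {a b : Fin n → QField q} (h : QRelations q' a b)
    (hint : ∀ i, IsIntegral ((QRelations.laurent a b).comap (QField.poly q))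
      (MvPolynomial.X i : MvPolynomial (Fin n) K))
    (hy : ∀ i, QField.y q i ∈
      (QField.poly q).range.toSubmodule * (QRelations.laurent a b).toSubmodule) :
    ∃ φ : QField q' →ₐ[K] QField q, (∀ i, φ (QField.x q' i) = a i) ∧
      (∀ i, φ (QField.y q' i) = b i) ∧
      ∀ w, w ∈ (QField.poly q).range.toSubmodule * φ.range.toSubmodule := by
  obtain ⟨Q, hQ, h1, hQpoly, hxQ, hyQ⟩ := exists_finite_generators _ hint hy
  have hli := linearIndependent_qMonomial_of_mul_mem hn
    (by simp [two_mul]) h.qCommute Q h1 hxQ hyQ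
  set φ := SkewFrac.lift _ (h.lift_injective hli) with hφ
  have hφx : ∀ i, φ (QField.x q' i) = a i := fun i => by simp [hφ, QField.x]
  have hφy : ∀ i, φ (QField.y q' i) = b i := fun i => by simp [hφ, QField.y]
  have hT : QRelations.laurent a b ≤ φ.range := by
    rw [QRelations.laurent, laurentAlgebra, Algebra.adjoin_le_iff]
    rintro _ (⟨i | i, rfl⟩ | ⟨i | i, rfl⟩)
    · exact ⟨_, hφx i⟩
    · exact ⟨_, hφy i⟩
    · exact ⟨(QField.x q' i)⁻¹, (map_inv₀ φ _).trans (congrArg _ (hφx i))⟩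
    · exact ⟨(QField.y q' i)⁻¹, (map_inv₀ φ _).trans (congrArg _ (hφy i))⟩
  have hle : ∀ P : Submodule K (QField q), P * (QRelations.laurent a b).toSubmodule ≤
      P * φ.range.toSubmodule := fun P =>
    mul_le_mul_right (show (QRelations.laurent a b).toSubmodule ≤ φ.range.toSubmodule from hT) P
  refine ⟨φ, hφx, hφy, fun w => mul_le_mul_left hQpoly _ ?_⟩
  exact mem_mul_range_of_mul_mem φ Q h1 (fun i w hw => hle _ (hxQ i w hw))
    (fun i w hw => hle _ (hyQ i w hw)) w

/-- Averaging over a finite group of automorphisms: if `D` is fixed, the sums over the orbits of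
polynomials lie in `D`, and `K[x] D` is everything, then `D` is the algebra of invariants. -/
theorem mem_of_forall_fixed [CharZero K] {G : Type*} [Fintype G] [Nonempty G]
    (ρ : G → QField q →ₐ[K] QField q) (D : Subalgebra K (QField q))
    (hD : ∀ g, ∀ d ∈ D, ρ g d = d) (hpoly : ∀ p, ∑ g, ρ g (QField.poly q p) ∈ D)
    (hall : ∀ w, w ∈ (QField.poly q).range.toSubmodule * D.toSubmodule)
    {w : QField q} (hw : ∀ g, ρ g w = w) : w ∈ D := by
  have key : ∀ w ∈ (QField.poly q).range.toSubmodule * D.toSubmodule, ∑ g, ρ g w ∈ D := by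
    intro w hw
    induction hw using Submodule.mul_induction_on' with
    | add a _ b _ ha hb =>
      simp only [map_add, Finset.sum_add_distrib]
      exact add_mem ha hb
    | mem_mul_mem v hv d hd =>
      obtain ⟨p, rfl⟩ := hv
      simp only [map_mul, hD _ d hd, ← Finset.sum_mul]
      exact D.mul_mem (hpoly p) hd
  have h1 := key w (hall w)
  simp only [hw, Finset.sum_const, Finset.card_univ, ← Nat.cast_smul_eq_nsmul K] at h1
  have h2 := D.smul_mem h1 ((Fintype.card G : K)⁻¹)
  rwa [smul_smul, inv_mul_cancel₀ (by simp), one_smul] at h2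

end Generation

/-! ### Interpolation and the first two polynomials -/

noncomputable section SymmetricPolynomials

open Polynomial

variable {K : Type*} [Field K] {n : ℕ}

/-- The polynomial `∏_k (u - x_k)`. -/
def rootPoly (K : Type*) [Field K] (n : ℕ) : (MvPolynomial (Fin n) K)[X] :=
  ∏ k, (X - C (MvPolynomial.X k))

/-- The polynomial `∏_{k ≠ j} (u - x_k)`. -/
def omitPoly (K : Type*) [Field K] {n : ℕ} (j : Fin n) : (MvPolynomial (Fin n) K)[X] :=
  ∏ k ∈ Finset.univ.erase j, (X - C (MvPolynomial.X k))

theorem X_sub_C_mul_omitPoly (j : Fin n) :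
    (X - C (MvPolynomial.X j)) * omitPoly K j = rootPoly K n := by
  rw [omitPoly, rootPoly, ← Finset.mul_prod_erase Finset.univ _ (Finset.mem_univ j)]

theorem prod_X_sub_C_coeff {R σ : Type*} [CommRing R] (s : Finset σ) (r : σ → R) {k : ℕ}
    (h : k ≤ s.card) : (∏ i ∈ s, (X - C (r i))).coeff k =
      (-1) ^ (s.card - k) * ∑ t ∈ s.powersetCard (s.card - k), ∏ i ∈ t, r i := by
  have := Finset.prod_X_add_C_coeff s (fun i => - r i) h
  simp only [map_neg, ← sub_eq_add_neg] at this
  rw [this, Finset.mul_sum]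
  refine Finset.sum_congr rfl fun t ht => ?_
  rw [Finset.prod_neg, (Finset.mem_powersetCard.1 ht).2]

theorem rootPoly_coeff {k : ℕ} (h : k ≤ n) :
    (rootPoly K n).coeff k = (-1) ^ (n - k) * MvPolynomial.esymm (Fin n) K (n - k) := by
  rw [rootPoly, prod_X_sub_C_coeff _ _ (by simpa using h)]
  simp [MvPolynomial.esymm]

theorem omitPoly_coeff (j : Fin n) {k : ℕ} (h : k < n) :
    (omitPoly K j).coeff k = (-1) ^ (n - (k + 1)) * QField.esymmOmit K (n - (k + 1)) j := by
  rw [omitPoly, prod_X_sub_C_coeff _ _ (by simp; omega)]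
  rw [QField.esymmOmit, Finset.card_erase_of_mem (Finset.mem_univ j), Finset.card_fin,
    show n - 1 - k = n - (k + 1) by omega]

theorem natDegree_rootPoly : (rootPoly K n).natDegree = n := by
  rw [rootPoly, natDegree_finsetProd_X_sub_C_eq_card]; simp

theorem natDegree_omitPoly (j : Fin n) : (omitPoly K j).natDegree = n - 1 := by
  rw [omitPoly, natDegree_finsetProd_X_sub_C_eq_card]; simp

theorem monic_rootPoly : (rootPoly K n).Monic := monic_prod_of_monic _ _ fun _ _ => monic_X_sub_C _

theorem eval_rootPoly (j : Fin n) : (rootPoly K n).eval (MvPolynomial.X j) = 0 := by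
  rw [← X_sub_C_mul_omitPoly j]; simp

theorem eval_omitPoly_self (j : Fin n) : (omitPoly K j).eval (MvPolynomial.X j) =
    ∏ k ∈ Finset.univ.erase j, (MvPolynomial.X j - MvPolynomial.X k) := by
  simp [omitPoly, eval_prod]

theorem eval_omitPoly_of_ne {j k : Fin n} (h : j ≠ k) :
    (omitPoly K k).eval (MvPolynomial.X j) = 0 := by
  rw [omitPoly, eval_prod, Finset.prod_eq_zero (Finset.mem_erase.2 ⟨h, Finset.mem_univ j⟩)]
  simp

theorem prod_X_sub_X_ne_zero (j : Fin n) :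
    ∏ k ∈ Finset.univ.erase j, (MvPolynomial.X j - MvPolynomial.X k : MvPolynomial (Fin n) K) ≠ 0 := by
  refine Finset.prod_ne_zero_iff.2 fun k hk => ?_
  rw [sub_ne_zero, (MvPolynomial.X_injective).ne_iff]
  exact (Finset.ne_of_mem_erase hk).symm

end SymmetricPolynomials

noncomputable section BasePair

open Polynomial

namespace QField

variable {K : Type*} [Field K] {n : ℕ} (q : Fin n → Kˣ)

theorem poly_injective : Function.Injective (poly q) := by
  rw [injective_iff_map_eq_zero]
  intro f hf
  rw [poly, AlgHom.comp_apply, map_eq_zero_iff _ (SkewFrac.of_injective K)] at hf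
  have key : (QAffine.rep q).comp (QAffine.px q) =
      (Algebra.lmul K _).comp (MvPolynomial.rename Sum.inl) := by
    refine MvPolynomial.algHom_ext fun i => ?_
    ext g
    simp [QAffine.px, QAffine.rep]
  have := LinearMap.congr_fun (DFunLike.congr_fun key f) 1
  rw [AlgHom.comp_apply, hf, map_zero, LinearMap.zero_apply] at this
  replace this : 0 = MvPolynomial.rename Sum.inl f := this.trans (mul_one _)
  exact MvPolynomial.rename_injective _ Sum.inl_injective (this.symm.trans (map_zero _).symm)

/-- The denominator `∏_{k ≠ j} (x_j - x_k)`. -/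
def denom (j : Fin n) : QField q :=
  poly q (∏ k ∈ Finset.univ.erase j, (MvPolynomial.X j - MvPolynomial.X k))

theorem denom_ne_zero (j : Fin n) : denom q j ≠ 0 := by
  rw [denom, Ne, map_eq_zero_iff _ (poly_injective q)]
  exact prod_X_sub_X_ne_zero j

/-- `t_{i+1}` is the coefficient at `u^i` of the interpolation polynomial. -/
theorem t_succ {i : ℕ} (hi : i < n) : t q (i + 1) =
    ∑ j, poly q ((omitPoly K j).coeff i) * ((denom q j)⁻¹ * y q j) := by
  rw [t]
  refine Finset.sum_congr rfl fun j _ => ?_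
  rw [omitPoly_coeff j hi, mul_assoc, denom]

theorem poly_mul_poly (f g : MvPolynomial (Fin n) K) :
    poly q f * poly q g = poly q g * poly q f := by
  rw [← map_mul, mul_comm, map_mul]

theorem poly_mul_inv_denom (f : MvPolynomial (Fin n) K) (j : Fin n) :
    poly q f * (denom q j)⁻¹ = (denom q j)⁻¹ * poly q f :=
  (show Commute _ _ from poly_mul_poly q _ _).inv_right₀.eq

/-- The interpolation formula for `T(u) = ∑ t_{i+1} u^i`: the value of `T` at `x_j`, with the
powers of `x_j` on the left, is `y_j`. -/
theorem y_eq_sum (j : Fin n) : y q j = ∑ i : Fin n, x q j ^ (i : ℕ) * t q (i + 1) := by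
  have h1 : ∀ k, ∑ i : Fin n, x q j ^ (i : ℕ) * poly q ((omitPoly K k).coeff i) =
      poly q ((omitPoly K k).eval (MvPolynomial.X j)) := by
    intro k
    rw [eval_eq_sum_range' (n := n) (by rw [natDegree_omitPoly]; have := j.2; omega),
      Finset.sum_range, map_sum]
    refine Finset.sum_congr rfl fun i _ => ?_
    rw [map_mul, map_pow, poly_X, ← poly_X, ← map_pow, poly_mul_poly]
  simp only [t_succ q (Fin.is_lt _), Finset.mul_sum]
  rw [Finset.sum_comm]
  simp only [← mul_assoc (x q j ^ _), ← Finset.sum_mul, h1]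
  rw [Finset.sum_eq_single j]
  · rw [eval_omitPoly_self, ← denom, mul_inv_cancel_left₀ (denom_ne_zero q j)]
  · intro k _ hk
    rw [eval_omitPoly_of_ne hk.symm, map_zero, zero_mul]
  · simp

/-- A polynomial of degree less than `n`, with coefficients on the right of the powers of the variable,
is zero if its values at the `x_j` are: the Vandermonde matrix has a nonzero determinant. -/
theorem eq_zero_of_vandermonde {s : Fin n → QField q}
    (h : ∀ j, ∑ i : Fin n, x q j ^ (i : ℕ) * s i = 0) : s = 0 := by
  set V := Matrix.vandermonde (fun j : Fin n => (MvPolynomial.X j : MvPolynomial (Fin n) K)) with hV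
  have hdet : V.det ≠ 0 := Matrix.det_vandermonde_ne_zero_iff.2 MvPolynomial.X_injective
  funext k
  have h1 : ∑ j, poly q (V.adjugate k j) * ∑ i : Fin n, x q j ^ (i : ℕ) * s i = poly q V.det * s k := by
    simp only [Finset.mul_sum]
    rw [Finset.sum_comm]
    have h2 : ∀ i : Fin n, ∑ j, poly q (V.adjugate k j) * x q j ^ (i : ℕ) =
        poly q ((V.adjugate * V) k i) := by
      intro i
      simp [Matrix.mul_apply, hV, Matrix.vandermonde_apply, poly_X]
    simp only [← mul_assoc, ← Finset.sum_mul, h2, Matrix.adjugate_mul]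
    rw [Finset.sum_eq_single k]
    · simp
    · intro i _ hi
      simp [Matrix.one_apply_ne hi.symm]
    · simp
  simp only [h, mul_zero, Finset.sum_const_zero] at h1
  refine (mul_eq_zero.1 h1.symm).resolve_left ?_
  rwa [map_eq_zero_iff _ (poly_injective q)]

/-- The `t_i` commute: the products `t_i t_j` and `t_j t_i` have the same double interpolation, because
`y_j y_k = y_k y_j` and, for `j ≠ k`, `y_j` commutes with `x_k`. -/
theorem t_mul_t {i j : ℕ} (hi : i < n) (hj : j < n) :
    t q (i + 1) * t q (j + 1) = t q (j + 1) * t q (i + 1) := by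
  suffices h : ∀ i l : Fin n, t q (i + 1) * t q (l + 1) - t q (l + 1) * t q (i + 1) = 0 from
    sub_eq_zero.1 (h ⟨i, hi⟩ ⟨j, hj⟩)
  intro i l
  have hxx : ∀ j k (a b : ℕ), x q j ^ a * x q k ^ b = x q k ^ b * x q j ^ a := fun j k a b =>
    (show Commute _ _ from x_mul_x j k).pow_pow a b
  have hyx : ∀ j k, j ≠ k → ∀ a : ℕ, y q j * x q k ^ a = x q k ^ a * y q j := fun j k hjk a =>
    (show Commute _ _ by
      have := y_mul_x (q := q) j k
      rwa [if_neg hjk, one_smul] at this).pow_right a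
  have hyy : ∀ j k, j ≠ k → y q j * y q k =
      ∑ l : Fin n, ∑ i : Fin n, x q k ^ (l : ℕ) * (x q j ^ (i : ℕ) * (t q (i + 1) * t q (l + 1))) := by
    intro j k hjk
    conv_lhs => rw [y_eq_sum q k, Finset.mul_sum]
    refine Finset.sum_congr rfl fun l _ => ?_
    rw [← mul_assoc, hyx j k hjk, y_eq_sum q j]
    simp only [Finset.sum_mul, Finset.mul_sum, mul_assoc]
  have key : ∀ j k, ∑ i : Fin n, x q j ^ (i : ℕ) *
      (∑ l : Fin n, x q k ^ (l : ℕ) * (t q (i + 1) * t q (l + 1) - t q (l + 1) * t q (i + 1))) = 0 := by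
    intro j k
    have h1 : ∀ i l : Fin n, x q j ^ (i : ℕ) * (x q k ^ (l : ℕ) * (t q (i + 1) * t q (l + 1))) =
      x q k ^ (l : ℕ) * (x q j ^ (i : ℕ) * (t q (i + 1) * t q (l + 1))) := fun i l => by
      rw [← mul_assoc, hxx, mul_assoc]
    simp only [mul_sub, Finset.sum_sub_distrib, Finset.mul_sum]
    rw [sub_eq_zero]
    obtain rfl | hjk := eq_or_ne j k
    · rw [Finset.sum_comm]
      refine Finset.sum_congr rfl fun i _ => Finset.sum_congr rfl fun l _ => ?_
      rw [← mul_assoc, hxx, mul_assoc]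
    · have h2 := hyy j k hjk
      have h3 := hyy k j hjk.symm
      rw [y_mul_y] at h2
      rw [Finset.sum_comm]
      simp only [h1]
      rw [← h2, h3]
  have h1 := fun k => congrFun (eq_zero_of_vandermonde q fun j => key j k) i
  exact congrFun (eq_zero_of_vandermonde q h1) l

end QField

namespace QField

variable {K : Type*} [Field K] {n : ℕ} (q : Kˣ)

/-- The polynomial `P_0(u) = ∏_k (u - x_k)` with coefficients in the skew field. -/
def basePoly (q : Kˣ) : (QField fun _ : Fin n => q)[X] :=
  (rootPoly K n).map (poly fun _ : Fin n => q).toRingHom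

/-- The polynomial `P_1(u) = ∑ t_{i+1} u^i`. -/
def interpPoly (q : Kˣ) : (QField fun _ : Fin n => q)[X] :=
  ∑ j, (omitPoly K j).map (poly fun _ : Fin n => q).toRingHom *
    C ((denom (fun _ : Fin n => q) j)⁻¹ * y (fun _ : Fin n => q) j)

theorem basePoly_coeff (i : ℕ) :
    (basePoly q).coeff i = poly (fun _ : Fin n => q) ((rootPoly K n).coeff i) := by
  simp [basePoly]

theorem interpPoly_coeff_eq_sum (i : ℕ) : (interpPoly q).coeff i =
    ∑ j, poly (fun _ : Fin n => q) ((omitPoly K j).coeff i) *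
      ((denom (fun _ : Fin n => q) j)⁻¹ * y (fun _ : Fin n => q) j) := by
  simp only [interpPoly, finsetSum_coeff, coeff_mul_C, coeff_map]
  rfl

theorem interpPoly_coeff {i : ℕ} (hi : i < n) :
    (interpPoly q).coeff i = t (fun _ : Fin n => q) (i + 1) := by
  rw [interpPoly_coeff_eq_sum, t_succ _ hi]

theorem interpPoly_coeff_of_le {i : ℕ} (hn : 0 < n) (hi : n ≤ i) :
    (interpPoly q : (QField fun _ : Fin n => q)[X]).coeff i = 0 := by
  rw [interpPoly_coeff_eq_sum]
  refine Finset.sum_eq_zero fun j _ => ?_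
  rw [coeff_eq_zero_of_natDegree_lt (by rw [natDegree_omitPoly]; omega), map_zero, zero_mul]

/-- Moving a polynomial past `y_j` is not affected by the denominator, which commutes with it. -/
theorem inv_denom_mul_y_mul_poly (q : Fin n → Kˣ) (j : Fin n) {f g : MvPolynomial (Fin n) K}
    (h : y q j * poly q f = poly q g * y q j) :
    (denom q j)⁻¹ * y q j * poly q f = poly q g * ((denom q j)⁻¹ * y q j) := by
  rw [mul_assoc, h, ← mul_assoc, ← poly_mul_inv_denom, mul_assoc]

/-- `y_j` moves past `P_0(u)` replacing the factor `u - x_j` by `u - q x_j`. -/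
theorem C_mul_basePoly (j : Fin n) :
    C ((denom (fun _ : Fin n => q) j)⁻¹ * y (fun _ : Fin n => q) j) * basePoly q =
      ((omitPoly K j) * (X - C (MvPolynomial.C (q : K) * MvPolynomial.X j))).map
        (poly fun _ : Fin n => q).toRingHom *
          C ((denom (fun _ : Fin n => q) j)⁻¹ * y (fun _ : Fin n => q) j) := by
  set w := (denom (fun _ : Fin n => q) j)⁻¹ * y (fun _ : Fin n => q) j with hw
  have hk : ∀ k, k ≠ j → Commute w (poly (fun _ : Fin n => q) (MvPolynomial.X k)) := by
    intro k hk
    refine inv_denom_mul_y_mul_poly _ _ ?_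
    have := y_mul_x (q := fun _ : Fin n => q) j k
    rwa [if_neg hk.symm, one_smul, ← poly_X] at this
  have hj : w * (poly fun _ : Fin n => q).toRingHom (MvPolynomial.X j) =
      (poly fun _ : Fin n => q).toRingHom (MvPolynomial.C (q : K) * MvPolynomial.X j) * w := by
    refine inv_denom_mul_y_mul_poly _ _ ?_
    have := y_mul_x (q := fun _ : Fin n => q) j j
    rwa [if_pos rfl, ← poly_X, ← smul_mul_assoc, ← map_smul, MvPolynomial.smul_eq_C_mul] at this
  have hX : C w * (X : (QField fun _ : Fin n => q)[X]) = X * C w := (commute_X _).symm.eq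
  have homit : Commute (C w) ((omitPoly K j).map (poly fun _ : Fin n => q).toRingHom) := by
    refine Finset.prod_induction _
      (fun f : (MvPolynomial (Fin n) K)[X] => Commute (C w) (f.map (poly fun _ : Fin n => q).toRingHom))
      (fun f g hf hg => ?_) ?_ fun k hk' => ?_
    · rw [Polynomial.map_mul]; exact hf.mul_right hg
    · rw [Polynomial.map_one]; exact .one_right _
    · rw [Polynomial.map_sub, map_X, map_C]
      exact Commute.sub_right hX ((hk k (Finset.ne_of_mem_erase hk')).map C)
  rw [basePoly, ← X_sub_C_mul_omitPoly j, mul_comm (X - _)]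
  simp only [Polynomial.map_mul, Polynomial.map_sub, map_X, map_C]
  rw [← mul_assoc, homit.eq, mul_assoc, mul_assoc, mul_sub, sub_mul, hX, ← C_mul, ← C_mul, hj]

attribute [local instance] Polynomial.algebra in
open ExchangePair in
/-- The polynomials `P_0` and `P_1` satisfy the exchange relations with parameter `1`. -/
theorem exchangePair_basePoly {m : ℕ} (hm : m + 1 = n) :
    ExchangePair (q : K) 1 m (basePoly q : (QField fun _ : Fin n => q)[X]) (interpPoly q) := by
  refine of_identity (c := 1) (one_mul 1) (fun i hi => ?_) (fun i hi => ?_) (fun i j => ?_)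
    (fun i j => ?_) ?_
  · rw [basePoly_coeff, coeff_eq_zero_of_natDegree_lt (by rw [natDegree_rootPoly]; omega), map_zero]
  · exact interpPoly_coeff_of_le q (by omega) (by omega)
  · simp only [basePoly_coeff, poly_mul_poly]
  · obtain hi | hi := lt_or_ge i n
    · obtain hj | hj := lt_or_ge j n
      · rw [interpPoly_coeff q hi, interpPoly_coeff q hj, t_mul_t _ hi hj]
      · rw [interpPoly_coeff_of_le q (by omega) hj]; simp
    · rw [interpPoly_coeff_of_le q (by omega) hi]; simp
  -- Each `w_j = d_j⁻¹ y_j` is moved to the right of `P_0(u)`; the coefficients of `w_j` on both sides are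
  -- then polynomials in commuting variables, and are compared by `ring`.
  · let Φ : (MvPolynomial (Fin n) K)[X][X] →+* (QField fun _ : Fin n => q)[X][X] :=
      mapRingHom (mapRingHom (poly fun _ : Fin n => q).toRingHom)
    have hΦC : ∀ f, Φ (C f) = C (f.map (poly fun _ : Fin n => q).toRingHom) := fun f => by
      simp [Φ]
    have hΦm : ∀ f : (MvPolynomial (Fin n) K)[X], Φ (f.map C) =
        (f.map (poly fun _ : Fin n => q).toRingHom).map C := fun f => by
      simp only [Φ, coe_mapRingHom, Polynomial.map_map]
      congr 1
      exact RingHom.ext fun x => by simp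
    have hΦs : ∀ c : K, (C (C (algebraMap K (QField fun _ : Fin n => q) c)) :
        (QField fun _ : Fin n => q)[X][X]) = Φ (C (C (MvPolynomial.C c))) := fun c => by
      rw [hΦC, map_C]
      congr 2
      exact ((poly fun _ : Fin n => q).commutes c).symm
    have hΦX : (X : (QField fun _ : Fin n => q)[X][X]) = Φ X := by simp [Φ]
    have hΦCX : (C X : (QField fun _ : Fin n => q)[X][X]) = Φ (C X) := by simp [Φ]
    have hBm : (interpPoly q : (QField fun _ : Fin n => q)[X]).map C = ∑ j, Φ ((omitPoly K j).map C) *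
        C (C ((denom (fun _ : Fin n => q) j)⁻¹ * y (fun _ : Fin n => q) j)) := by
      simp only [interpPoly, Polynomial.map_sum, Polynomial.map_mul, map_C, hΦm]
    have hB : (C (interpPoly q) : (QField fun _ : Fin n => q)[X][X]) = ∑ j, Φ (C (omitPoly K j)) *
        C (C ((denom (fun _ : Fin n => q) j)⁻¹ * y (fun _ : Fin n => q) j)) := by
      simp only [interpPoly, map_sum, C_mul, hΦC]
    have hA : (C (basePoly q) : (QField fun _ : Fin n => q)[X][X]) = Φ (C (rootPoly K n)) := by
      rw [hΦC, basePoly]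
    have hAm : (basePoly q : (QField fun _ : Fin n => q)[X]).map C = Φ ((rootPoly K n).map C) := by
      rw [hΦm, basePoly]
    have hBA : (interpPoly q : (QField fun _ : Fin n => q)[X]).map C * C (basePoly q) =
        ∑ j, Φ ((omitPoly K j).map C *
          C (omitPoly K j * (X - C (MvPolynomial.C (q : K) * MvPolynomial.X j)))) *
        C (C ((denom (fun _ : Fin n => q) j)⁻¹ * y (fun _ : Fin n => q) j)) := by
      rw [hBm, Finset.sum_mul]
      refine Finset.sum_congr rfl fun j _ => ?_
      rw [mul_assoc, ← C_mul, C_mul_basePoly, C_mul, ← mul_assoc, ← hΦC, ← map_mul]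
    rw [hBA, hBm, hB, hA, hAm, show (1 : K[X][X]) = C (C 1) by simp]
    simp only [polyScalar_sub, polyScalar_mul, polyScalar_CC, polyScalar_CX, polyScalar_X, hΦs,
      hΦX, hΦCX, Finset.mul_sum, ← Finset.sum_sub_distrib]
    refine Finset.sum_congr rfl fun j _ => ?_
    simp only [← mul_assoc, ← map_mul, ← sub_mul, ← map_sub]
    congr 2
    rw [← X_sub_C_mul_omitPoly j]
    simp only [Polynomial.map_mul, Polynomial.map_sub, map_X, map_C, C_mul, C_sub, map_one]
    ring

end QField
end BasePair

/-! ### The Euclidean sequence -/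

section SkewCommutation

variable {K F : Type*} [Field K]

/-- `a b = ζ b a` for a nonzero scalar `ζ`. -/
def SkewComm [Ring F] [Algebra K F] (ζ : Kˣ) (a b : F) : Prop := a * b = (ζ : K) • (b * a)

namespace SkewComm

section Ring

variable [Ring F] [Algebra K F] {ζ ζ' : Kˣ} {a b b' : F}

theorem qCommute (h : SkewComm ζ a b) : QCommute K a b := ⟨ζ, h⟩

theorem one_iff : SkewComm (1 : Kˣ) a b ↔ a * b = b * a := by simp [SkewComm]

theorem symm (h : SkewComm ζ a b) : SkewComm ζ⁻¹ b a := by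
  rw [SkewComm, h, smul_smul]; simp

theorem zero_right (ζ : Kˣ) (a : F) : SkewComm ζ a 0 := by simp [SkewComm]

theorem one_right (a : F) : SkewComm (1 : Kˣ) a 1 := by simp [SkewComm]

theorem add_right (h : SkewComm ζ a b) (h' : SkewComm ζ a b') : SkewComm ζ a (b + b') := by
  rw [SkewComm, mul_add, h, h', ← smul_add, add_mul]

theorem sub_right (h : SkewComm ζ a b) (h' : SkewComm ζ a b') : SkewComm ζ a (b - b') := by
  rw [SkewComm, mul_sub, h, h', ← smul_sub, sub_mul]

theorem mul_right (h : SkewComm ζ a b) (h' : SkewComm ζ' a b') : SkewComm (ζ * ζ') a (b * b') := by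
  rw [SkewComm, ← mul_assoc, h, smul_mul_assoc, mul_assoc, h', mul_smul_comm, smul_smul, mul_assoc,
    Units.val_mul]

theorem mul_left {a' : F} (h : SkewComm ζ a b) (h' : SkewComm ζ' a' b) :
    SkewComm (ζ * ζ') (a * a') b := by
  simpa [mul_comm] using (h.symm.mul_right h'.symm).symm

theorem pow_right (h : SkewComm ζ a b) (k : ℕ) : SkewComm (ζ ^ k) a (b ^ k) := by
  induction k with
  | zero => simpa using one_right (K := K) a
  | succ k ih => rw [pow_succ, pow_succ]; exact ih.mul_right h

theorem smul_right (h : SkewComm ζ a b) (c : K) : SkewComm ζ a (c • b) := by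
  rw [SkewComm, mul_smul_comm, h, smul_comm, smul_mul_assoc]

theorem of_upToUnit_right (h : SkewComm ζ a b) (hb : UpToUnit K b' b) : SkewComm ζ a b' := by
  obtain ⟨c, rfl⟩ := hb
  exact h.smul_right _

theorem of_upToUnit_left {a' : F} (h : SkewComm ζ a b) (ha : UpToUnit K a' a) :
    SkewComm ζ a' b := by
  simpa using (h.symm.of_upToUnit_right ha).symm

end Ring

variable [DivisionRing F] [Algebra K F] {ζ ζ' : Kˣ} {a b : F}

theorem inv_right (h : SkewComm ζ a b) : SkewComm ζ⁻¹ a b⁻¹ := by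
  obtain rfl | hb := eq_or_ne b 0
  · simpa using zero_right _ a
  apply mul_left_cancel₀ hb
  rw [mul_smul_comm, mul_inv_cancel_left₀ hb, ← mul_assoc, h.symm, smul_mul_assoc,
    mul_inv_cancel_right₀ hb]

theorem zpow_right (h : SkewComm ζ a b) (k : ℤ) : SkewComm (ζ ^ k) a (b ^ k) := by
  cases k with
  | ofNat k => simpa using h.pow_right k
  | negSucc k => rw [zpow_negSucc, zpow_negSucc]; exact (h.pow_right _).inv_right

theorem zpow_left (h : SkewComm ζ a b) (k : ℤ) : SkewComm (ζ ^ k) (a ^ k) b := by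
  simpa using (h.symm.zpow_right k).symm

end SkewComm
end SkewCommutation

noncomputable section Chain

open Polynomial

namespace QField

variable {K : Type*} [Field K] {n : ℕ} (q : Kˣ)

/-- The Euclidean sequence `P_0, P_1, P_2, …` that starts with `P_0(u) = ∏_k (u - x_k)` and
`P_1(u) = ∑ t_{i+1} u^i`; the polynomial `P_i` has degree at most `n - i`. -/
def chain (q : Kˣ) : ℕ → (QField fun _ : Fin n => q)[X]
  | 0 => basePoly q
  | 1 => interpPoly q
  | i + 2 => ExchangePair.step (n - (i + 1)) (chain q i) (chain q (i + 1))

/-- The parameter of the exchange relations between `P_i` and `P_{i+1}`. -/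
def chainParam (q : Kˣ) (i : ℕ) : K := if Even i then 1 else ((q⁻¹ : Kˣ) : K)

theorem chainParam_succ (i : ℕ) : chainParam q i * q * chainParam q (i + 1) = 1 := by
  by_cases h : Even i <;> simp [chainParam, h, Nat.even_add_one]

/-- Successive polynomials satisfy the exchange relations, with parameter alternately `1` and `q⁻¹`. -/
theorem exchangePair_chain {i m : ℕ} (hm : i + 1 + m = n) :
    ExchangePair (q : K) (chainParam q i) m (chain (n := n) q i) (chain q (i + 1)) := by
  induction i generalizing m with
  | zero =>
    simp only [chainParam, Even.zero, if_true]
    exact exchangePair_basePoly q (by omega)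
  | succ i ih =>
    have := (ih (m := m + 1) (by omega)).next (chainParam_succ q i)
    rw [chain, show n - (i + 1) = m + 1 by omega]
    exact this

theorem chain_comm {i : ℕ} (hi : i ≤ n) (hn : 0 < n) (j k : ℕ) :
    (chain (n := n) q i).coeff j * (chain q i).coeff k = (chain q i).coeff k * (chain q i).coeff j := by
  cases i with
  | zero => exact (exchangePair_chain (n := n) q (i := 0) (m := n - 1) (by omega)).comm_A j k
  | succ i => exact (exchangePair_chain (n := n) q (i := i) (m := n - (i + 1)) (by omega)).comm_B j k

theorem chain_coeff_of_lt {i : ℕ} (hi : i ≤ n) (hn : 0 < n) {k : ℕ} (hk : n - i < k) :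
    (chain (n := n) q i).coeff k = 0 := by
  cases i with
  | zero => exact (exchangePair_chain (n := n) q (i := 0) (m := n - 1) (by omega)).coeff_A k (by omega)
  | succ i =>
    exact (exchangePair_chain (n := n) q (i := i) (m := n - (i + 1)) (by omega)).coeff_B k (by omega)

/-- Up to the sign, `e_k^{(i)}` is the coefficient of `P_i` at `u^k` if `i` is odd, and at
`u^{n-i-k}` if `i` is even; in the latter case the signs alternate in `k`. -/
theorem eRec_eq_chain (hn : 0 < n) (i : ℕ) (hi : i ≤ n) :
    ∃ ε : QField fun _ : Fin n => q, (ε = 1 ∨ ε = -1) ∧ ∀ k ≤ n - i,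
      eRec (fun _ : Fin n => q) i k =
        if Even i then ε * ((-1) ^ k * (chain q i).coeff (n - i - k)) else ε * (chain q i).coeff k := by
  induction i using Nat.strong_induction_on with
  | _ i ih =>
    match i, hi, ih with
    | 0, _, _ =>
      refine ⟨1, .inl rfl, fun k hk => ?_⟩
      rw [if_pos (by simp), eRec, chain, basePoly_coeff, rootPoly_coeff (by omega),
        show n - (n - 0 - k) = k by omega, map_mul, ← e, map_pow, map_neg, map_one, one_mul,
        ← mul_assoc, ← pow_add, (Even.add_self k).neg_one_pow, one_mul]
    | 1, h1, _ =>
      refine ⟨1, .inl rfl, fun k hk => ?_⟩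
      rw [if_neg (by simp), eRec, chain, interpPoly_coeff q (by omega), one_mul]
    | i + 2, hi, ih =>
      obtain ⟨ε, hε, h0⟩ := ih i (by omega) (by omega)
      obtain ⟨ε', hε', h1⟩ := ih (i + 1) (by omega) (by omega)
      obtain ⟨m, hm⟩ : ∃ m, n = i + 2 + m := ⟨n - (i + 2), by omega⟩
      have hcomm := chain_comm (n := n) q (i := i + 1) (by omega) hn
      have e1 : n - (i + 2) = m := by omega
      have e2 : n - (i + 1) = m + 1 := by omega
      have e3 : n - i = m + 2 := by omega
      have hA : ∀ k ≤ m + 2, _ := fun k hk => h0 k (by omega)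
      have hB : ∀ k ≤ m + 1, _ := fun k hk => h1 k (by omega)
      have hc : ∀ k, (chain (n := n) q (i + 2)).coeff k = _ := fun k => by
        rw [chain, ExchangePair.coeff_step]
      rw [e1]
      rw [e2] at hc hB
      rw [e3] at hA
      by_cases hev : Even i
      · refine ⟨-ε, by rcases hε with rfl | rfl <;> simp, fun k hk => ?_⟩
        obtain ⟨r, rfl⟩ := Nat.exists_eq_add_of_le hk
        rw [if_pos (by simpa [Nat.even_add] using hev), eRec, e1, hc,
          hA _ (by omega), hA _ (by omega), hA _ (by omega), hB _ (by omega), hB _ (by omega),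
          hB _ (by omega), hB _ (by omega)]
        simp only [if_pos hev, if_neg (show ¬ Even (i + 1) by simpa [Nat.even_add_one] using hev)]
        simp only [show k + r + 2 - (k + 1) = r + 1 by omega, show k + r - k = r by omega,
          show k + r + 1 - k = r + 1 by omega, Nat.sub_zero,
          show k + r + 2 - (k + r + 2) = 0 by omega, pow_add]
        rcases hε with rfl | rfl <;> rcases hε' with rfl | rfl <;>
        rcases neg_one_pow_eq_or (QField fun _ : Fin n => q) k with h | h <;>
        rcases neg_one_pow_eq_or (QField fun _ : Fin n => q) r with h' | h' <;>
        simp [h, h'] <;> noncomm_ring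
      · refine ⟨ε * (-1) ^ (m + 1), ?_, fun k hk => ?_⟩
        · rcases hε with rfl | rfl <;>
          rcases neg_one_pow_eq_or (QField fun _ : Fin n => q) (m + 1) with h | h <;> simp [h]
        obtain ⟨r, rfl⟩ := Nat.exists_eq_add_of_le hk
        rw [if_neg (by simpa [Nat.even_add] using hev), eRec, e1, hc,
          hA _ (by omega), hA _ (by omega), hA _ (by omega), hB _ (by omega), hB _ (by omega),
          hB _ (by omega), hB _ (by omega)]
        simp only [if_neg hev, if_pos (show Even (i + 1) by simpa [Nat.even_add_one] using hev)]
        simp only [show k + r - k = r by omega,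
          show k + r + 1 - k = r + 1 by omega, Nat.sub_zero, Nat.sub_self,
          show k + r + 1 - r = k + 1 by omega, show k + r + 1 - (r + 1) = k by omega, pow_add]
        rw [hcomm 0 (k + r + 1)]
        rcases hε with rfl | rfl <;> rcases hε' with rfl | rfl <;>
        rcases neg_one_pow_eq_or (QField fun _ : Fin n => q) k with h | h <;>
        rcases neg_one_pow_eq_or (QField fun _ : Fin n => q) r with h' | h' <;>
        simp [h, h'] <;> noncomm_ring

end QField
end Chain

/-! ### End coefficients and the relations of the generators -/

noncomputable section Corners

open Polynomial

theorem UpToUnit.of_eq_or_eq_neg {K F : Type*} [Field K] [Ring F] [Algebra K F] {a b : F}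
    (h : a = b ∨ a = -b) : UpToUnit K a b := by
  rcases h with rfl | rfl
  · exact .refl _
  · exact ⟨-1, by simp⟩

namespace QField

variable {K : Type*} [Field K] {n : ℕ} (q : Kˣ)

/-- The end coefficient of `P_i` that is `X_{i+1}` up to the sign: the constant term if `i` is even
and the leading coefficient if `i` is odd. -/
def cornerX (q : Kˣ) (i : ℕ) : QField fun _ : Fin n => q :=
  if Even i then (chain q i).coeff 0 else (chain q i).coeff (n - i)

/-- The end coefficient of `P_i` that is `Y_i` up to the sign: the leading coefficient if `i` is even
and the constant term if `i` is odd. -/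
def cornerY (q : Kˣ) (i : ℕ) : QField fun _ : Fin n => q :=
  if Even i then (chain q i).coeff (n - i) else (chain q i).coeff 0

theorem bigX_upToUnit (hn : 0 < n) {i : ℕ} (hi : i ≤ n) :
    UpToUnit K (bigX (fun _ : Fin n => q) (i + 1)) (cornerX q i) := by
  obtain ⟨ε, hε, h⟩ := eRec_eq_chain (n := n) q hn i hi
  rw [bigX, Nat.add_sub_cancel, h _ le_rfl, cornerX, Nat.sub_self]
  rcases neg_one_pow_eq_or (QField fun _ : Fin n => q) (n - i) with h | h <;> rw [h] <;>
  rcases hε with rfl | rfl <;> split_ifs <;>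
  exact .of_eq_or_eq_neg (by simp)

theorem bigY_upToUnit (hn : 0 < n) {i : ℕ} (hi : i ≤ n) :
    UpToUnit K (bigY (fun _ : Fin n => q) i) (cornerY q i) := by
  obtain ⟨ε, hε, h⟩ := eRec_eq_chain (n := n) q hn i hi
  rw [bigY, h _ (Nat.zero_le _), cornerY, Nat.sub_zero, pow_zero, one_mul]
  rcases hε with rfl | rfl <;> split_ifs <;>
  exact .of_eq_or_eq_neg (by simp)

theorem exists_cornerX_eq (i : ℕ) : ∃ k, cornerX (n := n) q i = (chain q i).coeff k := by
  unfold cornerX; split_ifs <;> exact ⟨_, rfl⟩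

theorem exists_cornerY_eq (i : ℕ) : ∃ k, cornerY (n := n) q i = (chain q i).coeff k := by
  unfold cornerY; split_ifs <;> exact ⟨_, rfl⟩

/-- `Y_i` commutes with `P_{i+1}`. -/
theorem cornerY_comm_succ {i : ℕ} (hi : i < n) (j : ℕ) :
    SkewComm (1 : Kˣ) (cornerY (n := n) q i) ((chain q (i + 1)).coeff j) := by
  have h := exchangePair_chain (n := n) q (i := i) (m := n - (i + 1)) (by omega)
  rw [SkewComm.one_iff, cornerY]
  split_ifs with hev
  · have := h.lead_A j
    rw [chainParam, if_pos hev, one_smul, show n - (i + 1) + 1 = n - i by omega] at this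
    exact this.symm
  · have := h.zero_succ j
    rw [chainParam, if_neg hev] at this
    simpa using this.symm

/-- The exponent of `q` in the commutation of `X_{i+1}` with `P_{i+1}`. -/
theorem cornerX_skewComm_succ {i : ℕ} (hi : i < n) (j : ℕ) :
    SkewComm (q⁻¹ ^ ((-1) ^ i : ℤ)) (cornerX (n := n) q i) ((chain q (i + 1)).coeff j) := by
  have h := exchangePair_chain (n := n) q (i := i) (m := n - (i + 1)) (by omega)
  rw [cornerX]
  split_ifs with hev
  · have := h.zero_succ j
    rw [chainParam, if_pos hev, one_mul] at this
    rw [hev.neg_one_pow, zpow_one]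
    exact SkewComm.symm this
  · have := h.lead_A j
    rw [chainParam, if_neg hev, show n - (i + 1) + 1 = n - i by omega] at this
    rw [(Nat.not_even_iff_odd.1 hev).neg_one_pow, zpow_neg_one]
    exact SkewComm.symm this

theorem corner_comm_self {i : ℕ} (hi : i ≤ n) (hn : 0 < n) (j : ℕ) :
    SkewComm (1 : Kˣ) (cornerX (n := n) q i) ((chain q i).coeff j) ∧
      SkewComm (1 : Kˣ) (cornerY (n := n) q i) ((chain q i).coeff j) := by
  obtain ⟨k, hk⟩ := exists_cornerX_eq (n := n) q i
  obtain ⟨l, hl⟩ := exists_cornerY_eq (n := n) q i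
  rw [hk, hl, SkewComm.one_iff, SkewComm.one_iff]
  exact ⟨chain_comm q hi hn _ _, chain_comm q hi hn _ _⟩

variable {G : Type*} [DivisionRing G] [Algebra K G] (ψ : (QField fun _ : Fin n => q) →ₐ[K] G)

/-- The exponents of a commutation propagate along the sequence by the recursion
`f_{i+2} = f_i + 2 f_{i+1}`. -/
theorem skewComm_chain_next {ζ₀ ζ₁ : Kˣ} {z : G} {i : ℕ}
    (h0 : ∀ j, SkewComm ζ₀ z (ψ ((chain q i).coeff j)))
    (h1 : ∀ j, SkewComm ζ₁ z (ψ ((chain q (i + 1)).coeff j))) (j : ℕ) :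
    SkewComm (ζ₀ * (ζ₁ * ζ₁)) z (ψ ((chain q (i + 2)).coeff j)) := by
  rw [chain, ExchangePair.coeff_step]
  simp only [map_sub, map_mul]
  exact (((h0 _).mul_right ((h1 _).mul_right (h1 _))).sub_right
    ((h0 _).mul_right ((h1 _).mul_right (h1 _)))).sub_right
      ((h0 _).mul_right ((h1 _).mul_right (h1 _)))

theorem exists_skewComm_chain {ζ : Kˣ} {z : G} {i : ℕ}
    (h0 : ∀ j, SkewComm (1 : Kˣ) z (ψ ((chain q i).coeff j)))
    (h1 : ∀ j, SkewComm ζ z (ψ ((chain q (i + 1)).coeff j))) :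
    ∃ f : ℕ → Kˣ, f i = 1 ∧ f (i + 1) = ζ ∧ (∀ r, i ≤ r → f (r + 2) = f r * (f (r + 1) * f (r + 1))) ∧
      ∀ r, i ≤ r → ∀ j, SkewComm (f r) z (ψ ((chain q r).coeff j)) := by
  -- `g k` is the pair of scalars for `P_{i+k}` and `P_{i+k+1}`.
  let g : ℕ → Kˣ × Kˣ := fun k => Nat.rec (1, ζ) (fun _ p => (p.2, p.1 * (p.2 * p.2))) k
  have hg : ∀ k, (∀ j, SkewComm (g k).1 z (ψ ((chain q (i + k)).coeff j))) ∧
      ∀ j, SkewComm (g k).2 z (ψ ((chain q (i + k + 1)).coeff j)) := by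
    intro k
    induction k with
    | zero => exact ⟨h0, h1⟩
    | succ k ih => exact ⟨ih.2, skewComm_chain_next q ψ ih.1 ih.2⟩
  refine ⟨fun r => (g (r - i)).1, by simp [g], ?_, fun r hr => ?_, fun r hr => ?_⟩
  · simp only [Nat.add_sub_cancel_left]; rfl
  · obtain ⟨k, rfl⟩ := Nat.exists_eq_add_of_le hr
    simp only [show i + k + 2 - i = k + 2 by omega, show i + k + 1 - i = k + 1 by omega,
      Nat.add_sub_cancel_left]
    rfl
  · obtain ⟨k, rfl⟩ := Nat.exists_eq_add_of_le hr
    simp only [Nat.add_sub_cancel_left]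
    exact (hg k).1

/-- A formula for `X̂_{i+1}` that includes `i = 0`, because `Y_0 = 1`. -/
theorem hatX_succ (i : ℕ) : hatX (fun _ : Fin n => q) (i + 1) =
    bigY (fun _ : Fin n => q) i ^ ((-1) ^ (i + 1) : ℤ) *
      bigX (fun _ : Fin n => q) (i + 1) ^ ((-1) ^ i : ℤ) := by
  rw [hatX]
  split_ifs with h
  · obtain rfl : i = 0 := by omega
    simp [bigY, eRec, e]
  · rw [Nat.add_sub_cancel, pow_add _ (i + 1) 1, pow_add _ i 1]; simp

/-- A formula for `Ŷ_{i+1}` that includes `i = 0`, where `i - 1 = 0`, and `i = 1`, because `Y_0 = 1`. -/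
theorem hatY_succ (i : ℕ) : hatY (fun _ : Fin n => q) (i + 1) =
    (bigY (fun _ : Fin n => q) (i - 1))⁻¹ * bigY (fun _ : Fin n => q) i ^ (-2 : ℤ) *
      bigY (fun _ : Fin n => q) (i + 1) := by
  have h0 : bigY (fun _ : Fin n => q) 0 = 1 := by simp [bigY, eRec, e]
  rw [hatY]
  split_ifs with h h'
  · obtain rfl : i = 0 := by omega
    simp [h0]
  · obtain rfl : i = 1 := by omega
    simp [h0]
  · rw [show i + 1 - 2 = i - 1 by omega, Nat.add_sub_cancel]

theorem upToUnit_map {a b : QField fun _ : Fin n => q} (h : UpToUnit K a b) :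
    UpToUnit K (ψ a) (ψ b) := by
  obtain ⟨c, rfl⟩ := h
  exact ⟨c, map_smul ψ _ _⟩

theorem skewComm_bigX (hn : 0 < n) {ζ : Kˣ} {z : G} {i : ℕ} (hi : i ≤ n)
    (h : ∀ j, SkewComm ζ z (ψ ((chain q i).coeff j))) :
    SkewComm ζ z (ψ (bigX (fun _ : Fin n => q) (i + 1))) := by
  obtain ⟨k, hk⟩ := exists_cornerX_eq (n := n) q i
  exact (hk ▸ h k : SkewComm ζ z (ψ (cornerX q i))).of_upToUnit_right
    (upToUnit_map q ψ (bigX_upToUnit q hn hi))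

theorem skewComm_bigY (hn : 0 < n) {ζ : Kˣ} {z : G} {i : ℕ} (hi : i ≤ n)
    (h : ∀ j, SkewComm ζ z (ψ ((chain q i).coeff j))) :
    SkewComm ζ z (ψ (bigY (fun _ : Fin n => q) i)) := by
  obtain ⟨k, hk⟩ := exists_cornerY_eq (n := n) q i
  exact (hk ▸ h k : SkewComm ζ z (ψ (cornerY q i))).of_upToUnit_right
    (upToUnit_map q ψ (bigY_upToUnit q hn hi))

/-- An element that commutes with `P_i` and commutes up to a scalar with `P_{i+1}` commutes with
`X̂_{j+1}` for `j ≥ i` and with `Ŷ_{j+1}` for `j > i`: the exponents of the generators in `X̂` and `Ŷ`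
are those that cancel the scalars. -/
theorem comm_hat (hn : 0 < n) {ζ : Kˣ} {z : G} {i : ℕ}
    (h0 : ∀ j, SkewComm (1 : Kˣ) z (ψ ((chain q i).coeff j)))
    (h1 : ∀ j, SkewComm ζ z (ψ ((chain q (i + 1)).coeff j))) {j : ℕ} (hj : j < n) :
    (i ≤ j → SkewComm (1 : Kˣ) z (ψ (hatX (fun _ : Fin n => q) (j + 1)))) ∧
    (i < j → SkewComm (1 : Kˣ) z (ψ (hatY (fun _ : Fin n => q) (j + 1)))) := by
  obtain ⟨f, -, -, hf, hz⟩ := exists_skewComm_chain q ψ h0 h1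
  constructor
  · intro hij
    have := ((skewComm_bigY q ψ hn hj.le (hz j hij)).zpow_right ((-1) ^ (j + 1))).mul_right
      ((skewComm_bigX q ψ hn hj.le (hz j hij)).zpow_right ((-1) ^ j))
    rw [← zpow_add, show ((-1) ^ (j + 1) + (-1) ^ j : ℤ) = 0 by rw [pow_succ]; ring,
      zpow_zero] at this
    rwa [hatX_succ q, map_mul, map_zpow₀, map_zpow₀]
  · intro hij
    obtain ⟨r, rfl⟩ : ∃ r, j = r + 1 := ⟨j - 1, by omega⟩
    have := ((skewComm_bigY q ψ hn (by omega) (hz r (by omega))).inv_right.mul_right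
      ((skewComm_bigY q ψ hn (by omega) (hz (r + 1) (by omega))).zpow_right (-2))).mul_right
      (skewComm_bigY q ψ hn (by omega) (hz (r + 2) (by omega)))
    rw [hf r (by omega), show (f r)⁻¹ * f (r + 1) ^ (-2 : ℤ) * (f r * (f (r + 1) * f (r + 1))) = 1 by
      rw [zpow_neg, zpow_ofNat, pow_two, ← mul_inv, inv_mul_cancel]] at this
    rwa [hatY_succ, Nat.add_sub_cancel, map_mul, map_mul, map_zpow₀, map_inv₀]

/-- `Y_i` commutes with all later polynomials: the exponents vanish for `P_i` and `P_{i+1}`. -/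
theorem bigY_comm_chain (hn : 0 < n) {i r : ℕ} (hi : i < n) (hr : i ≤ r) (j : ℕ) :
    SkewComm (1 : Kˣ) (bigY (fun _ : Fin n => q) i) ((chain q r).coeff j) := by
  obtain ⟨f, f0, f1, hf, hz⟩ := exists_skewComm_chain q (AlgHom.id K _) (fun j => (corner_comm_self q hi.le hn j).2)
    (cornerY_comm_succ q hi)
  have : ∀ k, f (i + k) = 1 ∧ f (i + k + 1) = 1 := by
    intro k
    induction k with
    | zero => exact ⟨f0, f1⟩
    | succ k ih =>
      refine ⟨ih.2, ?_⟩
      rw [show i + (k + 1) + 1 = i + k + 2 by omega, hf _ (by omega), ih.1, ih.2]; simp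
  obtain ⟨k, rfl⟩ := Nat.exists_eq_add_of_le hr
  have h := hz (i + k) hr j
  rw [(this k).1] at h
  exact h.of_upToUnit_left (bigY_upToUnit q hn hi.le)

theorem bigY_comm_bigY (hn : 0 < n) {i j : ℕ} (hi : i ≤ n) (hj : j ≤ n) :
    SkewComm (1 : Kˣ) (bigY (fun _ : Fin n => q) i) (bigY (fun _ : Fin n => q) j) := by
  wlog hij : i < j generalizing i j
  · obtain rfl | hlt := eq_or_lt_of_le (not_lt.1 hij)
    · exact SkewComm.one_iff.2 rfl
    · simpa using (this hj hi hlt).symm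
  exact skewComm_bigY q (AlgHom.id K _) hn hj (bigY_comm_chain q hn (by omega) hij.le)

theorem hatX_comm_chain (hn : 0 < n) {i : ℕ} (hi : i < n) (j : ℕ) :
    SkewComm (1 : Kˣ) (hatX (fun _ : Fin n => q) (i + 1)) ((chain q i).coeff j) := by
  rw [hatX_succ q]
  have h1 := (bigY_comm_chain q hn hi le_rfl j).zpow_left ((-1) ^ (i + 1))
  have h2 := ((corner_comm_self q hi.le hn j).1.of_upToUnit_left
    (bigX_upToUnit q hn hi.le)).zpow_left ((-1) ^ i)
  simpa using h1.mul_left h2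

/-- The sign of the exponent in `X̂_{i+1}` makes the scalar in the commutation with `P_{i+1}`
independent of the parity of `i`. -/
theorem hatX_skewComm_chain_succ (hn : 0 < n) {i : ℕ} (hi : i < n) (j : ℕ) :
    SkewComm q⁻¹ (hatX (fun _ : Fin n => q) (i + 1)) ((chain q (i + 1)).coeff j) := by
  rw [hatX_succ q]
  have h1 := (bigY_comm_chain q hn hi (Nat.le_succ i) j).zpow_left ((-1) ^ (i + 1))
  have h2 := ((cornerX_skewComm_succ q hi j).of_upToUnit_left
    (bigX_upToUnit q hn hi.le)).zpow_left ((-1) ^ i)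
  rw [← zpow_mul, ← pow_add, (Even.add_self i).neg_one_pow, zpow_one] at h2
  simpa using h1.mul_left h2

/-- The elements `X̂_i`, `Ŷ_i` satisfy the relations of the generators `x_i`, `y_i`. -/
theorem qRelations_hat (hn : 0 < n) : QRelations (fun _ : Fin n => q)
    (fun i => hatX (fun _ : Fin n => q) (i + 1)) (fun i => hatY (fun _ : Fin n => q) (i + 1)) := by
  refine ⟨fun i j => ?_, fun i j => ?_, fun i j => ?_⟩
  · wlog hij : i ≤ j generalizing i j
    · exact (this j i (le_of_not_ge hij)).symm
    exact SkewComm.one_iff.1 ((comm_hat q (AlgHom.id K _) hn (hatX_comm_chain q hn i.2)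
      (hatX_skewComm_chain_succ q hn i.2) j.2).1 hij)
  · have h : ∀ k ≤ n, SkewComm (1 : Kˣ) (bigY (fun _ : Fin n => q) k)
        (hatY (fun _ : Fin n => q) (j + 1)) := fun k hk => by
      rw [hatY_succ]
      simpa using ((bigY_comm_bigY q hn hk (by omega)).inv_right.mul_right
        ((bigY_comm_bigY q hn hk (by omega)).zpow_right (-2))).mul_right
        (bigY_comm_bigY q hn hk (show (j : ℕ) + 1 ≤ n by omega))
    rw [← SkewComm.one_iff (K := K), hatY_succ q i]
    simpa using ((h _ (by omega)).zpow_left (-1) |>.mul_left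
      ((h _ (by omega)).zpow_left (-2))).mul_left (h (i + 1) (by omega))
  · suffices h : SkewComm (if i = j then q⁻¹ else 1) (hatX (fun _ : Fin n => q) (j + 1))
        (hatY (fun _ : Fin n => q) (i + 1)) by
      have := h.symm
      rw [SkewComm] at this
      rw [this]
      split_ifs <;> simp
    have hlow : ∀ k ≤ (j : ℕ), SkewComm (1 : Kˣ) (hatX (fun _ : Fin n => q) (j + 1))
        (bigY (fun _ : Fin n => q) k) := fun k hk => by
      rw [hatX_succ q]
      simpa using ((bigY_comm_bigY q hn (by omega) (by omega)).zpow_left _).mul_left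
        ((skewComm_bigX q (AlgHom.id K _) hn (by omega) (bigY_comm_chain q hn (by omega) hk)).symm.zpow_left _)
    rcases lt_trichotomy i j with hij | rfl | hij
    · rw [if_neg hij.ne, hatY_succ]
      simpa using ((hlow _ (by omega)).inv_right.mul_right ((hlow _ (by omega)).zpow_right (-2))).mul_right
        (hlow ((i : ℕ) + 1) (by omega))
    · rw [if_pos rfl, hatY_succ]
      simpa using ((hlow _ (by omega)).inv_right.mul_right ((hlow _ le_rfl).zpow_right (-2))).mul_right
        (skewComm_bigY q (AlgHom.id K _) hn (by omega) (hatX_skewComm_chain_succ q hn i.2))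
    · rw [if_neg hij.ne']
      exact (comm_hat q (AlgHom.id K _) hn (hatX_comm_chain q hn j.2)
        (hatX_skewComm_chain_succ q hn j.2) i.2).2 hij

end QField
end Corners

/-! ### Reversing the sequence, and nonvanishing of the end coefficients -/

noncomputable section Reconstruction

open Polynomial

namespace QField

variable {K : Type*} [Field K] {n : ℕ} (q : Kˣ)

/-- The Euclidean sequence can be run backwards: `P_i` and `P_{i+1}` determine the previous
polynomials as soon as the end coefficients of these are known. -/
theorem chain_mem_of_corner_mem (T : Subalgebra K (QField fun _ : Fin n => q)) {i : ℕ} (hi : i < n)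
    (hcorner : ∀ r ≤ i, cornerX q r ∈ T ∧ cornerY q r ∈ T)
    (hinv : ∀ r, 0 < r → r ≤ i → cornerX (n := n) q r ≠ 0 ∧ cornerY (n := n) q r ≠ 0 ∧
      (cornerX q r)⁻¹ ∈ T ∧ (cornerY q r)⁻¹ ∈ T)
    (h0 : ∀ k, (chain q i).coeff k ∈ T) (h1 : ∀ k, (chain q (i + 1)).coeff k ∈ T) :
    (∀ k, (chain q 0).coeff k ∈ T) ∧ ∀ k, (chain q 1).coeff k ∈ T := by
  induction i with
  | zero => exact ⟨h0, h1⟩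
  | succ i ih =>
    refine ih (by omega) (fun r hr => hcorner r (by omega)) (fun r hr hr' => hinv r hr (by omega))
      (fun k => ?_) h0
    set A := chain (n := n) q i with hA
    set B := chain (n := n) q (i + 1) with hB
    have hAc : A.coeff 0 ∈ T ∧ A.coeff (n - (i + 1) + 1) ∈ T := by
      have := hcorner i (by omega)
      rw [cornerX, cornerY] at this
      rw [show n - (i + 1) + 1 = n - i by omega]
      split_ifs at this
      exacts [this, this.symm]
    have hBc : B.coeff 0 ≠ 0 ∧ B.coeff (n - (i + 1)) ≠ 0 ∧ (B.coeff 0)⁻¹ ∈ T ∧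
        (B.coeff (n - (i + 1)))⁻¹ ∈ T := by
      have := hinv (i + 1) (by omega) le_rfl
      rw [cornerX, cornerY] at this
      split_ifs at this
      exacts [this, ⟨this.2.1, this.1, this.2.2.2, this.2.2.1⟩]
    cases k with
    | zero => exact hAc.1
    | succ k =>
      have h := ExchangePair.coeff_step (n - (i + 1)) A B k
      have hne : B.coeff 0 * B.coeff (n - (i + 1)) ≠ 0 := mul_ne_zero hBc.1 hBc.2.1
      have h' : A.coeff (k + 1) = ((chain q (i + 2)).coeff k + A.coeff (n - (i + 1) + 1) *
          (B.coeff k * B.coeff 0) + A.coeff 0 * (B.coeff (k + 1) * B.coeff (n - (i + 1)))) *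
          (B.coeff 0 * B.coeff (n - (i + 1)))⁻¹ := by
        rw [eq_mul_inv_iff_mul_eq₀ hne, chain, h]
        abel
      rw [h', mul_inv_rev]
      exact T.mul_mem (T.add_mem (T.add_mem (h1 k) (T.mul_mem hAc.2 (T.mul_mem (h0 _) (h0 _))))
        (T.mul_mem hAc.1 (T.mul_mem (h0 _) (h0 _)))) (T.mul_mem hBc.2.2.2 hBc.2.2.1)

/-- An algebra that contains the `e_k` and the `t_k` satisfies the conditions of the
generation lemmas: `x_j` is a root of `P_0`, and `y_j` is a value of `P_1`. -/
theorem isIntegral_and_mem_of_chain_mem {T : Subalgebra K (QField fun _ : Fin n => q)}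
    (h0 : ∀ k, (chain q 0).coeff k ∈ T) (h1 : ∀ k, (chain q 1).coeff k ∈ T) :
    (∀ i, IsIntegral (T.comap (poly fun _ : Fin n => q))
      (MvPolynomial.X i : MvPolynomial (Fin n) K)) ∧
    ∀ i, y (fun _ : Fin n => q) i ∈ (poly fun _ : Fin n => q).range.toSubmodule * T.toSubmodule := by
  constructor
  · intro i
    have hc : ∀ k, (rootPoly K n).coeff k ∈ T.comap (poly fun _ : Fin n => q) := fun k => by
      rw [Subalgebra.mem_comap, ← basePoly_coeff]
      exact h0 k
    have hl : rootPoly K n ∈ lifts (algebraMap (T.comap (poly fun _ : Fin n => q))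
        (MvPolynomial (Fin n) K)) := by
      rw [lifts_iff_coeff_lifts]
      exact fun k => ⟨⟨_, hc k⟩, rfl⟩
    obtain ⟨p, hp, -, hmonic⟩ := lifts_and_degree_eq_and_monic hl monic_rootPoly
    refine ⟨p, hmonic, ?_⟩
    rw [← eval_map, hp, eval_rootPoly]
  · intro i
    rw [y_eq_sum]
    refine Submodule.sum_mem _ fun k _ => Submodule.mul_mem_mul ⟨MvPolynomial.X i ^ (k : ℕ), ?_⟩ ?_
    · simp [poly_X]
    · have := h1 k
      rwa [chain, interpPoly_coeff q k.2] at this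

end QField
end Reconstruction

noncomputable section Nonvanishing

open Polynomial

namespace QField

variable {K : Type*} [Field K] {n : ℕ} (q : Kˣ)

theorem corner_zero_ne_zero : cornerX (n := n) q 0 ≠ 0 ∧ cornerY (n := n) q 0 ≠ 0 := by
  rw [cornerX, cornerY, if_pos Even.zero, if_pos Even.zero, chain, basePoly_coeff, basePoly_coeff,
    Nat.sub_zero]
  constructor
  · rw [map_ne_zero_iff _ (poly_injective _), rootPoly, coeff_zero_eq_eval_zero, eval_prod,
      Finset.prod_ne_zero_iff]
    simp
  · have := monic_rootPoly (K := K) (n := n)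
    rw [Monic, leadingCoeff, natDegree_rootPoly] at this
    rw [this, map_one]
    exact one_ne_zero

/-- The end coefficients of `P_i` commute up to scalars with all later polynomials. -/
theorem corner_qCommute (hn : 0 < n) {i r : ℕ} (hi : i < n) (hr : i ≤ r) (k : ℕ) :
    QCommute K (cornerX (n := n) q i) ((chain q r).coeff k) ∧
      QCommute K (cornerY (n := n) q i) ((chain q r).coeff k) := by
  obtain ⟨f, -, -, -, hf⟩ := exists_skewComm_chain q (AlgHom.id K _) (fun j => (corner_comm_self q hi.le hn j).1)
    (cornerX_skewComm_succ q hi)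
  obtain ⟨g, -, -, -, hg⟩ := exists_skewComm_chain q (AlgHom.id K _) (fun j => (corner_comm_self q hi.le hn j).2)
    (cornerY_comm_succ q hi)
  exact ⟨(hf r hr k).qCommute, (hg r hr k).qCommute⟩

/-- If an end coefficient of `B` vanishes, or if `q = 1`, the exchange relations for a pair `A`, `B`
degenerate and say that the coefficients commute; for `q ≠ 1` the reason is that then `B = 0`. -/
theorem qCommute_of_degenerate {i m : ℕ} (hm : i + 1 + m = n)
    (hA : (chain (n := n) q i).coeff 0 ≠ 0) (hA' : (chain (n := n) q i).coeff (m + 1) ≠ 0)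
    (hB : (chain (n := n) q (i + 1)).coeff 0 = 0 ∨ (chain (n := n) q (i + 1)).coeff m = 0)
    (j k : ℕ) : QCommute K ((chain (n := n) q i).coeff j) ((chain q (i + 1)).coeff k) := by
  have h := exchangePair_chain (n := n) q hm
  have hl : chainParam q i ≠ 0 := by unfold chainParam; split_ifs <;> simp
  by_cases hq : q = 1
  · subst hq
    have hl1 : chainParam (1 : Kˣ) i = 1 := by unfold chainParam; split_ifs <;> simp
    rw [hl1, Units.val_one] at h
    refine .of_commute ?_
    induction k generalizing j with
    | zero => simpa using (h.succ_zero j).symm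
    | succ k ih =>
      have := h.succ_succ j k
      rw [← ih (j + 1)] at this
      simp only [one_smul, mul_one, sub_self, mul_zero, zero_smul, sub_zero] at this
      exact (sub_left_injective this).symm
  · have hc : chainParam q i * (1 - (q : K)) ≠ 0 :=
      mul_ne_zero hl (sub_ne_zero.2 fun h' => hq (Units.ext h'.symm))
    suffices (chain (n := n) q (i + 1)).coeff k = 0 by
      rw [this]; exact .zero_right _
    rcases hB with hB | hB
    · have := h.succ_zero k
      rw [hB, zero_mul, mul_zero, smul_zero, zero_sub, eq_comm, neg_eq_zero] at this
      exact ((mul_eq_zero.1 ((smul_eq_zero.1 this).resolve_left hc)).resolve_left hA)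
    · have := h.lead_B k
      rw [hB, zero_mul, mul_zero, smul_zero, zero_add, eq_comm] at this
      exact ((mul_eq_zero.1 ((smul_eq_zero.1 this).resolve_left hc)).resolve_left hA')

/-- The end coefficients do not vanish. If one of those of `P_{s+1}` did, the end coefficients of
`P_0, …, P_s`, the inner coefficients of `P_s` and the coefficients of `P_{s+1}` would be `2n` elements
commuting up to scalars, over whose Laurent algebra the skew field is finite. Hence their monomials
would be linearly independent, and none of them could vanish. -/
theorem corner_ne_zero (hn : 0 < n) {i : ℕ} (hi : i ≤ n) :
    cornerX (n := n) q i ≠ 0 ∧ cornerY (n := n) q i ≠ 0 := by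
  induction i using Nat.strong_induction_on with
  | _ i ih =>
    obtain rfl | ⟨s, rfl⟩ : i = 0 ∨ ∃ s, i = s + 1 := by
      cases i with
      | zero => exact .inl rfl
      | succ s => exact .inr ⟨s, rfl⟩
    · exact corner_zero_ne_zero q
    obtain ⟨m, rfl⟩ := Nat.exists_eq_add_of_le hi
    set n := s + 1 + m with hnm
    have hends : ∀ i ≤ n, (cornerX (n := n) q i ≠ 0 ∧ cornerY (n := n) q i ≠ 0) ↔
        ((chain (n := n) q i).coeff 0 ≠ 0 ∧ (chain (n := n) q i).coeff (n - i) ≠ 0) := by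
      intro i hi
      rw [cornerX, cornerY]
      split_ifs
      · rfl
      · exact and_comm
    rw [hends _ hi, show n - (s + 1) = m by omega]
    by_contra hcon
    have hB : (chain (n := n) q (s + 1)).coeff 0 = 0 ∨ (chain (n := n) q (s + 1)).coeff m = 0 := by
      tauto
    have hA := (hends s (by omega)).1 (ih s (by omega) (by omega))
    rw [show n - s = m + 1 by omega] at hA
    have hAB := qCommute_of_degenerate q hnm.symm hA.1 hA.2 hB
    -- `s + 1` elements `X_i`, `s` elements `Y_i` (as `Y_0 = 1`), `m` inner coefficients of `P_s` and `m + 1`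
    -- coefficients of `P_{s+1}`; together `2 (s + 1 + m) = 2 n`.
    let ι := (Fin (s + 1) ⊕ Fin s) ⊕ (Fin m ⊕ Fin (m + 1))
    let z : ι → QField fun _ : Fin n => q := Sum.elim
      (Sum.elim (fun i => cornerX q i) (fun i => cornerY q (i + 1)))
      (Sum.elim (fun i => (chain q s).coeff (i + 1)) (fun i => (chain q (s + 1)).coeff i))
    have hcc : ∀ i ≤ s, ∀ j ≤ s, ∀ c ∈ ({cornerX q i, cornerY q i} : Set (QField fun _ : Fin n => q)),
        ∀ d ∈ ({cornerX q j, cornerY q j} : Set (QField fun _ : Fin n => q)), QCommute K c d := by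
      intro i hi j hj
      wlog hij : i ≤ j generalizing i j
      · exact fun c hc d hd => (this j hj i hi (by omega) d hd c hc).symm
      obtain ⟨k, hk⟩ := exists_cornerX_eq (n := n) q j
      obtain ⟨l, hl⟩ := exists_cornerY_eq (n := n) q j
      rw [hk, hl]
      have h := corner_qCommute q hn (show i < n by omega) hij
      rintro _ (rfl | rfl) _ (rfl | rfl)
      exacts [(h _).1, (h _).1, (h _).2, (h _).2]
    have hz : ∀ i j, QCommute K (z i) (z j) := by
      have hcr : ∀ (i : Fin (s + 1) ⊕ Fin s) (r : ℕ) (k : ℕ), s ≤ r →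
          QCommute K (z (.inl i)) ((chain q r).coeff k) := by
        rintro (i | i) r k hr
        · exact (corner_qCommute q hn (by omega) (by omega) k).1
        · exact (corner_qCommute q hn (by omega) (by omega) k).2
      rintro (i | i | i) (j | j | j)
      · have hmem : ∀ i : Fin (s + 1) ⊕ Fin s, ∃ r ≤ s, z (.inl i) ∈
            ({cornerX q r, cornerY q r} : Set (QField fun _ : Fin n => q)) := by
          rintro (i | i)
          · exact ⟨i, by omega, .inl rfl⟩
          · exact ⟨i + 1, by omega, .inr rfl⟩
        obtain ⟨r, hr, hi⟩ := hmem i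
        obtain ⟨r', hr', hj⟩ := hmem j
        exact hcc r hr r' hr' _ hi _ hj
      · exact hcr _ _ _ le_rfl
      · exact hcr _ _ _ (by omega)
      · exact (hcr _ _ _ le_rfl).symm
      · exact .of_commute (chain_comm q (by omega) hn _ _)
      · exact hAB _ _
      · exact (hcr _ _ _ (by omega)).symm
      · exact (hAB _ _).symm
      · exact .of_commute (chain_comm q (by omega) hn _ _)
    have hX : ∀ r ≤ s, cornerX q r ∈ laurentAlgebra K z ∧ (cornerX q r)⁻¹ ∈ laurentAlgebra K z :=
      fun r hr => ⟨mem_laurentAlgebra z (.inl (.inl ⟨r, by omega⟩)),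
        inv_mem_laurentAlgebra z (.inl (.inl ⟨r, by omega⟩))⟩
    have hY : ∀ r < s, cornerY q (r + 1) ∈ laurentAlgebra K z ∧
        (cornerY q (r + 1))⁻¹ ∈ laurentAlgebra K z :=
      fun r hr => ⟨mem_laurentAlgebra z (.inl (.inr ⟨r, by omega⟩)),
        inv_mem_laurentAlgebra z (.inl (.inr ⟨r, by omega⟩))⟩
    have hY0 : cornerY (n := n) q 0 = 1 := by
      have := monic_rootPoly (K := K) (n := n)
      rw [Monic, leadingCoeff, natDegree_rootPoly] at this
      rw [cornerY, if_pos Even.zero, chain, basePoly_coeff, Nat.sub_zero, this, map_one]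
    have hYall : ∀ r ≤ s, cornerY q r ∈ laurentAlgebra K z := fun r hr => by
      cases r with
      | zero => rw [hY0]; exact one_mem _
      | succ r => exact (hY r (by omega)).1
    have h0 : ∀ k, (chain (n := n) q s).coeff k ∈ laurentAlgebra K z := by
      have hc : (chain (n := n) q s).coeff 0 ∈ laurentAlgebra K z ∧
          (chain (n := n) q s).coeff (n - s) ∈ laurentAlgebra K z := by
        have h1 := (hX s le_rfl).1
        have h2 := hYall s le_rfl
        rw [cornerX] at h1
        rw [cornerY] at h2
        split_ifs at h1 h2
        exacts [⟨h1, h2⟩, ⟨h2, h1⟩]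
      intro k
      obtain rfl | hk := Nat.eq_zero_or_pos k
      · exact hc.1
      obtain hk' | rfl | hk' := lt_trichotomy k (n - s)
      · have := mem_laurentAlgebra (K := K) z (.inr (.inl ⟨k - 1, by omega⟩))
        simpa only [z, Sum.elim_inr, Sum.elim_inl, Nat.sub_add_cancel hk] using this
      · exact hc.2
      · rw [chain_coeff_of_lt q (by omega) hn hk']
        exact zero_mem _
    have h1 : ∀ k, (chain (n := n) q (s + 1)).coeff k ∈ laurentAlgebra K z := by
      intro k
      obtain hk | hk := le_or_gt k m
      · exact mem_laurentAlgebra z (.inr (.inr ⟨k, by omega⟩))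
      · rw [chain_coeff_of_lt q (by omega) hn (by omega)]
        exact zero_mem _
    obtain ⟨g0, g1⟩ := chain_mem_of_corner_mem q (laurentAlgebra K z) (i := s) (by omega)
      (fun r hr => ⟨(hX r hr).1, hYall r hr⟩)
      (fun r hr hr' => by
        obtain ⟨r, rfl⟩ : ∃ r', r = r' + 1 := ⟨r - 1, by omega⟩
        exact ⟨(ih _ (by omega) (by omega)).1, (ih _ (by omega) (by omega)).2, (hX _ hr').2,
          (hY r (by omega)).2⟩) h0 h1
    obtain ⟨hint, hy⟩ := isIntegral_and_mem_of_chain_mem q g0 g1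
    obtain ⟨Q, hQ, hQ1, -, hxQ, hyQ⟩ := QRelations.exists_finite_generators _ hint hy
    have hli := linearIndependent_qMonomial_of_mul_mem hn
      (by simp only [ι, Fintype.card_sum, Fintype.card_fin]; omega) hz Q hQ1 hxQ hyQ
    have hzne : ∀ i, z i ≠ 0 := fun i => by
      rw [← qMonomial_single z i]
      exact hli.ne_zero _
    rcases hB with hB | hB
    · exact hzne (.inr (.inr ⟨0, by omega⟩)) hB
    · exact hzne (.inr (.inr ⟨m, by omega⟩)) hB

end QField
end Nonvanishing

/-! ### Invariants of the symmetric group -/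

noncomputable section Laurent

open Polynomial

/-- `a` and `a⁻¹` lie in `T`. -/
def InvMem {K F : Type*} [Field K] [DivisionRing F] [Algebra K F] (T : Subalgebra K F) (a : F) : Prop :=
  a ∈ T ∧ a⁻¹ ∈ T

namespace InvMem

variable {K F : Type*} [Field K] [DivisionRing F] [Algebra K F] {T : Subalgebra K F} {a b : F}

theorem inv (h : InvMem T a) : InvMem T a⁻¹ := ⟨h.2, by rw [inv_inv]; exact h.1⟩

theorem mul (h : InvMem T a) (h' : InvMem T b) : InvMem T (a * b) :=
  ⟨T.mul_mem h.1 h'.1, by rw [mul_inv_rev]; exact T.mul_mem h'.2 h.2⟩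

theorem zpow (h : InvMem T a) (k : ℤ) : InvMem T (a ^ k) := by
  have hp : ∀ {a : F}, InvMem T a → ∀ k : ℕ, InvMem T (a ^ k) := fun h k =>
    ⟨T.pow_mem h.1 k, by rw [← inv_pow]; exact T.pow_mem h.2 k⟩
  cases k with
  | ofNat k => simpa using hp h k
  | negSucc k => rw [zpow_negSucc]; exact (hp h _).inv

theorem of_upToUnit (h : InvMem T b) (hab : UpToUnit K a b) : InvMem T a := by
  obtain ⟨c, rfl⟩ := hab
  rw [Algebra.smul_def]
  exact mul ⟨T.algebraMap_mem _, by rw [← map_inv₀]; exact T.algebraMap_mem _⟩ h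

end InvMem

namespace QField

variable {K : Type*} [Field K] {n : ℕ} (q : Kˣ)

theorem bigX_ne_zero (hn : 0 < n) {i : ℕ} (hi : i ≤ n) : bigX (fun _ : Fin n => q) (i + 1) ≠ 0 :=
  (bigX_upToUnit q hn hi).ne_zero (corner_ne_zero q hn hi).1

theorem bigY_ne_zero (hn : 0 < n) {i : ℕ} (hi : i ≤ n) : bigY (fun _ : Fin n => q) i ≠ 0 :=
  (bigY_upToUnit q hn hi).ne_zero (corner_ne_zero q hn hi).2

/-- The elements `X_i`, `Y_i` are Laurent monomials in the `X̂_i`, `Ŷ_i`. -/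
theorem invMem_big (hn : 0 < n) {T : Subalgebra K (QField fun _ : Fin n => q)}
    (hX : ∀ i < n, InvMem T (hatX (fun _ : Fin n => q) (i + 1)))
    (hY : ∀ i < n, InvMem T (hatY (fun _ : Fin n => q) (i + 1))) :
    (∀ i < n, InvMem T (bigX (fun _ : Fin n => q) (i + 1))) ∧
      ∀ i ≤ n, InvMem T (bigY (fun _ : Fin n => q) i) := by
  have hbY : ∀ i ≤ n, InvMem T (bigY (fun _ : Fin n => q) i) := by
    intro i
    induction i using Nat.strong_induction_on with
    | _ i ih =>
      intro hi
      cases i with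
      | zero =>
        have : bigY (fun _ : Fin n => q) 0 = 1 := by simp [bigY, eRec, e]
        rw [this]
        exact ⟨T.one_mem, by rw [inv_one]; exact T.one_mem⟩
      | succ i =>
        have h1 : InvMem T ((bigY (fun _ : Fin n => q) (i - 1))⁻¹ *
            bigY (fun _ : Fin n => q) i ^ (-2 : ℤ)) :=
          (ih (i - 1) (by omega) (by omega)).inv.mul ((ih i (by omega) (by omega)).zpow _)
        have h2 := h1.inv.mul (hY i (by omega))
        rwa [hatY_succ, inv_mul_cancel_left₀] at h2
        exact mul_ne_zero (inv_ne_zero (bigY_ne_zero q hn (by omega)))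
          (zpow_ne_zero _ (bigY_ne_zero q hn (by omega)))
  refine ⟨fun i hi => ?_, hbY⟩
  have h := (((hbY i hi.le).zpow ((-1) ^ (i + 1))).inv.mul (hX i hi)).zpow ((-1) ^ i)
  rwa [hatX_succ, inv_mul_cancel_left₀ (zpow_ne_zero _ (bigY_ne_zero q hn hi.le)), ← zpow_mul,
    ← pow_add, (Even.add_self i).neg_one_pow, zpow_one] at h

/-- The elements `e_k` and `t_k` are Laurent polynomials in the `X̂_i`, `Ŷ_i`. -/
theorem chain_mem_of_hat_mem (hn : 0 < n) {T : Subalgebra K (QField fun _ : Fin n => q)}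
    (hX : ∀ i < n, InvMem T (hatX (fun _ : Fin n => q) (i + 1)))
    (hY : ∀ i < n, InvMem T (hatY (fun _ : Fin n => q) (i + 1))) :
    (∀ k, (chain q 0).coeff k ∈ T) ∧ ∀ k, (chain q 1).coeff k ∈ T := by
  obtain ⟨hbX, hbY⟩ := invMem_big q hn hX hY
  have hcX : ∀ i < n, InvMem T (cornerX q i) := fun i hi =>
    (hbX i hi).of_upToUnit (bigX_upToUnit q hn hi.le).symm
  have hcY : ∀ i ≤ n, InvMem T (cornerY q i) := fun i hi =>
    (hbY i hi).of_upToUnit (bigY_upToUnit q hn hi).symm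
  have hends : ∀ i < n, (chain q i).coeff 0 ∈ T ∧ (chain q i).coeff (n - i) ∈ T := by
    intro i hi
    have h1 := (hcX i hi).1
    have h2 := (hcY i hi.le).1
    rw [cornerX] at h1
    rw [cornerY] at h2
    split_ifs at h1 h2
    exacts [⟨h1, h2⟩, ⟨h2, h1⟩]
  refine chain_mem_of_corner_mem q T (i := n - 1) (by omega)
    (fun r hr => ⟨(hcX r (by omega)).1, (hcY r (by omega)).1⟩)
    (fun r hr hr' => ⟨(corner_ne_zero q hn (by omega)).1, (corner_ne_zero q hn (by omega)).2,
      (hcX r (by omega)).2, (hcY r (by omega)).2⟩) (fun k => ?_) (fun k => ?_)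
  -- The reconstruction starts from `P_{n-1}`, which has end coefficients only, and the constant `P_n`.
  · obtain rfl | rfl | hk : k = 0 ∨ k = n - (n - 1) ∨ n - (n - 1) < k := by omega
    · exact (hends _ (by omega)).1
    · exact (hends _ (by omega)).2
    · rw [chain_coeff_of_lt q (by omega) hn hk]
      exact T.zero_mem
  · rw [Nat.sub_add_cancel hn]
    obtain rfl | hk := Nat.eq_zero_or_pos k
    · have := (hcY n le_rfl).1
      rw [cornerY, Nat.sub_self, ite_self] at this
      exact this
    · rw [chain_coeff_of_lt q le_rfl hn (by omega)]
      exact T.zero_mem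

end QField
end Laurent

noncomputable section SymmetricGroup

open Polynomial

/-- An embedding with image `D` as an isomorphism onto `D`. -/
def algEquivOfRange {K E F : Type*} [Field K] [DivisionRing E] [Algebra K E] [DivisionRing F] [Algebra K F]
    (φ : E →ₐ[K] F) {D : Subalgebra K F} (h : φ.range = D) : E ≃ₐ[K] D :=
  (AlgEquiv.ofInjective φ φ.toRingHom.injective).trans (Subalgebra.equivOfEq _ _ h)

namespace QField

variable {K : Type*} [Field K] {n : ℕ} (q : Kˣ)

/-- The automorphism of `F_{q,n}` given by an element of `W(B_n)`. -/
def weylAut (q : Kˣ) (w : WeylB n) : (QField fun _ : Fin n => q) →ₐ[K] QField fun _ : Fin n => q :=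
  (SkewFrac.map (weylAction n q w)).toAlgHom

theorem weylAut_x (w : WeylB n) (i : Fin n) : weylAut q w (x _ i) =
    ((w.left (w.right i) : ℤ) : K) • x _ (w.right i) := by
  rw [x, x, ← map_smul]
  refine (SkewFrac.map_of _ _).trans (congrArg _ ?_)
  exact QAffine.lift_x ..

theorem weylAut_y (w : WeylB n) (i : Fin n) : weylAut q w (y _ i) =
    ((w.left (w.right i) : ℤ) : K) • y _ (w.right i) := by
  rw [y, y, ← map_smul]
  refine (SkewFrac.map_of _ _).trans (congrArg _ ?_)
  exact QAffine.lift_y ..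

theorem weylAut_mul (v w : WeylB n) (a : QField fun _ : Fin n => q) :
    weylAut q (v * w) a = weylAut q v (weylAut q w a) := by
  simp only [weylAut, map_mul]
  rfl

theorem mem_weylInvariants {T : ClassicalType} {a : QField fun _ : Fin n => q} :
    a ∈ weylInvariants T n q ↔ ∀ w ∈ weylGroup n T, weylAut q w a = a := Iff.rfl

theorem inv_mem_weylInvariants {T : ClassicalType} (a : QField fun _ : Fin n => q)
    (h : a ∈ weylInvariants T n q) : a⁻¹ ∈ weylInvariants T n q := by
  rw [mem_weylInvariants] at h ⊢
  intro w hw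
  rw [map_inv₀, h w hw]

/-- The automorphism of `F_{q,n}` given by a permutation. -/
def permAut (q : Kˣ) (σ : Equiv.Perm (Fin n)) :
    (QField fun _ : Fin n => q) →ₐ[K] QField fun _ : Fin n => q :=
  weylAut q (SemidirectProduct.inr σ)

@[simp] theorem permAut_x (σ : Equiv.Perm (Fin n)) (i : Fin n) :
    permAut q σ (x _ i) = x _ (σ i) := by
  rw [permAut, weylAut_x]; simp

@[simp] theorem permAut_y (σ : Equiv.Perm (Fin n)) (i : Fin n) :
    permAut q σ (y _ i) = y _ (σ i) := by
  rw [permAut, weylAut_y]; simp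

theorem permAut_poly (σ : Equiv.Perm (Fin n)) (f : MvPolynomial (Fin n) K) :
    permAut q σ (poly _ f) = poly _ (MvPolynomial.rename σ f) := by
  have : (permAut q σ).comp (poly _) = (poly _).comp (MvPolynomial.rename σ) :=
    MvPolynomial.algHom_ext fun i => by simp [poly_X]
  exact DFunLike.congr_fun this f

theorem mem_weylInvariants_A {a : QField fun _ : Fin n => q} :
    a ∈ weylInvariants .A n q ↔ ∀ σ, permAut q σ a = a := by
  rw [mem_weylInvariants]
  constructor
  · exact fun h σ => h _ ⟨σ, rfl⟩
  · rintro h _ ⟨σ, rfl⟩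
    exact h σ

theorem poly_mem_weylInvariants_A {f : MvPolynomial (Fin n) K} (hf : f.IsSymmetric) :
    poly _ f ∈ weylInvariants .A n q := by
  rw [mem_weylInvariants_A]
  intro σ
  rw [permAut_poly, hf σ]

/-- The `t_i` are invariant, being determined by the values `y_j` of `T` at `x_j`. -/
theorem t_mem_weylInvariants_A {i : ℕ} (hi : i < n) :
    t (fun _ : Fin n => q) (i + 1) ∈ weylInvariants .A n q := by
  rw [mem_weylInvariants_A]
  intro σ
  have h := eq_zero_of_vandermonde (fun _ : Fin n => q) (s := fun i =>
    permAut q σ (t (fun _ : Fin n => q) (i + 1)) - t (fun _ : Fin n => q) (i + 1)) fun j => by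
      simp only [mul_sub, Finset.sum_sub_distrib]
      rw [← y_eq_sum, sub_eq_zero]
      have := congrArg (permAut q σ) (y_eq_sum (fun _ : Fin n => q) (σ⁻¹ j))
      simp only [map_sum, map_mul, map_pow, permAut_x, permAut_y] at this
      simpa using this.symm
  exact sub_eq_zero.1 (congrFun h ⟨i, hi⟩)

theorem eRec_mem_weylInvariants_A (i : ℕ) (hi : i ≤ n) (k : ℕ) (hk : k ≤ n - i) (hn : 0 < n) :
    eRec (fun _ : Fin n => q) i k ∈ weylInvariants .A n q := by
  induction i using Nat.strong_induction_on generalizing k with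
  | _ i ih =>
    match i, hi, hk, ih with
    | 0, _, _, _ => exact poly_mem_weylInvariants_A q (MvPolynomial.esymm_isSymmetric _ _ _)
    | 1, _, hk, _ => exact t_mem_weylInvariants_A q (by omega)
    | i + 2, hi, hk, ih =>
      have h0 := fun k hk => ih i (by omega) (by omega) k hk
      have h1 := fun k hk => ih (i + 1) (by omega) (by omega) k hk
      have hs : ∀ k : ℕ, ((-1) ^ k : QField fun _ : Fin n => q) ∈ weylInvariants .A n q := fun k =>
        pow_mem (neg_mem (one_mem _)) k
      rw [eRec]
      exact sub_mem (sub_mem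
        (mul_mem (mul_mem (h0 _ (by omega)) (h1 _ (by omega))) (h1 _ (by omega)))
        (mul_mem (mul_mem (mul_mem (hs _) (h0 _ (by omega))) (h1 _ (by omega))) (h1 _ (by omega))))
        (mul_mem (mul_mem (mul_mem (hs _) (h0 _ (by omega))) (h1 _ (by omega))) (h1 _ (by omega)))

theorem zpow_mem_weylInvariants {T : ClassicalType} {a : QField fun _ : Fin n => q}
    (h : a ∈ weylInvariants T n q) (k : ℤ) : a ^ k ∈ weylInvariants T n q :=
  (InvMem.zpow ⟨h, inv_mem_weylInvariants q a h⟩ k).1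

theorem hat_mem_weylInvariants_A (hn : 0 < n) {i : ℕ} (hi : i < n) :
    hatX (fun _ : Fin n => q) (i + 1) ∈ weylInvariants .A n q ∧
      hatY (fun _ : Fin n => q) (i + 1) ∈ weylInvariants .A n q := by
  have hY : ∀ i ≤ n, bigY (fun _ : Fin n => q) i ∈ weylInvariants .A n q := fun i hi =>
    eRec_mem_weylInvariants_A q i hi 0 (by omega) hn
  have hX : bigX (fun _ : Fin n => q) (i + 1) ∈ weylInvariants .A n q :=
    eRec_mem_weylInvariants_A q i (by omega) (n - i) le_rfl hn
  rw [hatX_succ, hatY_succ]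
  exact ⟨mul_mem (zpow_mem_weylInvariants q (hY _ hi.le) _) (zpow_mem_weylInvariants q hX _),
    mul_mem (mul_mem (inv_mem_weylInvariants q _ (hY _ (by omega)))
      (zpow_mem_weylInvariants q (hY _ hi.le) _)) (hY _ hi)⟩

/-- A subalgebra containing the `e_k` contains all symmetric polynomials. -/
theorem poly_mem_of_isSymmetric {T : Subalgebra K (QField fun _ : Fin n => q)}
    (h0 : ∀ k, (chain q 0).coeff k ∈ T) {f : MvPolynomial (Fin n) K} (hf : f.IsSymmetric) :
    poly _ f ∈ T := by
  have he : ∀ k ≤ n, poly _ (MvPolynomial.esymm (Fin n) K k) ∈ T := by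
    intro k hk
    have h := T.mul_mem (T.pow_mem (neg_mem T.one_mem) k) (h0 (n - k))
    rw [chain, basePoly_coeff, rootPoly_coeff (Nat.sub_le _ _), Nat.sub_sub_self hk, map_mul,
      map_pow, map_neg, map_one, ← mul_assoc, ← pow_add, (Even.add_self k).neg_one_pow,
      one_mul] at h
    exact h
  obtain ⟨p, hp⟩ := MvPolynomial.esymmAlgHom_surjective (R := K) (σ := Fin n) (n := n) (by simp) ⟨f, hf⟩
  have hp' := congrArg Subtype.val hp
  rw [MvPolynomial.esymmAlgHom_apply] at hp'
  change _ = f at hp'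
  rw [← hp']
  have hle : (MvPolynomial.aeval (R := K) fun i : Fin n => MvPolynomial.esymm (Fin n) K (i + 1)).range ≤
      T.comap (poly fun _ : Fin n => q) := by
    rw [← Algebra.adjoin_range_eq_range_aeval, Algebra.adjoin_le_iff]
    rintro _ ⟨i, rfl⟩
    exact he _ i.2
  exact hle ⟨p, rfl⟩

/-- The isomorphism `x_k ↦ X̂_k`, `y_k ↦ Ŷ_k` of `F_{q,n}` with its `S_n`-invariants. -/
theorem exists_algHom_range_eq_weylInvariants_A [CharZero K] (hn : 0 < n) :
    ∃ φ : (QField fun _ : Fin n => q) →ₐ[K] QField fun _ : Fin n => q,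
      φ.range = weylInvariants .A n q ∧
      (∀ i : Fin n, φ (x _ i) = hatX _ (i + 1)) ∧ ∀ i : Fin n, φ (y _ i) = hatY _ (i + 1) := by
  have hrel := qRelations_hat (n := n) q hn
  obtain ⟨h0, h1⟩ := chain_mem_of_hat_mem q hn
    (T := QRelations.laurent (fun i : Fin n => hatX (fun _ : Fin n => q) (i + 1))
      (fun i : Fin n => hatY (fun _ : Fin n => q) (i + 1)))
    (fun i hi => ⟨mem_laurentAlgebra (Sum.elim _ _) (Sum.inl (⟨i, hi⟩ : Fin n)),
      inv_mem_laurentAlgebra (Sum.elim _ _) (Sum.inl (⟨i, hi⟩ : Fin n))⟩)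
    (fun i hi => ⟨mem_laurentAlgebra (Sum.elim _ _) (Sum.inr (⟨i, hi⟩ : Fin n)),
      inv_mem_laurentAlgebra (Sum.elim _ _) (Sum.inr (⟨i, hi⟩ : Fin n))⟩)
  obtain ⟨hint, hy⟩ := isIntegral_and_mem_of_chain_mem q h0 h1
  obtain ⟨φ, hφx, hφy, hφ⟩ := hrel.exists_algHom hn hint hy
  have hinv : ∀ a, φ a ∈ weylInvariants .A n q := fun a =>
    mem_of_gen_mem (inv_mem_weylInvariants q)
      (fun i => by rw [hφx]; exact (hat_mem_weylInvariants_A q hn i.2).1)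
      (fun i => by rw [hφy]; exact (hat_mem_weylInvariants_A q hn i.2).2) a
  refine ⟨φ, le_antisymm ?_ fun w hw => ?_, hφx, hφy⟩
  · rintro _ ⟨a, rfl⟩
    exact hinv a
  · refine mem_of_forall_fixed (permAut q) φ.range ?_ (fun p => ?_) hφ
      ((mem_weylInvariants_A q).1 hw)
    · rintro σ _ ⟨a, rfl⟩
      exact (mem_weylInvariants_A q).1 (hinv a) σ
    · simp only [permAut_poly, ← map_sum]
      refine poly_mem_of_isSymmetric q (chain_mem_of_hat_mem q hn (fun i hi => ?_)
        fun i hi => ?_).1 fun τ => ?_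
      · have : hatX (fun _ : Fin n => q) (i + 1) ∈ φ.range := ⟨_, hφx ⟨i, hi⟩⟩
        exact ⟨this, SkewFrac.inv_mem_range φ _ this⟩
      · have : hatY (fun _ : Fin n => q) (i + 1) ∈ φ.range := ⟨_, hφy ⟨i, hi⟩⟩
        exact ⟨this, SkewFrac.inv_mem_range φ _ this⟩
      · rw [map_sum]
        simp only [MvPolynomial.rename_rename, ← Equiv.Perm.coe_mul]
        exact Equiv.sum_comp (Equiv.mulLeft τ) fun σ : Equiv.Perm (Fin n) => MvPolynomial.rename σ p

end QField
end SymmetricGroup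

/-! ### Sign changes and the groups `W(B_n)`, `W(D_n)` -/

noncomputable section SignGroup

namespace QField

variable {K : Type*} [Field K] {n : ℕ} (q : Kˣ)

theorem y_skewComm_x (i j : Fin n) :
    SkewComm (if i = j then q else 1) (y (fun _ : Fin n => q) i) (x _ j) := by
  rw [SkewComm, y_mul_x]
  split_ifs <;> simp

theorem weylAut_poly (w : WeylB n) (f : MvPolynomial (Fin n) K) :
    weylAut q w (poly _ f) = poly _ (MvPolynomial.aeval
      (fun i => ((w.left (w.right i) : ℤ) : K) • MvPolynomial.X (w.right i)) f) := by
  have : (weylAut q w).comp (poly _) = (poly _).comp (MvPolynomial.aeval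
      (fun i => ((w.left (w.right i) : ℤ) : K) • MvPolynomial.X (w.right i))) :=
    MvPolynomial.algHom_ext fun i => by simp [poly_X, weylAut_x]
  exact DFunLike.congr_fun this f

/-- The automorphism of `F_{q,n}` given by changes of signs. -/
def signAut (q : Kˣ) (ε : Fin n → ℤˣ) :
    (QField fun _ : Fin n => q) →ₐ[K] QField fun _ : Fin n => q :=
  weylAut q (SemidirectProduct.inl ε)

theorem signAut_monomial (ε : Fin n → ℤˣ) (s : Fin n →₀ ℕ) (c : K) :
    signAut q ε (poly _ (MvPolynomial.monomial s c)) =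
      (∏ i, (((ε i : ℤ) : K)) ^ s i) • poly _ (MvPolynomial.monomial s c) := by
  rw [signAut, weylAut_poly, ← map_smul]
  congr 1
  rw [MvPolynomial.aeval_monomial, MvPolynomial.monomial_eq,
    Finsupp.prod_fintype _ _ (by simp), Finsupp.prod_fintype _ _ (by simp)]
  simp only [MvPolynomial.smul_eq_C_mul, mul_pow, Finset.prod_mul_distrib, map_prod, map_pow,
    SemidirectProduct.left_inl, SemidirectProduct.right_inl, MvPolynomial.algebraMap_eq]
  exact mul_left_comm _ _ _

/-- The average over the sign changes kills the monomials with an odd exponent. -/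
theorem sum_sign_monomial (s : Fin n →₀ ℕ) {i : Fin n} (hi : Odd (s i)) :
    ∑ ε : Fin n → ℤˣ, ∏ j, (((ε j : ℤ) : K)) ^ s j = 0 := by
  have h := Finset.prod_univ_sum (fun _ : Fin n => (Finset.univ : Finset ℤˣ))
    fun j u => (((u : ℤ) : K)) ^ s j
  rw [Fintype.piFinset_univ] at h
  rw [← h, Finset.prod_eq_zero (Finset.mem_univ i)]
  simp [Finset.univ, Fintype.elems, hi.neg_one_pow]

/-- `x_i²` and `x_i⁻¹ y_i` satisfy the relations of the generators with parameter `q²`. -/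
theorem qRelations_sq : QRelations (fun _ : Fin n => q ^ 2) (fun i => x (fun _ : Fin n => q) i ^ 2)
    (fun i => (x (fun _ : Fin n => q) i)⁻¹ * y _ i) := by
  have hxx : ∀ i j, SkewComm (1 : Kˣ) (x (fun _ : Fin n => q) i) (x _ j) := fun i j =>
    SkewComm.one_iff.2 (x_mul_x i j)
  have hyy : ∀ i j, SkewComm (1 : Kˣ) (y (fun _ : Fin n => q) i) (y _ j) := fun i j =>
    SkewComm.one_iff.2 (y_mul_y i j)
  refine ⟨fun i j => ?_, fun i j => ?_, fun i j => ?_⟩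
  · exact ((show Commute _ _ from x_mul_x i j).pow_pow 2 2).eq
  · obtain rfl | hij := eq_or_ne i j
    · rfl
    have h1 := y_skewComm_x q i j
    have h2 := y_skewComm_x q j i
    rw [if_neg hij] at h1
    rw [if_neg hij.symm] at h2
    have h3 := ((hxx i j).inv_right.mul_right h2.symm).symm.inv_right.symm
    have h4 := h3.mul_left (h1.inv_right.mul_right (hyy i j))
    exact (SkewComm.one_iff (K := K)).1 (by simpa using h4)
  · have h := ((((hxx j i).inv_right.symm).mul_left (y_skewComm_x q i j)).pow_right 2)
    rw [SkewComm] at h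
    rw [h]
    split_ifs <;> simp

theorem isIntegral_comap_poly {q : Fin n → Kˣ} {T : Subalgebra K (QField q)}
    {f : MvPolynomial (Fin n) K} (hf : poly q f ∈ T) : IsIntegral (T.comap (poly q)) f :=
  isIntegral_algebraMap (R := T.comap (poly q)) (x := ⟨f, hf⟩)

/-- The embedding `F_{q²,n} → F_{q,n}` with `x_i ↦ x_i²`, `y_i ↦ x_i⁻¹ y_i`. Its image consists of the
invariants of the sign changes. -/
theorem exists_algHom_sq [CharZero K] (hn : 0 < n) :
    ∃ ψ : (QField fun _ : Fin n => q ^ 2) →ₐ[K] QField fun _ : Fin n => q,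
      (∀ i, ψ (x _ i) = x _ i ^ 2) ∧ (∀ i, ψ (y _ i) = (x _ i)⁻¹ * y _ i) ∧
      ∀ a, a ∈ ψ.range ↔ ∀ ε, signAut q ε a = a := by
  have hx : ∀ i, x (fun _ : Fin n => q) i ^ 2 ∈ QRelations.laurent
      (fun i => x (fun _ : Fin n => q) i ^ 2) (fun i => (x (fun _ : Fin n => q) i)⁻¹ * y _ i) :=
    fun i => mem_laurentAlgebra (Sum.elim _ _) (Sum.inl i)
  have hy : ∀ i, (x (fun _ : Fin n => q) i)⁻¹ * y (fun _ : Fin n => q) i ∈ QRelations.laurent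
      (fun i => x (fun _ : Fin n => q) i ^ 2) (fun i => (x (fun _ : Fin n => q) i)⁻¹ * y _ i) :=
    fun i => mem_laurentAlgebra (Sum.elim _ _) (Sum.inr i)
  obtain ⟨ψ, hψx, hψy, hψ⟩ := (qRelations_sq (n := n) q).exists_algHom hn
    (fun i => by
      refine IsIntegral.of_pow (n := 2) two_pos ?_
      refine isIntegral_comap_poly ?_
      rw [map_pow, poly_X]
      exact hx i)
    (fun i => by
      rw [← mul_inv_cancel_left₀ (x_ne_zero (q := fun _ : Fin n => q) i) (y _ i)]
      exact Submodule.mul_mem_mul ⟨MvPolynomial.X i, poly_X _ i⟩ (hy i))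
  have hψfix : ∀ ε a, signAut q ε (ψ a) = ψ a := by
    intro ε a
    have : (signAut q ε).comp ψ = ψ := by
      refine algHom_ext (fun i => ?_) fun i => ?_
      · rw [AlgHom.comp_apply, hψx, map_pow, signAut, weylAut_x, smul_pow]
        rcases Int.units_eq_one_or (ε i) with h | h <;> simp [h]
      · rw [AlgHom.comp_apply, hψy, map_mul, map_inv₀, signAut, weylAut_x, weylAut_y]
        rcases Int.units_eq_one_or (ε i) with h | h <;> simp [h]
    exact DFunLike.congr_fun this a
  refine ⟨ψ, hψx, hψy, fun a => ⟨?_, fun ha => ?_⟩⟩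
  · rintro ⟨a, rfl⟩ ε
    exact hψfix ε a
  refine mem_of_forall_fixed (signAut q) ψ.range ?_ (fun p => ?_) hψ ha
  · rintro ε _ ⟨a, rfl⟩
    exact hψfix ε a
  · induction p using MvPolynomial.induction_on' with
    | add p p' hp hp' =>
      simp only [map_add, Finset.sum_add_distrib]
      exact add_mem hp hp'
    | monomial s c =>
      simp only [signAut_monomial, ← Finset.sum_smul]
      by_cases hs : ∀ i, Even (s i)
      · refine Subalgebra.smul_mem _ ?_ _
        choose r hr using hs
        have hpoly : ψ.comp (poly _) = (poly _).comp (MvPolynomial.expand 2) :=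
          MvPolynomial.algHom_ext fun i => by simp [poly_X, hψx]
        refine ⟨poly _ (MvPolynomial.monomial (Finsupp.equivFunOnFinite.symm r) c), ?_⟩
        refine (DFunLike.congr_fun hpoly _).trans ?_
        rw [AlgHom.comp_apply, MvPolynomial.expand_monomial]
        rw [show 2 • Finsupp.equivFunOnFinite.symm r = s by ext i; simp [hr, two_mul]]
      · obtain ⟨i, hi⟩ := not_forall.1 hs
        rw [sum_sign_monomial s (Nat.not_even_iff_odd.1 hi), zero_smul]
        exact zero_mem _

/-- The embedding `F_{q²,n} → F_{q,n}` is compatible with permutations. -/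
theorem comp_permAut_eq {ψ : (QField fun _ : Fin n => q ^ 2) →ₐ[K] QField fun _ : Fin n => q}
    (hψx : ∀ i, ψ (x _ i) = x _ i ^ 2) (hψy : ∀ i, ψ (y _ i) = (x _ i)⁻¹ * y _ i)
    (σ : Equiv.Perm (Fin n)) (a : QField fun _ : Fin n => q ^ 2) :
    permAut q σ (ψ a) = ψ (permAut (q ^ 2) σ a) := by
  have : (permAut q σ).comp ψ = ψ.comp (permAut (q ^ 2) σ) :=
    algHom_ext (fun i => by simp [hψx]) fun i => by simp [hψy]
  exact DFunLike.congr_fun this a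

/-- The invariants of `W(B_n)` are the image of the `S_n`-invariants of `F_{q²,n}`. -/
theorem mem_weylInvariants_B_iff
    {ψ : (QField fun _ : Fin n => q ^ 2) →ₐ[K] QField fun _ : Fin n => q}
    (hψx : ∀ i, ψ (x _ i) = x _ i ^ 2) (hψy : ∀ i, ψ (y _ i) = (x _ i)⁻¹ * y _ i)
    (hψ : ∀ a, a ∈ ψ.range ↔ ∀ ε, signAut q ε a = a) (a : QField fun _ : Fin n => q) :
    a ∈ weylInvariants .B n q ↔ ∃ b ∈ weylInvariants .A n (q ^ 2), ψ b = a := by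
  constructor
  · intro ha
    rw [mem_weylInvariants] at ha
    obtain ⟨b, rfl⟩ := (hψ a).2 fun ε => ha _ trivial
    refine ⟨b, (mem_weylInvariants_A _).2 fun σ => ?_, rfl⟩
    have : ψ (permAut (q ^ 2) σ b) = ψ b := by
      rw [← comp_permAut_eq q hψx hψy]
      exact ha _ trivial
    exact ψ.toRingHom.injective this
  · rintro ⟨b, hb, rfl⟩
    rw [mem_weylInvariants]
    intro w _
    rw [← SemidirectProduct.inl_left_mul_inr_right w, weylAut_mul]
    change signAut q _ (permAut q _ _) = _
    rw [comp_permAut_eq q hψx hψy, (mem_weylInvariants_A _).1 hb]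
    exact (hψ _).1 ⟨b, rfl⟩ _

end QField
end SignGroup

noncomputable section EvenSignGroup

namespace QField

variable {K : Type*} [Field K] {n : ℕ} (q : Kˣ)

/-- The sign character of `W(B_n)` with kernel `W(D_n)`. -/
def weylSign (w : WeylB n) : ℤˣ := ∏ i, w.left i

theorem weylSign_mul (v w : WeylB n) : weylSign (v * w) = weylSign v * weylSign w := by
  simp only [weylSign, SemidirectProduct.mul_left, Pi.mul_apply, Finset.prod_mul_distrib]
  congr 1
  exact Equiv.prod_comp v.right⁻¹ w.left

/-- The product `x_1 ⋯ x_n`. -/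
def prodX (q : Kˣ) : QField fun _ : Fin n => q := poly _ (∏ i, MvPolynomial.X i)

theorem prodX_ne_zero : prodX (n := n) q ≠ 0 := by
  rw [prodX, map_ne_zero_iff _ (poly_injective _), Finset.prod_ne_zero_iff]
  simp

theorem weylAut_prodX (w : WeylB n) :
    weylAut q w (prodX q) = ((weylSign w : ℤ) : K) • prodX q := by
  rw [prodX, weylAut_poly, ← map_smul]
  congr 1
  rw [map_prod]
  simp only [MvPolynomial.aeval_X, MvPolynomial.smul_eq_C_mul, Finset.prod_mul_distrib]
  rw [Equiv.prod_comp w.right fun i => (MvPolynomial.X i : MvPolynomial (Fin n) K),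
    Equiv.prod_comp w.right fun i => (MvPolynomial.C ((w.left i : ℤ) : K) : MvPolynomial (Fin n) K),
    ← map_prod, weylSign]
  simp

theorem prodX_skewComm_y (i : Fin n) : SkewComm q⁻¹ (prodX q) (y (fun _ : Fin n => q) i) := by
  have hk : ∀ s : Finset (Fin n), SkewComm (∏ k ∈ s, if i = k then q else 1)
      (y (fun _ : Fin n => q) i) (poly _ (∏ k ∈ s, MvPolynomial.X k)) := by
    intro s
    induction s using Finset.induction_on with
    | empty => simpa using SkewComm.one_right (K := K) _
    | insert k s hk ih =>
      rw [Finset.prod_insert hk, Finset.prod_insert hk, map_mul, poly_X]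
      exact (y_skewComm_x q i k).mul_right ih
  simpa [prodX] using (hk Finset.univ).symm

theorem hatX_one : hatX (fun _ : Fin n => q) 1 = prodX q := by
  have : MvPolynomial.esymm (Fin n) K n = ∏ i, MvPolynomial.X i := by
    have h := Finset.powersetCard_self (Finset.univ : Finset (Fin n))
    rw [Finset.card_fin] at h
    rw [MvPolynomial.esymm, h, Finset.sum_singleton]
  simp [hatX, bigX, eRec, e, this, prodX]

/-- `F^{W(D_n)} = F^{W(B_n)} + x_1 ⋯ x_n F^{W(B_n)}`: an element odd under the sign change `τ` of one
variable is the product of `x_1 ⋯ x_n` and an invariant. -/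
theorem exists_add_prodX_mul [CharZero K] (hn : 0 < n) {a : QField fun _ : Fin n => q}
    (ha : a ∈ weylInvariants .D n q) :
    ∃ b ∈ weylInvariants .B n q, ∃ c ∈ weylInvariants .B n q, a = b + prodX q * c := by
  rw [mem_weylInvariants] at ha
  replace ha : ∀ w : WeylB n, weylSign w = 1 → weylAut q w a = a := fun w hw => ha w hw
  let τ : WeylB n := SemidirectProduct.inl (Function.update 1 ⟨0, hn⟩ (-1))
  have hτ : weylSign τ = -1 := by
    simp [weylSign, τ, Finset.prod_update_of_mem]
  have hττ : τ * τ = 1 := by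
    rw [← map_mul, ← map_one SemidirectProduct.inl]
    congr 1
    funext i
    obtain rfl | hi := eq_or_ne i ⟨0, hn⟩
    · simp
    · simp [hi]
  have hodd : ∀ w : WeylB n, weylSign w = -1 → weylAut q w a = weylAut q τ a := by
    intro w hw
    rw [← one_mul w, ← hττ, mul_assoc, weylAut_mul,
      ha (τ * w) (by rw [weylSign_mul, hτ, hw]; simp)]
  have hcomp : ∀ w : WeylB n, weylAut q w (weylAut q τ a) = weylAut q (w * τ) a := fun w =>
    (weylAut_mul q w τ a).symm
  -- `p` is the even part of `2 a` under `τ`, and `m` the odd part.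
  set p := a + weylAut q τ a with hp
  set m := a - weylAut q τ a with hm
  have hpfix : p ∈ weylInvariants .B n q := by
    rw [mem_weylInvariants]
    intro w _
    rcases Int.units_eq_one_or (weylSign w) with hw | hw
    · rw [hp, map_add, hcomp, ha w hw, hodd (w * τ) (by rw [weylSign_mul, hτ, hw]; simp)]
    · rw [hp, map_add, hcomp, hodd w hw, ha (w * τ) (by rw [weylSign_mul, hτ, hw]; simp), add_comm]
  have hmfix : (prodX q)⁻¹ * m ∈ weylInvariants .B n q := by
    rw [mem_weylInvariants]
    intro w _
    rw [map_mul, map_inv₀, weylAut_prodX]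
    rcases Int.units_eq_one_or (weylSign w) with hw | hw
    · rw [hm, map_sub, hcomp, ha w hw, hodd (w * τ) (by rw [weylSign_mul, hτ, hw]; simp), hw]
      simp
    · rw [hm, map_sub, hcomp, hodd w hw, ha (w * τ) (by rw [weylSign_mul, hτ, hw]; simp), hw]
      simp [mul_sub]
      abel
  refine ⟨(2⁻¹ : K) • p, Subalgebra.smul_mem _ hpfix _, (2⁻¹ : K) • ((prodX q)⁻¹ * m),
    Subalgebra.smul_mem _ hmfix _, ?_⟩
  rw [mul_smul_comm, mul_inv_cancel_left₀ (prodX_ne_zero q), ← smul_add, hp, hm,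
    show a + weylAut q τ a + (a - weylAut q τ a) = (2 : K) • a by rw [two_smul]; abel, smul_smul]
  simp

/-- The isomorphism of `F_{q̄,n}`, for `q̄ = (q, q², …, q²)`, with the `W(D_n)`-invariants: in the
isomorphism for `W(B_n)` the image `(x_1 ⋯ x_n)²` of `x_1` is replaced by `x_1 ⋯ x_n`. -/
theorem exists_algHom_range_eq_weylInvariants_D [CharZero K] (hn : 0 < n) :
    ∃ φ : QField (weylParam n q .D) →ₐ[K] QField fun _ : Fin n => q,
      φ.range = weylInvariants .D n q := by
  obtain ⟨ψ, hψx, hψy, hψ⟩ := exists_algHom_sq (n := n) q hn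
  obtain ⟨φ, hφ, hφx, hφy⟩ := exists_algHom_range_eq_weylInvariants_A (n := n) (q ^ 2) hn
  have hhat := qRelations_hat (n := n) (q ^ 2) hn
  have hψpoly : ∀ f, ψ (poly _ f) = poly _ (MvPolynomial.expand 2 f) := by
    have : ψ.comp (poly _) = (poly _).comp (MvPolynomial.expand 2) :=
      MvPolynomial.algHom_ext fun i => by simp [poly_X, hψx]
    exact DFunLike.congr_fun this
  have hz0 : ∀ j, SkewComm (1 : Kˣ) (prodX q) (ψ ((chain (n := n) (q ^ 2) 0).coeff j)) := fun j => by
    rw [chain, basePoly_coeff, hψpoly, SkewComm.one_iff, prodX, poly_mul_poly]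
  -- `x_1 ⋯ x_n` commutes with the image of `P_0` and commutes up to `q⁻¹` with that of `P_1`.
  have hz1 : ∀ j, SkewComm q⁻¹ (prodX q) (ψ ((chain (n := n) (q ^ 2) (0 + 1)).coeff j)) := fun j => by
    rw [chain, interpPoly_coeff_eq_sum, map_sum]
    refine Finset.sum_induction _ (SkewComm q⁻¹ (prodX q)) (fun _ _ => SkewComm.add_right)
      (SkewComm.zero_right _ _) fun k _ => ?_
    have hc : ∀ f, SkewComm (1 : Kˣ) (prodX q) (poly (fun _ : Fin n => q) f) := fun f => by
      rw [SkewComm.one_iff, prodX, poly_mul_poly]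
    rw [map_mul, map_mul, map_inv₀, denom, hψpoly, hψpoly, hψy, ← poly_X]
    simpa using (hc _).mul_right ((hc _).inv_right.mul_right
      ((hc _).inv_right.mul_right (prodX_skewComm_y q k)))
  let a : Fin n → QField fun _ : Fin n => q := fun i =>
    if (i : ℕ) = 0 then prodX q else ψ (hatX _ (i + 1))
  let b : Fin n → QField fun _ : Fin n => q := fun i => ψ (hatY _ (i + 1))
  have ha0 : ∀ i : Fin n, (i : ℕ) = 0 → a i = prodX q := fun i hi => if_pos hi
  have ha1 : ∀ i : Fin n, (i : ℕ) ≠ 0 → a i = ψ (hatX _ (i + 1)) := fun i hi => if_neg hi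
  have hrel : QRelations (weylParam n q .D) a b := by
    refine ⟨fun i j => ?_, fun i j => ?_, fun i j => ?_⟩
    · by_cases hi : (i : ℕ) = 0 <;> by_cases hj : (j : ℕ) = 0
      · rw [ha0 i hi, ha0 j hj]
      · rw [ha0 i hi, ha1 j hj]
        exact SkewComm.one_iff.1 ((comm_hat _ ψ hn hz0 hz1 j.2).1 (Nat.zero_le _))
      · rw [ha1 i hi, ha0 j hj]
        exact (SkewComm.one_iff.1 ((comm_hat _ ψ hn hz0 hz1 i.2).1 (Nat.zero_le _))).symm
      · rw [ha1 i hi, ha1 j hj, ← map_mul, hhat.aa, map_mul]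
    · rw [← map_mul, hhat.bb, map_mul]
    · by_cases hj : (j : ℕ) = 0
      · rw [ha0 j hj]
        by_cases hi : (i : ℕ) = 0
        · have h := skewComm_bigY _ ψ hn (show 0 + 1 ≤ n from hn) hz1
          have hY : hatY (fun _ : Fin n => q ^ 2) (i + 1) = bigY (fun _ : Fin n => q ^ 2) (0 + 1) := by
            rw [hi, hatY, if_pos rfl]
          rw [if_pos (Fin.ext (hi.trans hj.symm)), weylParam, if_pos hi]
          simp only [b, hY]
          simpa [SkewComm] using h.symm
        · have hij : i ≠ j := fun h => hi (h ▸ hj)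
          rw [if_neg hij, one_smul]
          exact (SkewComm.one_iff.1 ((comm_hat _ ψ hn hz0 hz1 i.2).2 (Nat.pos_of_ne_zero hi))).symm
      · rw [ha1 j hj, ← map_mul, hhat.ba, map_smul, map_mul]
        split_ifs with hij
        · rw [weylParam, if_neg (hij ▸ hj)]
        · rfl
  set T := QRelations.laurent a b with hT
  have haT : ∀ i, InvMem T (a i) := fun i =>
    ⟨mem_laurentAlgebra (Sum.elim a b) (.inl i), inv_mem_laurentAlgebra (Sum.elim a b) (.inl i)⟩
  have hbT : ∀ i, InvMem T (b i) := fun i =>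
    ⟨mem_laurentAlgebra (Sum.elim a b) (.inr i), inv_mem_laurentAlgebra (Sum.elim a b) (.inr i)⟩
  have hX1 : ψ (hatX (fun _ : Fin n => q ^ 2) 1) = prodX q ^ (2 : ℤ) := by
    rw [hatX_one, prodX, prodX, hψpoly, zpow_ofNat, ← map_pow]
    congr 1
    simp [map_prod, Finset.prod_pow]
  have hXT : ∀ {T : Subalgebra K (QField fun _ : Fin n => q)}, (∀ i, InvMem T (a i)) →
      ∀ i < n, InvMem T (ψ (hatX (fun _ : Fin n => q ^ 2) (i + 1))) := by
    intro T haT i hi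
    by_cases h : i = 0
    · subst h
      rw [hX1, ← ha0 ⟨0, hi⟩ rfl]
      exact (haT _).zpow 2
    · rw [← ha1 ⟨i, hi⟩ h]
      exact haT _
  -- The reconstruction takes place in `F_{q²,n}`, with the preimage of the Laurent algebra `T`.
  have hcomap : ∀ {c : QField fun _ : Fin n => q ^ 2}, InvMem T (ψ c) → InvMem (T.comap ψ) c :=
    fun h => ⟨h.1, by rw [Subalgebra.mem_comap, map_inv₀]; exact h.2⟩
  obtain ⟨h0, h1⟩ := chain_mem_of_hat_mem (q ^ 2) hn (T := T.comap ψ)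
    (fun i hi => hcomap (hXT haT i hi)) (fun i hi => hcomap (hbT ⟨i, hi⟩))
  obtain ⟨hint, hy⟩ := isIntegral_and_mem_of_chain_mem (q ^ 2) h0 h1
  obtain ⟨χ, hχa, hχb, hχ⟩ := hrel.exists_algHom hn
    (fun i => by
      refine IsIntegral.of_pow (n := 2) two_pos ?_
      let f : (T.comap ψ).comap (poly fun _ : Fin n => q ^ 2) →+* T.comap (poly fun _ : Fin n => q) :=
        ((MvPolynomial.expand (R := K) (σ := Fin n) 2).toRingHom.comp
          ((T.comap ψ).comap (poly fun _ : Fin n => q ^ 2)).val.toRingHom).codRestrict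
            (T.comap (poly fun _ : Fin n => q)) fun c => by
              have := c.2
              rw [Subalgebra.mem_comap, Subalgebra.mem_comap, hψpoly] at this
              exact this
      have := (hint i).map_of_comp_eq f (MvPolynomial.expand (R := K) (σ := Fin n) 2).toRingHom
        (RingHom.ext fun c => rfl)
      simpa using this)
    (fun i => by
      have hle : ((poly fun _ : Fin n => q ^ 2).range.toSubmodule * (T.comap ψ).toSubmodule).map
          ψ.toLinearMap ≤ (poly fun _ : Fin n => q).range.toSubmodule * T.toSubmodule := by
        rw [Submodule.map_mul]
        refine mul_le_mul' ?_ ?_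
        · rintro _ ⟨_, ⟨f, rfl⟩, rfl⟩
          exact ⟨_, (hψpoly f).symm⟩
        · rintro _ ⟨c, hc, rfl⟩
          exact hc
      have h := Submodule.mul_mem_mul
        (show x (fun _ : Fin n => q) i ∈ (poly fun _ : Fin n => q).range.toSubmodule from
          ⟨MvPolynomial.X i, poly_X _ i⟩) (hle ⟨_, hy i, hψy i⟩)
      rwa [mul_inv_cancel_left₀ (x_ne_zero i), ← mul_assoc,
        (poly fun _ : Fin n => q).range.isIdempotentElem_toSubmodule.eq] at h)
  have hBD : ∀ c ∈ weylInvariants .B n q, c ∈ weylInvariants .D n q := fun c hc w _ => hc w trivial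
  have hBψ : ∀ c ∈ weylInvariants .A n (q ^ 2), ψ c ∈ weylInvariants .B n q := fun c hc =>
    (mem_weylInvariants_B_iff q hψx hψy hψ _).2 ⟨c, hc, rfl⟩
  have hχinv : ∀ c ∈ χ.range, c⁻¹ ∈ χ.range := SkewFrac.inv_mem_range χ
  have haχ : ∀ i, InvMem χ.range (a i) := fun i =>
    have h : a i ∈ χ.range := ⟨_, hχa i⟩
    ⟨h, hχinv _ h⟩
  have hBχ : ∀ c ∈ weylInvariants .B n q, c ∈ χ.range := by
    intro c hc
    obtain ⟨d, hd, rfl⟩ := (mem_weylInvariants_B_iff q hψx hψy hψ c).1 hc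
    rw [← hφ] at hd
    obtain ⟨d, rfl⟩ := hd
    exact mem_of_gen_mem (φ := ψ.comp φ) hχinv
      (fun i => by rw [AlgHom.comp_apply, hφx]; exact (hXT haχ i i.2).1)
      (fun i => by rw [AlgHom.comp_apply, hφy]; exact ⟨_, hχb i⟩) d
  refine ⟨χ, le_antisymm ?_ fun c hc => ?_⟩
  · rintro _ ⟨c, rfl⟩
    refine mem_of_gen_mem (inv_mem_weylInvariants q) (fun i => ?_) (fun i => ?_) c
    · rw [hχa]
      by_cases hi : (i : ℕ) = 0
      · rw [ha0 i hi, mem_weylInvariants]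
        intro w hw
        rw [weylAut_prodX, show weylSign w = 1 from hw]
        simp
      · rw [ha1 i hi]
        exact hBD _ (hBψ _ (hat_mem_weylInvariants_A _ hn i.2).1)
    · rw [hχb]
      exact hBD _ (hBψ _ (hat_mem_weylInvariants_A _ hn i.2).2)
  · obtain ⟨d, hd, d', hd', rfl⟩ := exists_add_prodX_mul q hn hc
    refine χ.range.add_mem (hBχ _ hd) (χ.range.mul_mem ?_ (hBχ _ hd'))
    rw [← ha0 ⟨0, hn⟩ rfl]
    exact (haχ _).1

/-- The composition of the isomorphism for `S_n` with parameter `q²` and the embedding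
`F_{q²,n} → F_{q,n}`. -/
theorem exists_algHom_range_eq_weylInvariants_B [CharZero K] (hn : 0 < n) :
    ∃ φ : (QField fun _ : Fin n => q ^ 2) →ₐ[K] QField fun _ : Fin n => q,
      φ.range = weylInvariants .B n q := by
  obtain ⟨ψ, hψx, hψy, hψ⟩ := exists_algHom_sq (n := n) q hn
  obtain ⟨φ, hφ, -, -⟩ := exists_algHom_range_eq_weylInvariants_A (n := n) (q ^ 2) hn
  refine ⟨ψ.comp φ, ?_⟩
  ext a
  rw [mem_weylInvariants_B_iff q hψx hψy hψ, ← hφ]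
  constructor
  · rintro ⟨b, rfl⟩
    exact ⟨φ b, ⟨b, rfl⟩, rfl⟩
  · rintro ⟨_, ⟨b, rfl⟩, rfl⟩
    exact ⟨b, rfl⟩

end QField
end EvenSignGroup

theorem mainTheorem2 {K : Type*} [Field K] [CharZero K] (n : ℕ) (hn : 0 < n) (q : Kˣ) :
    (∀ T : ClassicalType, Nonempty (weylInvariants T n q ≃ₐ[K] QField (weylParam n q T))) ∧
    Nonempty (weylInvariants .B n q ≃ₐ[K] weylInvariants .A n (q ^ 2)) ∧
    (∀ i ≤ n, ∀ k ≤ n - i, QField.eRec (fun _ : Fin n => q) i k ∈ weylInvariants .A n q) ∧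
    (∀ i, 1 ≤ i → i ≤ n → QField.bigX (fun _ : Fin n => q) i ≠ 0 ∧
      QField.bigY (fun _ : Fin n => q) i ≠ 0) ∧
    ∃ φ : QField (fun _ : Fin n => q) ≃ₐ[K] weylInvariants .A n q, ∀ k : Fin n,
      (φ (QField.x _ k) : QField fun _ : Fin n => q) = QField.hatX _ (k + 1) ∧
      (φ (QField.y _ k) : QField fun _ : Fin n => q) = QField.hatY _ (k + 1) := by
  obtain ⟨φA, hA, hAx, hAy⟩ := QField.exists_algHom_range_eq_weylInvariants_A (n := n) q hn
  obtain ⟨φA', hA', -, -⟩ := QField.exists_algHom_range_eq_weylInvariants_A (n := n) (q ^ 2) hn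
  obtain ⟨φB, hB⟩ := QField.exists_algHom_range_eq_weylInvariants_B (n := n) q hn
  obtain ⟨φD, hD⟩ := QField.exists_algHom_range_eq_weylInvariants_D (n := n) q hn
  refine ⟨fun T => ?_, ⟨(algEquivOfRange φB hB).symm.trans (algEquivOfRange φA' hA')⟩,
    fun i hi k hk => QField.eRec_mem_weylInvariants_A q i hi k hk hn, fun i hi hi' => ?_,
    algEquivOfRange φA hA, fun k => ⟨hAx k, hAy k⟩⟩
  · cases T with
    | A => exact ⟨(algEquivOfRange φA hA).symm⟩
    | B => exact ⟨(algEquivOfRange φB hB).symm⟩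
    | C => exact ⟨(algEquivOfRange φB hB).symm⟩
    | D => exact ⟨(algEquivOfRange φD hD).symm⟩
  · obtain ⟨i, rfl⟩ : ∃ j, i = j + 1 := ⟨i - 1, by omega⟩
    exact ⟨QField.bigX_ne_zero q hn (by omega), QField.bigY_ne_zero q hn hi'⟩
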